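/- **Theorem (Double Dirac cone at the $\Gamma$ point).** Setting. Let $R^*$ be the rotation of $\mathbb R^2$ by $2\pi/3$, let $\mathbf u_1\in\mathbb R^2$ be nonzero, $\mathbf u_2=-R^*\mathbf u_1$, $\mathbf U=\mathbb Z\mathbf u_1\oplus\mathbb Z\mathbf u_2$, $\Omega=\{c_1\mathbf u_1+c_2\mathbf u_2: c_1,c_2\in(-\tfrac12,\tfrac12)\}$, $\mathbf v_1=\frac13(2\mathbf u_1-\mathbf u_2)$, $\mathbf v_2=\frac13(\mathbf u_1+\mathbf u_2)$, and let $\mathbf q_1$ be given by $\mathbf q_1\cdot\mathbf v_1=2\pi$, $\mathbf q_1\cdot\mathbf v_2=0$. Write $\langle f,g\rangle=\int_\Omega\overline{f}\,g\,d\mathbf x$ and $\tau=e^{2\pi i/3}$. A real function $V\in C^\infty(\mathbb R^2)$ is a super honeycomb lattice potential if it is periodic with respect to $\mathbf u_1,\mathbf u_2,\mathbf v_1,\mathbf v_2$, satisfies $V(R^*\mathbf x)=V(\mathbf x)=V(-\mathbf x)$, and $\frac1{|\Omega|}\int_\Omega e^{-i\mathbf q_1\cdot\mathbf y}V(\mathbf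 y)\,d\mathbf y\ne0$. For $\mathbf k\in\mathbb R^2$ let $E_1(\mathbf k)\le E_2(\mathbf k)\le\cdots$ be the eigenvalues, counted with multiplicity, of $\mathcal H_V=-\Delta+V$ on the space $L^2_{\mathbf k}$ of functions $f\in L^2_{loc}(\mathbb R^2)$ with $f(\mathbf x+\mathbf u)=e^{i\mathbf k\cdot\mathbf u}f(\mathbf x)$ for $\mathbf u\in\mathbf U$. Hypotheses. Let $V$ be a super honeycomb lattice potential, and assume that there are $n_*\ge1$ and $E_D\in\mathbb R$ with $$E_{n_*}(\mathbf 0)<E_D=E_{n_*+1}(\mathbf 0)=E_{n_*+2}(\mathbf 0)=E_{n_*+3}(\mathbf 0)=E_{n_*+4}(\mathbf 0)<E_{n_*+5}(\mathbf 0).$$ Let $\phi_1$ be an eigenfunction of $\mathcal H_V$ on $L^2_{\mathbf 0}$ with eigenvalue $E_D$, $\langle\phi_1,\phi_1\rangle=1$, such that $\phi_1(\mathbf x+\mathbf v_1)=\tau\phi_1(\mathbf x)$ and $\phi_1(R^*\mathbf x)=\tau\phi_1(\mathbf x)$. (Then $\phi_1$, $\phi_2(\mathbf x)=\overline{\phi_1(-\mathbf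 x)}$, $\phi_3(\mathbf x)=\phi_1(-\mathbf x)$, $\phi_4(\mathbf x)=\overline{\phi_1(\mathbf x)}$ are an orthonormal basis of $\ker(\mathcal H_V-E_D)$.) Let $\mathcal Q_\perp$ be the orthogonal projection of $L^2_{\mathbf 0}$ onto $\ker(\mathcal H_V-E_D)^\perp$, let $(\mathcal H_V-E_D)^{-1}$ be the inverse on this subspace, and put $$\boldsymbol v_\sharp=\langle\phi_1,\nabla\phi_2\rangle\in\mathbb C^2,\qquad v_F=\|\boldsymbol v_\sharp\|,$$ $$m(\mathbf k)=\big\langle\phi_1,\,2i\mathbf k\cdot\nabla(\mathcal H_V-E_D)^{-1}\mathcal Q_\perp\,2i\mathbf k\cdot\nabla\phi_1\big\rangle,\qquad b(\mathbf k)=\big\langle\phi_1,\,2i\mathbf k\cdot\nabla(\mathcal H_V-E_D)^{-1}\mathcal Q_\perp\,2i\mathbf k\cdot\nabla\phi_2\big\rangle,$$ $$\check\mu_1(\mathbf k)=\max\big(|2i\mathbf k\cdot\boldsymbol v_\sharp+b(\mathbf k)|,|2i\mathbf k\cdot\boldsymbol v_\sharp-b(\mathbf k)|\big),\qquad \check\mu_2(\mathbf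 k)=\min\big(|2i\mathbf k\cdot\boldsymbol v_\sharp+b(\mathbf k)|,|2i\mathbf k\cdot\boldsymbol v_\sharp-b(\mathbf k)|\big).$$ Assume $v_F\neq0$. Conclusion. The four branches behave conically near $\mathbf k=\mathbf 0$: one has $|2i\mathbf k\cdot\boldsymbol v_\sharp|=\sqrt2\,v_F\|\mathbf k\|$ for all $\mathbf k\in\mathbb R^2$, and, as $\mathbf k\to\mathbf 0$, $$\begin{aligned} E_{n_*+1}(\mathbf k)&=E_D-\check\mu_1(\mathbf k)+\|\mathbf k\|^2-m(\mathbf k)+O(\|\mathbf k\|^3),\\ E_{n_*+2}(\mathbf k)&=E_D-\check\mu_2(\mathbf k)+\|\mathbf k\|^2-m(\mathbf k)+O(\|\mathbf k\|^3),\\ E_{n_*+3}(\mathbf k)&=E_D+\check\mu_2(\mathbf k)+\|\mathbf k\|^2-m(\mathbf k)+O(\|\mathbf k\|^3),\\ E_{n_*+4}(\mathbf k)&=E_D+\check\mu_1(\mathbf k)+\|\mathbf k\|^2-m(\mathbf k)+O(\|\mathbf k\|^3). \end{aligned}$$ -/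

import Mathlib

open scoped ContDiff Topology InnerProductSpace Asymptotics

noncomputable section

namespace SuperHoneycomb

/-- The Euclidean plane. -/
abbrev Plane : Type := EuclideanSpace ℝ (Fin 2)

/-- The rotation `R*` by the angle `2π/3`. -/
def rot (x : Plane) : Plane :=
  !₂[-(1 / 2) * x 0 - Real.sqrt 3 / 2 * x 1, Real.sqrt 3 / 2 * x 0 - 1 / 2 * x 1]

/-- The cube root of unity `τ = e^{2πi/3}`. -/
def tau : ℂ := Complex.exp (2 * Real.pi * Complex.I / 3)

/-- The second period `u₂ = -R* u₁`. -/
def period₂ (u₁ : Plane) : Plane := -rot u₁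

/-- The folding period `v₁ = (2u₁ - u₂)/3`. -/
def fold₁ (u₁ : Plane) : Plane := (1 / 3 : ℝ) • ((2 : ℝ) • u₁ - period₂ u₁)

/-- The folding period `v₂ = (u₁ + u₂)/3`. -/
def fold₂ (u₁ : Plane) : Plane := (1 / 3 : ℝ) • (u₁ + period₂ u₁)

/-- The fundamental cell `Ω = {c₁ u₁ + c₂ u₂ : c₁, c₂ ∈ (-1/2, 1/2)}`. -/
def cell (u₁ : Plane) : Set Plane :=
  {x | ∃ c₁ ∈ Set.Ioo (-(1 / 2) : ℝ) (1 / 2), ∃ c₂ ∈ Set.Ioo (-(1 / 2) : ℝ) (1 / 2),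
    x = c₁ • u₁ + c₂ • period₂ u₁}

/-- Lebesgue measure on the fundamental cell. -/
abbrev cellMeasure (u₁ : Plane) : MeasureTheory.Measure Plane :=
  MeasureTheory.volume.restrict (cell u₁)

/-- The inner product `⟨f, g⟩ = ∫_Ω conj(f) g` of functions on the plane. -/
def cellInner (u₁ : Plane) (f g : Plane → ℂ) : ℂ :=
  ∫ x in cell u₁, (starRingEnd ℂ) (f x) * g x

/-- Super honeycomb lattice potentials with period `u₁`. Invariance under complex conjugation is
expressed by `V` being real valued. The vector `q` in the last field is the dual vector `q₁` of
`v₁`, determined by `q₁ · v₁ = 2π` and `q₁ · v₂ = 0`. -/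
structure IsSuperHoneycomb (u₁ : Plane) (V : Plane → ℝ) : Prop where
  u_ne_zero : u₁ ≠ 0
  smooth : ContDiff ℝ ∞ V
  periodic₁ : ∀ x, V (x + u₁) = V x
  periodic₂ : ∀ x, V (x + period₂ u₁) = V x
  rotation : ∀ x, V (rot x) = V x
  even : ∀ x, V (-x) = V x
  folding₁ : ∀ x, V (x + fold₁ u₁) = V x
  folding₂ : ∀ x, V (x + fold₂ u₁) = V x
  nondegenerate : ∃ q : Plane, ⟪q, fold₁ u₁⟫_ℝ = 2 * Real.pi ∧ ⟪q, fold₂ u₁⟫_ℝ = 0 ∧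
    (⨍ y in cell u₁, Complex.exp (-Complex.I * (⟪q, y⟫_ℝ : ℂ)) * (V y : ℂ)) ≠ 0

/-- The smooth functions `f` with `f(x + u) = e^{i k · u} f(x)` for the lattice vectors `u`
(it suffices to ask this for the two generators). For `k = 0` these are the smooth periodic
functions. -/
def smoothBloch (u₁ k : Plane) : Submodule ℂ (Plane → ℂ) where
  carrier := {f | ContDiff ℝ ∞ f ∧
    (∀ x, f (x + u₁) = Complex.exp (Complex.I * (⟪k, u₁⟫_ℝ : ℂ)) * f x) ∧
    (∀ x, f (x + period₂ u₁) = Complex.exp (Complex.I * (⟪k, period₂ u₁⟫_ℝ : ℂ)) * f x)}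
  add_mem' := by
    rintro f g ⟨hf, hf1, hf2⟩ ⟨hg, hg1, hg2⟩
    refine ⟨hf.add hg, fun x => ?_, fun x => ?_⟩
    · simp only [Pi.add_apply, hf1, hg1, mul_add]
    · simp only [Pi.add_apply, hf2, hg2, mul_add]
  zero_mem' := ⟨contDiff_const, fun x => by simp, fun x => by simp⟩
  smul_mem' := by
    rintro c f ⟨hf, hf1, hf2⟩
    refine ⟨contDiff_const.smul hf, fun x => ?_, fun x => ?_⟩
    · simp only [Pi.smul_apply, smul_eq_mul, hf1]; ring
    · simp only [Pi.smul_apply, smul_eq_mul, hf2]; ring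

/-- The differential expression `(H_V - E) f = -Δ f + V f - E f`. -/
def shifted (V : Plane → ℝ) (E : ℝ) (f : Plane → ℂ) : Plane → ℂ :=
  fun x => -(Laplacian.laplacian f x) + (V x : ℂ) * f x - (E : ℂ) * f x

/-- The eigenspace `ker (H_V - E)` of `H_V = -Δ + V` on the space `L²_k` of quasi-periodic
functions. A function in `L²_k` is determined by its restriction to the cell, so `L²_k` is
represented by `L²(Ω)`; the quasi-momentum enters through the test functions. An element `f`
belongs to the eigenspace if `-Δ f + V f = E f` holds weakly:
`⟨(H_V - E) ψ, f⟩ = 0` for all smooth quasi-periodic `ψ`. -/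
def eigenspace (u₁ : Plane) (V : Plane → ℝ) (k : Plane) (E : ℝ) :
    Submodule ℂ (MeasureTheory.Lp ℂ 2 (cellMeasure u₁)) :=
  (Submodule.span ℂ {g : MeasureTheory.Lp ℂ 2 (cellMeasure u₁) |
    ∃ ψ ∈ smoothBloch u₁ k, g =ᵐ[cellMeasure u₁] shifted V E ψ})ᗮ

/-- The band function `E_n(k)`, `n ≥ 1`: the `n`-th eigenvalue of `H_V` on `L²_k`, in
nondecreasing order and counted with multiplicity, i.e. the least `E` such that the eigenspaces
with eigenvalues at most `E` span a space of dimension at least `n`. -/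
def band (u₁ : Plane) (V : Plane → ℝ) (n : ℕ) (k : Plane) : ℝ :=
  sInf {E : ℝ | (n : Cardinal) ≤
    Module.rank ℂ (⨆ (l : ℝ) (_ : l ≤ E), eigenspace u₁ V k l :
      Submodule ℂ (MeasureTheory.Lp ℂ 2 (cellMeasure u₁)))}

/-- The fourfold degeneracy at the point `k = 0`:
`E_n(0) < E_D = E_{n+1}(0) = ⋯ = E_{n+4}(0) < E_{n+5}(0)`. -/
structure FourfoldDegeneracy (u₁ : Plane) (V : Plane → ℝ) (n : ℕ) (ED : ℝ) : Prop where
  pos : 1 ≤ n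
  below : band u₁ V n 0 < ED
  eq₁ : band u₁ V (n + 1) 0 = ED
  eq₂ : band u₁ V (n + 2) 0 = ED
  eq₃ : band u₁ V (n + 3) 0 = ED
  eq₄ : band u₁ V (n + 4) 0 = ED
  above : ED < band u₁ V (n + 5) 0

/-- A normalized eigenfunction `φ₁` of `H_V` with eigenvalue `E_D` in the space `χ_{τ,τ}` of
periodic functions with `φ₁(x + v₁) = τ φ₁(x)` and `φ₁(R* x) = τ φ₁(x)`. The function is taken
smooth, which eigenfunctions are since `V` is smooth. -/
structure IsDiracState (u₁ : Plane) (V : Plane → ℝ) (ED : ℝ) (φ : Plane → ℂ) : Prop where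
  mem : φ ∈ smoothBloch u₁ 0
  folding : ∀ x, φ (x + fold₁ u₁) = tau * φ x
  rotation : ∀ x, φ (rot x) = tau * φ x
  normalized : cellInner u₁ φ φ = 1
  eigen : ∀ x, shifted V ED φ x = 0

/-- `φ₂(x) = conj(φ₁(-x))`. -/
def partner (φ : Plane → ℂ) : Plane → ℂ := fun x => (starRingEnd ℂ) (φ (-x))

/-- The operator `2 i k · ∇`. -/
def twoIkGrad (k : Plane) (f : Plane → ℂ) : Plane → ℂ :=
  fun x => 2 * Complex.I * fderiv ℝ f x k

/-- The smooth periodic solutions of `H_V f = E f`, that is `Ker (H_V - E)` at `k = 0`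
(all its elements are smooth since `V` is). -/
def periodicKer (u₁ : Plane) (V : Plane → ℝ) (E : ℝ) : Set (Plane → ℂ) :=
  {f | f ∈ smoothBloch u₁ 0 ∧ ∀ x, shifted V E f x = 0}

/-- `f` is orthogonal to `Ker (H_V - E)` in `L²(Ω)`. -/
def PerpKer (u₁ : Plane) (V : Plane → ℝ) (E : ℝ) (f : Plane → ℂ) : Prop :=
  ∀ h ∈ periodicKer u₁ V E, cellInner u₁ h f = 0

/-- `h = Q_⊥ g`, with `Q_⊥` the orthogonal projection onto `Ker (H_V - E)^⊥`. -/
def IsPerpPart (u₁ : Plane) (V : Plane → ℝ) (E : ℝ) (g h : Plane → ℂ) : Prop :=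
  g - h ∈ periodicKer u₁ V E ∧ PerpKer u₁ V E h

/-- `ψ = (H_V - E)⁻¹ Q_⊥ g`, the inverse being taken on `Ker (H_V - E)^⊥`: the function `ψ` is
periodic and orthogonal to `Ker (H_V - E)`, and `(H_V - E) ψ = Q_⊥ g`. -/
def IsReducedResolvent (u₁ : Plane) (V : Plane → ℝ) (E : ℝ) (g ψ : Plane → ℂ) : Prop :=
  ψ ∈ smoothBloch u₁ 0 ∧ PerpKer u₁ V E ψ ∧ IsPerpPart u₁ V E g (shifted V E ψ)

open Classical in
/-- The operator `(H_V - E)⁻¹ Q_⊥` on smooth periodic functions `g`. -/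
def reducedResolvent (u₁ : Plane) (V : Plane → ℝ) (E : ℝ) (g : Plane → ℂ) : Plane → ℂ :=
  if h : ∃ ψ, IsReducedResolvent u₁ V E g ψ then h.choose else 0

/-- The vector `v_♯ = ⟨φ₁, ∇ φ₂⟩ ∈ ℂ²`, where `φ₂(x) = conj(φ₁(-x))`. -/
def vSharp (u₁ : Plane) (φ : Plane → ℂ) : EuclideanSpace ℂ (Fin 2) :=
  WithLp.toLp 2 fun j =>
    cellInner u₁ φ fun x => fderiv ℝ (partner φ) x (EuclideanSpace.single j 1)

/-- The number `2 i k · v = 2 i (k₁ v₁ + k₂ v₂)`. -/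
def twoIkDot (k : Plane) (v : EuclideanSpace ℂ (Fin 2)) : ℂ :=
  2 * Complex.I * ∑ j, (k j : ℂ) * v j

/-- `m(k) = ⟨φ₁, 2ik·∇ (H_V - E)⁻¹ Q_⊥ 2ik·∇ φ₁⟩`. -/
def mTerm (u₁ : Plane) (V : Plane → ℝ) (E : ℝ) (φ : Plane → ℂ) (k : Plane) : ℂ :=
  cellInner u₁ φ (twoIkGrad k (reducedResolvent u₁ V E (twoIkGrad k φ)))

/-- `b(k) = ⟨φ₁, 2ik·∇ (H_V - E)⁻¹ Q_⊥ 2ik·∇ φ₂⟩`, where `φ₂(x) = conj(φ₁(-x))`. -/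
def bTerm (u₁ : Plane) (V : Plane → ℝ) (E : ℝ) (φ : Plane → ℂ) (k : Plane) : ℂ :=
  cellInner u₁ φ (twoIkGrad k (reducedResolvent u₁ V E (twoIkGrad k (partner φ))))

/-- The larger of `|2ik·v_♯ + b(k)|` and `|2ik·v_♯ - b(k)|`. -/
def muCheck₁ (u₁ : Plane) (V : Plane → ℝ) (E : ℝ) (φ : Plane → ℂ) (k : Plane) : ℝ :=
  max ‖twoIkDot k (vSharp u₁ φ) + bTerm u₁ V E φ k‖ ‖twoIkDot k (vSharp u₁ φ) - bTerm u₁ V E φ k‖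

/-- The smaller of `|2ik·v_♯ + b(k)|` and `|2ik·v_♯ - b(k)|`. -/
def muCheck₂ (u₁ : Plane) (V : Plane → ℝ) (E : ℝ) (φ : Plane → ℂ) (k : Plane) : ℝ :=
  min ‖twoIkDot k (vSharp u₁ φ) + bTerm u₁ V E φ k‖ ‖twoIkDot k (vSharp u₁ φ) - bTerm u₁ V E φ k‖

end SuperHoneycomb

end

open scoped ContDiff Topology InnerProductSpace Asymptotics

noncomputable section

namespace SuperHoneycomb

open MeasureTheory Set

/-! ### Geometry of the period cell and the torus. -/

section

/-! ### Lattice coordinates -/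

/-! Removing the phase `e^{ik·x}` turns `H_V` on `L²_k` into `H_V - 2ik·∇ + |k|²` on periodic
functions (`hamiltonian_phaseMap`), so small `k` perturbs the fourfold eigenvalue `E_D`. Translation
by `v₁` commutes with every term and splits the kernel into two sectors, spanned by `φ₁, φ₂`
(character `τ`) and by `φ₃, φ₄` (character `τ̄`), which `x ↦ -x` exchanges. The rotation annihilates
the diagonal first-order entries and forces `v_♯` to be a multiple of `(1, i)`; this gives
`|2ik·v_♯| = √2 v_F |k|`. To second order the effective matrix of a sector has diagonal `|k|² - m`
and off-diagonal entry `-(±2ik·v_♯ + b)` with its conjugate. The sign distinguishes the sectors,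
because the reflection reverses one gradient but preserves a product of two. The eigenvalues `|k|² -
m ± |±2ik·v_♯ + b|` are the four asserted ones.

The remainder is controlled by quasimodes. Two corrections by the reduced resolvent leave a residual
`O(|k|³)` (`hamiltonian_mode_add_corr`, `residual_mem_ofOrder`). A dimension count
(`card_le_of_norm_sub_le`) then shows that an interval between two effective eigenvalues, widened by
`C|k|³`, contains at least as many true eigenvalues as effective ones (`exists_window`). Whole
subspaces are tested, so crossings do no harm. Conversely, the gap at `k = 0` and the stability of
the counting function (`count_le_count_of_norm_le`) keep at least `n` eigenvalues below the cluster
and at most `n + 4` up to its top. The windows therefore determine each band up to third order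
(`exists_abs_band_sub_le`).

The bands are defined by weak eigenspaces in `L²(Ω)`. They are made accessible by the plane-wave
basis, a compact resolvent (`exists_resolvent`) and elliptic regularity through decay of Fourier
coefficients (`exists_smooth_of_weak`). Together these yield a Hilbert basis of smooth
eigenfunctions (`nonempty_eigenBasis`), and counting its eigenvalues computes the bands
(`rank_iSup_eigenspace`). -/

/-- The vectors dual to the periods: `⟪dualVec u₁ i, u_j⟫ = δ_ij`. -/
def dualVec (u₁ : Plane) : Fin 2 → Plane :=
  ![(‖u₁‖ ^ 2)⁻¹ • ((4 / 3 : ℝ) • u₁ - (2 / 3 : ℝ) • period₂ u₁),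
    (‖u₁‖ ^ 2)⁻¹ • ((4 / 3 : ℝ) • period₂ u₁ - (2 / 3 : ℝ) • u₁)]

lemma plane_inner (x y : Plane) : ⟪x, y⟫_ℝ = x 0 * y 0 + x 1 * y 1 := by
  simp [PiLp.inner_apply, Fin.sum_univ_two, mul_comm]

lemma plane_norm_sq (x : Plane) : ‖x‖ ^ 2 = x 0 ^ 2 + x 1 ^ 2 := by
  rw [EuclideanSpace.norm_sq_eq, Fin.sum_univ_two, Real.norm_eq_abs, Real.norm_eq_abs, sq_abs,
    sq_abs]

@[simp] lemma rot_zero_coord (x : Plane) : rot x 0 = -(1 / 2) * x 0 - Real.sqrt 3 / 2 * x 1 := rfl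
@[simp] lemma rot_one_coord (x : Plane) : rot x 1 = Real.sqrt 3 / 2 * x 0 - 1 / 2 * x 1 := rfl

@[simp] lemma period₂_zero_coord (x : Plane) :
    period₂ x 0 = 1 / 2 * x 0 + Real.sqrt 3 / 2 * x 1 := by
  simp [period₂]; ring

@[simp] lemma period₂_one_coord (x : Plane) :
    period₂ x 1 = -(Real.sqrt 3 / 2 * x 0) + 1 / 2 * x 1 := by
  simp [period₂]; ring

lemma sqrt_three_sq : Real.sqrt 3 ^ 2 = 3 := Real.sq_sqrt (by norm_num)

lemma sqrt_three_mul : Real.sqrt 3 * Real.sqrt 3 = 3 := Real.mul_self_sqrt (by norm_num)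

lemma plane_ext {x y : Plane} (h0 : x 0 = y 0) (h1 : x 1 = y 1) : x = y := by
  ext i; fin_cases i <;> assumption

variable {u₁ : Plane}

lemma dualVec_inner_eq (x : Plane) :
    ⟪dualVec u₁ 0, x⟫_ℝ = (‖u₁‖ ^ 2)⁻¹ *
      ((4 / 3) * (u₁ 0 * x 0 + u₁ 1 * x 1) -
        (2 / 3) * (period₂ u₁ 0 * x 0 + period₂ u₁ 1 * x 1)) ∧
    ⟪dualVec u₁ 1, x⟫_ℝ = (‖u₁‖ ^ 2)⁻¹ *
      ((4 / 3) * (period₂ u₁ 0 * x 0 + period₂ u₁ 1 * x 1) -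
        (2 / 3) * (u₁ 0 * x 0 + u₁ 1 * x 1)) := by
  constructor <;>
    simp only [dualVec, Matrix.cons_val_zero, Matrix.cons_val_one, real_inner_smul_left,
      inner_sub_left, plane_inner]

lemma dualVec_inner_periods (hu : u₁ ≠ 0) :
    ⟪dualVec u₁ 0, u₁⟫_ℝ = 1 ∧ ⟪dualVec u₁ 0, period₂ u₁⟫_ℝ = 0 ∧
    ⟪dualVec u₁ 1, u₁⟫_ℝ = 0 ∧ ⟪dualVec u₁ 1, period₂ u₁⟫_ℝ = 1 := by
  have hn : ‖u₁‖ ^ 2 ≠ 0 := by simpa using hu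
  have hn' := hn
  rw [plane_norm_sq] at hn'
  have h3 := sqrt_three_sq
  simp only [dualVec_inner_eq, plane_norm_sq, period₂_zero_coord, period₂_one_coord]
  refine ⟨?_, ?_, ?_, ?_⟩
  · rw [inv_mul_eq_iff_eq_mul₀ hn']; ring
  · rw [inv_mul_eq_iff_eq_mul₀ hn']; ring_nf; rw [h3]; ring
  · rw [inv_mul_eq_iff_eq_mul₀ hn']; ring
  · rw [inv_mul_eq_iff_eq_mul₀ hn']; ring_nf; rw [h3]; ring

lemma sum_dualVec_smul (hu : u₁ ≠ 0) (x : Plane) :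
    ⟪dualVec u₁ 0, x⟫_ℝ • u₁ + ⟪dualVec u₁ 1, x⟫_ℝ • period₂ u₁ = x := by
  have hn : ‖u₁‖ ^ 2 ≠ 0 := by simpa using hu
  have hn' := hn
  rw [plane_norm_sq] at hn'
  have h3 := sqrt_three_sq
  apply plane_ext <;>
  · simp only [dualVec_inner_eq, plane_norm_sq, PiLp.add_apply, PiLp.smul_apply, smul_eq_mul,
      period₂_zero_coord, period₂_one_coord]
    field_simp
    ring_nf
    simp only [h3]
    ring

/-- Coordinates with respect to the periods `u₁`, `u₂`. -/
def coordEquiv (hu : u₁ ≠ 0) : Plane ≃L[ℝ] (Fin 2 → ℝ) :=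
  LinearEquiv.toContinuousLinearEquiv
    { toFun := fun x i => ⟪dualVec u₁ i, x⟫_ℝ
      map_add' := fun x y => by ext i; simp [inner_add_right]
      map_smul' := fun c x => by ext i; simp [real_inner_smul_right]
      invFun := fun c => c 0 • u₁ + c 1 • period₂ u₁
      left_inv := fun x => sum_dualVec_smul hu x
      right_inv := fun c => by
        obtain ⟨h1, h2, h3, h4⟩ := dualVec_inner_periods hu
        ext i
        fin_cases i <;> simp [inner_add_right, real_inner_smul_right, h1, h2, h3, h4] }

@[simp] lemma coordEquiv_apply (hu : u₁ ≠ 0) (x : Plane) (i : Fin 2) :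
    coordEquiv hu x i = ⟪dualVec u₁ i, x⟫_ℝ := rfl

@[simp] lemma coordEquiv_symm_apply (hu : u₁ ≠ 0) (c : Fin 2 → ℝ) :
    (coordEquiv hu).symm c = c 0 • u₁ + c 1 • period₂ u₁ := rfl

/-- The open unit square centred at the origin. -/
def centredSquare : Set (Fin 2 → ℝ) := univ.pi fun _ => Ioo (-(1 / 2) : ℝ) (1 / 2)

lemma isOpen_centredSquare : IsOpen centredSquare := isOpen_set_pi finite_univ fun _ _ => isOpen_Ioo

lemma cell_eq_preimage (hu : u₁ ≠ 0) : cell u₁ = coordEquiv hu ⁻¹' centredSquare := by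
  ext x
  constructor
  · rintro ⟨c₁, h1, c₂, h2, rfl⟩
    have : c₁ • u₁ + c₂ • period₂ u₁ = (coordEquiv hu).symm ![c₁, c₂] := by simp
    rw [this, mem_preimage, ContinuousLinearEquiv.apply_symm_apply]
    intro i _
    fin_cases i
    · exact h1
    · exact h2
  · intro h
    exact ⟨_, h 0 trivial, _, h 1 trivial, ((coordEquiv hu).symm_apply_apply x).symm⟩

lemma isOpen_cell (hu : u₁ ≠ 0) : IsOpen (cell u₁) := by
  rw [cell_eq_preimage hu]
  exact isOpen_centredSquare.preimage (coordEquiv hu).continuous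

lemma measurableSet_cell (hu : u₁ ≠ 0) : MeasurableSet (cell u₁) := (isOpen_cell hu).measurableSet

lemma isBounded_cell (hu : u₁ ≠ 0) : Bornology.IsBounded (cell u₁) := by
  rw [cell_eq_preimage hu]
  have h1 : Bornology.IsBounded (centredSquare) :=
    Bornology.IsBounded.pi fun _ => Metric.isBounded_Ioo _ _
  have h2 := (coordEquiv hu).symm.lipschitz.isBounded_image h1
  rwa [ContinuousLinearEquiv.image_symm_eq_preimage] at h2

instance isFiniteMeasure_cellMeasure [Fact (u₁ ≠ 0)] : IsFiniteMeasure (cellMeasure u₁) :=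
  ⟨by simpa using (isBounded_cell (u₁ := u₁) Fact.out).measure_lt_top⟩

/-! ### The covering of the torus -/

/-- The covering map from the plane to the torus `ℝ² / U`. -/
def torusMap (u₁ : Plane) (x : Plane) : UnitAddTorus (Fin 2) :=
  fun i => ((⟪dualVec u₁ i, x⟫_ℝ : ℝ) : UnitAddCircle)

/-- A section of the covering map with values in the closure of the cell. -/
def torusSection (u₁ : Plane) (t : UnitAddTorus (Fin 2)) : Plane :=
  (AddCircle.equivIoc 1 (-(1 / 2) : ℝ) (t 0) : ℝ) • u₁ +
    (AddCircle.equivIoc 1 (-(1 / 2) : ℝ) (t 1) : ℝ) • period₂ u₁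

lemma continuous_torusMap : Continuous (torusMap u₁) := by
  unfold torusMap
  refine continuous_pi fun i => ?_
  exact (AddCircle.continuous_mk' 1).comp (continuous_const.inner continuous_id)

lemma measurable_torusSection : Measurable (torusSection u₁) := by
  unfold torusSection
  have h (i : Fin 2) : Measurable fun t : UnitAddTorus (Fin 2) =>
      ((AddCircle.equivIoc 1 (-(1 / 2) : ℝ) (t i) : ℝ)) :=
    (measurable_subtype_coe.comp (AddCircle.measurableEquivIoc 1 (-(1 / 2))).measurable).comp
      (measurable_pi_apply i)
  exact ((h 0).smul_const _).add ((h 1).smul_const _)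

lemma torusMap_torusSection (hu : u₁ ≠ 0) (t : UnitAddTorus (Fin 2)) :
    torusMap u₁ (torusSection u₁ t) = t := by
  obtain ⟨h1, h2, h3, h4⟩ := dualVec_inner_periods hu
  ext i
  fin_cases i <;>
    simp [torusMap, torusSection, inner_add_right, real_inner_smul_right, h1, h2, h3, h4,
      AddCircle.coe_equivIoc]

lemma torusSection_torusMap (hu : u₁ ≠ 0) {x : Plane} (hx : x ∈ cell u₁) :
    torusSection u₁ (torusMap u₁ x) = x := by
  rw [cell_eq_preimage hu] at hx
  have h (i : Fin 2) : (AddCircle.equivIoc 1 (-(1 / 2) : ℝ) (torusMap u₁ x i) : ℝ) =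
      ⟪dualVec u₁ i, x⟫_ℝ := by
    have := hx i trivial
    simp only [coordEquiv_apply, mem_Ioo] at this
    exact AddCircle.equivIoc_coe_of_mem ⟨this.1, by linarith [this.2]⟩
  rw [torusSection, h, h, sum_dualVec_smul hu]

lemma torusMap_add (x y : Plane) : torusMap u₁ (x + y) = torusMap u₁ x + torusMap u₁ y := by
  ext i; simp [torusMap, inner_add_right]

/-- The image of the measure of the cell on the torus. -/
def torusMeasure (u₁ : Plane) : Measure (UnitAddTorus (Fin 2)) :=
  (cellMeasure u₁).map (torusMap u₁)

/-- The open square differs by a null set from the half-open one, which is a fundamental domain of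
`ℤ²`. -/
lemma map_mk_centredSquare :
    (volume.restrict centredSquare).map (fun (c : Fin 2 → ℝ) (i : Fin 2) => (c i : UnitAddCircle)) =
      Measure.pi fun _ => (volume : Measure (AddCircle (1 : ℝ))) := by
  have h := measurePreserving_pi _ _
    (fun _ : Fin 2 => AddCircle.measurePreserving_mk 1 (-(1 / 2) : ℝ))
  rw [← h.map_eq, ← Measure.restrict_pi_pi]
  congr 1
  refine Measure.restrict_congr_set ?_
  have h2 := Measure.pi_Ioo_ae_eq_pi_Ioc (μ := fun _ : Fin 2 => (volume : Measure ℝ)) (s := univ)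
    (f := fun _ => -(1 / 2)) (g := fun _ => -(1 / 2) + 1)
  have e : (-(1 / 2) + 1 : ℝ) = 1 / 2 := by norm_num
  rw [e] at h2 ⊢
  exact h2

/-- Linear coordinates multiply Lebesgue measure by a constant `c`. Its value is irrelevant: any
nonzero finite multiple of Haar measure is invariant under translations and continuous
automorphisms, and this is all that the symmetries require. -/
lemma isAddHaarMeasure_torusMeasure (hu : u₁ ≠ 0) : (torusMeasure u₁).IsAddHaarMeasure := by
  have h1 : ((volume : Measure Plane).map (coordEquiv hu)).IsAddHaarMeasure :=
    (coordEquiv hu).isAddHaarMeasure_map _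
  obtain ⟨c, hc0, hct, hc⟩ : ∃ c : ENNReal, c ≠ 0 ∧ c ≠ ⊤ ∧
      (volume : Measure Plane).map (coordEquiv hu) = c • (volume : Measure (Fin 2 → ℝ)) :=
    ⟨_, by simpa using (Measure.addHaarScalarFactor_pos_of_isAddHaarMeasure _ _).ne',
      ENNReal.coe_ne_top, Measure.isAddLeftInvariant_eq_smul
        ((volume : Measure Plane).map (coordEquiv hu)) (volume : Measure (Fin 2 → ℝ))⟩
  have h3 : (cellMeasure u₁).map (coordEquiv hu) = c • volume.restrict centredSquare := by
    rw [← Measure.restrict_smul, ← hc]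
    rw [cellMeasure, cell_eq_preimage hu,
      Measure.restrict_map (coordEquiv hu).continuous.measurable isOpen_centredSquare.measurableSet]
  have h4 : torusMeasure u₁ = c • Measure.pi fun _ => (volume : Measure (AddCircle (1 : ℝ))) := by
    rw [← map_mk_centredSquare, ← Measure.map_smul, ← h3, Measure.map_map]
    · rfl
    · exact measurable_pi_lambda _ fun i => AddCircle.measurable_mk'.comp (measurable_pi_apply i)
    · exact (coordEquiv hu).continuous.measurable
  rw [h4]
  exact Measure.IsAddHaarMeasure.smul _ hc0 hct

lemma measurePreserving_torusMap :
    MeasurePreserving (torusMap u₁) (cellMeasure u₁) (torusMeasure u₁) :=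
  continuous_torusMap.measurable.measurePreserving _

lemma measurePreserving_torusSection (hu : u₁ ≠ 0) :
    MeasurePreserving (torusSection u₁) (torusMeasure u₁) (cellMeasure u₁) := by
  refine ⟨measurable_torusSection, ?_⟩
  rw [torusMeasure, Measure.map_map measurable_torusSection continuous_torusMap.measurable]
  conv_rhs => rw [← Measure.map_id (μ := cellMeasure u₁)]
  refine Measure.map_congr ?_
  filter_upwards [ae_restrict_mem (measurableSet_cell hu)] with x hx
  exact torusSection_torusMap hu hx

/-- Functions with the periods `u₁` and `u₂`. -/
def IsPeriodic {α : Type*} (u₁ : Plane) (f : Plane → α) : Prop :=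
  (∀ x, f (x + u₁) = f x) ∧ ∀ x, f (x + period₂ u₁) = f x

lemma exists_lattice_of_torusMap_eq (hu : u₁ ≠ 0) {x y : Plane}
    (h : torusMap u₁ x = torusMap u₁ y) : ∃ a b : ℤ, y = x + a • u₁ + b • period₂ u₁ := by
  have h0 (i : Fin 2) : ∃ n : ℤ, (n : ℝ) = ⟪dualVec u₁ i, y⟫_ℝ - ⟪dualVec u₁ i, x⟫_ℝ := by
    have := congrFun h i
    simp only [torusMap] at this
    have h2 : ((⟪dualVec u₁ i, y⟫_ℝ - ⟪dualVec u₁ i, x⟫_ℝ : ℝ) : UnitAddCircle) = 0 := by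
      rw [AddCircle.coe_sub, this, sub_self]
    obtain ⟨n, hn⟩ := (AddCircle.coe_eq_zero_iff 1).1 h2
    exact ⟨n, by simpa using hn⟩
  obtain ⟨a, ha⟩ := h0 0
  obtain ⟨b, hb⟩ := h0 1
  refine ⟨a, b, ?_⟩
  rw [← sum_dualVec_smul hu (y), ← Int.cast_smul_eq_zsmul ℝ a, ← Int.cast_smul_eq_zsmul ℝ b, ha, hb]
  conv_rhs => enter [1, 1]; rw [← sum_dualVec_smul hu x]
  module

lemma IsPeriodic.eq_of_torusMap_eq {α : Type*} {f : Plane → α} (hf : IsPeriodic u₁ f) (hu : u₁ ≠ 0)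
    {x y : Plane} (h : torusMap u₁ x = torusMap u₁ y) : f x = f y := by
  obtain ⟨a, b, rfl⟩ := exists_lattice_of_torusMap_eq hu h
  rw [Function.Periodic.zsmul (show Function.Periodic f (period₂ u₁) from hf.2) b,
    Function.Periodic.zsmul (show Function.Periodic f u₁ from hf.1) a]

/-- The integral over the cell of a periodic function is invariant under every map of the plane
that descends to a measure preserving map of the torus. -/
lemma IsPeriodic.setIntegral_comp {f : Plane → ℂ} (hf : IsPeriodic u₁ f) (hc : Continuous f)
    (hu : u₁ ≠ 0) {s : Plane → Plane} (hs : Continuous s)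
    {σ : UnitAddTorus (Fin 2) → UnitAddTorus (Fin 2)}
    (hσ : MeasurePreserving σ (torusMeasure u₁) (torusMeasure u₁))
    (h : ∀ x, torusMap u₁ (s x) = σ (torusMap u₁ x)) :
    ∫ x in cell u₁, f (s x) = ∫ x in cell u₁, f x := by
  have hp := measurePreserving_torusSection hu
  have key (g : Plane → ℂ) (hg : Continuous g) :
      ∫ x in cell u₁, g x = ∫ t, g (torusSection u₁ t) ∂(torusMeasure u₁) := by
    change ∫ x, g x ∂(cellMeasure u₁) = _
    rw [← hp.map_eq, integral_map hp.measurable.aemeasurable hg.aestronglyMeasurable]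
  rw [key (fun x => f (s x)) (hc.comp hs), key _ hc]
  -- `s` need not commute with the section, but both points lie over `σ t`, and `f` is periodic.
  have e (t) : f (s (torusSection u₁ t)) = f (torusSection u₁ (σ t)) := by
    refine hf.eq_of_torusMap_eq hu ?_
    rw [h, torusMap_torusSection hu, torusMap_torusSection hu]
  simp_rw [e]
  conv_rhs => rw [← hσ.map_eq]
  rw [integral_map hσ.measurable.aemeasurable]
  rw [hσ.map_eq]
  exact (hc.measurable.comp measurable_torusSection).aestronglyMeasurable

lemma IsPeriodic.setIntegral_add {f : Plane → ℂ} (hf : IsPeriodic u₁ f) (hc : Continuous f)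
    (hu : u₁ ≠ 0) (v : Plane) : ∫ x in cell u₁, f (x + v) = ∫ x in cell u₁, f x := by
  have := isAddHaarMeasure_torusMeasure hu
  exact hf.setIntegral_comp hc hu (by fun_prop)
    (measurePreserving_add_right (torusMeasure u₁) (torusMap u₁ v)) fun x => torusMap_add x v

lemma IsPeriodic.setIntegral_neg {f : Plane → ℂ} (hf : IsPeriodic u₁ f) (hc : Continuous f)
    (hu : u₁ ≠ 0) : ∫ x in cell u₁, f (-x) = ∫ x in cell u₁, f x := by
  have := isAddHaarMeasure_torusMeasure hu
  exact hf.setIntegral_comp hc hu (by fun_prop)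
    (σ := negAddMonoidHom (α := UnitAddTorus (Fin 2)))
    (AddMonoidHom.measurePreserving continuous_neg neg_surjective rfl)
    fun x => by ext i; simp [torusMap]

lemma rot_add (x y : Plane) : rot (x + y) = rot x + rot y := by
  apply plane_ext <;> simp <;> ring

lemma rot_smul (c : ℝ) (x : Plane) : rot (c • x) = c • rot x := by
  apply plane_ext <;> simp <;> ring

/-- The rotation as a continuous linear map. -/
def rotCLM : Plane →L[ℝ] Plane :=
  LinearMap.toContinuousLinearMap { toFun := rot, map_add' := rot_add, map_smul' := rot_smul }

@[simp] lemma rotCLM_apply (x : Plane) : rotCLM x = rot x := rfl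

/-- The orbit of a rotation of order three has its centre of mass at the origin. This gives the
action on the lattice, and later the vanishing of matrix elements in `inner_gradOp_eq_zero`. -/
lemma add_rot_add_rot_rot (x : Plane) : x + rot x + rot (rot x) = 0 := by
  have h3 := sqrt_three_mul
  apply plane_ext <;> simp <;> ring_nf <;> simp only [sqrt_three_sq] <;> ring

lemma rot_period₁ : rot u₁ = -period₂ u₁ := by simp [period₂]

lemma rot_period₂ : rot (period₂ u₁) = u₁ - period₂ u₁ := by
  have h := add_rot_add_rot_rot u₁
  have : rot (period₂ u₁) = - rot (rot u₁) := by
    rw [period₂, ← rotCLM_apply, map_neg, rotCLM_apply]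
  rw [this, period₂]
  rw [sub_neg_eq_add, neg_eq_iff_add_eq_zero, ← h]; abel

/-- In lattice coordinates the rotation has an integer matrix, so it descends to the torus as
`torusRot`. -/
lemma dualVec_inner_rot (hu : u₁ ≠ 0) (x : Plane) :
    ⟪dualVec u₁ 0, rot x⟫_ℝ = ⟪dualVec u₁ 1, x⟫_ℝ ∧
    ⟪dualVec u₁ 1, rot x⟫_ℝ = -⟪dualVec u₁ 0, x⟫_ℝ - ⟪dualVec u₁ 1, x⟫_ℝ := by
  obtain ⟨h1, h2, h3, h4⟩ := dualVec_inner_periods hu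
  have e : rot x = ⟪dualVec u₁ 0, x⟫_ℝ • (-period₂ u₁) +
      ⟪dualVec u₁ 1, x⟫_ℝ • (u₁ - period₂ u₁) := by
    conv_lhs => rw [← sum_dualVec_smul hu x]
    rw [rot_add, rot_smul, rot_smul, rot_period₁, rot_period₂]
  rw [e]
  constructor <;>
  · simp only [inner_add_right, real_inner_smul_right, inner_neg_right, inner_sub_right, h1, h2, h3,
      h4]
    ring

/-- The automorphism of the torus induced by the rotation. -/
def torusRot : UnitAddTorus (Fin 2) →+ UnitAddTorus (Fin 2) where
  toFun t := ![t 1, -t 0 - t 1]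
  map_zero' := by ext i; fin_cases i <;> simp
  map_add' s t := by
    ext i
    fin_cases i
    · simp
    · simp; abel

lemma IsPeriodic.setIntegral_rot {f : Plane → ℂ} (hf : IsPeriodic u₁ f) (hc : Continuous f)
    (hu : u₁ ≠ 0) : ∫ x in cell u₁, f (rot x) = ∫ x in cell u₁, f x := by
  have := isAddHaarMeasure_torusMeasure hu
  refine hf.setIntegral_comp hc hu rotCLM.continuous
    (σ := torusRot) (AddMonoidHom.measurePreserving ?_ ?_ rfl) fun x => ?_
  · refine continuous_pi fun i => ?_
    fin_cases i
    · exact continuous_apply 1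
    · exact (continuous_apply 0).neg.sub (continuous_apply 1)
  · intro t
    refine ⟨![-t 1 - t 0, t 0], ?_⟩
    ext i
    fin_cases i <;> simp [torusRot]
  · ext i
    fin_cases i
    · simp [torusMap, torusRot, (dualVec_inner_rot hu x).1]
    · simp [torusMap, torusRot, (dualVec_inner_rot hu x).2]

end

/-! ### The Hilbert space of the cell and its plane-wave basis. -/

section

variable {u₁ : Plane}

/-! ### Quasi-periodic functions as elements of `L²` of the cell -/

/-- The space `L²(Ω)`. -/
abbrev CellL2 (u₁ : Plane) : Type := Lp ℂ 2 (cellMeasure u₁)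

lemma memLp_cell_of_continuous [hu : Fact (u₁ ≠ 0)] {f : Plane → ℂ} (hf : Continuous f) :
    MemLp f 2 (cellMeasure u₁) := by
  obtain ⟨C, hC⟩ := ((isBounded_cell hu.out).isCompact_closure).exists_bound_of_continuousOn
    hf.continuousOn
  refine MemLp.of_bound hf.aestronglyMeasurable C ?_
  filter_upwards [ae_restrict_mem (measurableSet_cell hu.out)] with x hx
  exact hC x (subset_closure hx)

lemma integrableOn_cell_of_continuous [hu : Fact (u₁ ≠ 0)] {f : Plane → ℂ} (hf : Continuous f) :
    Integrable f (cellMeasure u₁) :=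
  memLp_one_iff_integrable.1 ((memLp_cell_of_continuous hf).mono_exponent (by norm_num))

variable {k : Plane}

lemma smoothBloch_contDiff (f : smoothBloch u₁ k) : ContDiff ℝ ∞ (f : Plane → ℂ) := f.2.1

lemma smoothBloch_continuous (f : smoothBloch u₁ k) : Continuous (f : Plane → ℂ) :=
  f.2.1.continuous

lemma smoothBloch_add_period₁ (f : smoothBloch u₁ k) (x : Plane) :
    f.1 (x + u₁) = Complex.exp (Complex.I * (⟪k, u₁⟫_ℝ : ℂ)) * f.1 x := f.2.2.1 x

lemma smoothBloch_add_period₂ (f : smoothBloch u₁ k) (x : Plane) :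
    f.1 (x + period₂ u₁) = Complex.exp (Complex.I * (⟪k, period₂ u₁⟫_ℝ : ℂ)) * f.1 x := f.2.2.2 x

/-- A smooth quasi-periodic function as an element of `L²(Ω)`. -/
def blochToL2 [Fact (u₁ ≠ 0)] (k : Plane) : smoothBloch u₁ k →ₗ[ℂ] CellL2 u₁ where
  toFun f := (memLp_cell_of_continuous (smoothBloch_continuous f)).toLp f.1
  map_add' f g := MemLp.toLp_add (memLp_cell_of_continuous (smoothBloch_continuous f))
    (memLp_cell_of_continuous (smoothBloch_continuous g))
  map_smul' c f := MemLp.toLp_const_smul c (memLp_cell_of_continuous (smoothBloch_continuous f))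

lemma coeFn_blochToL2 [Fact (u₁ ≠ 0)] (f : smoothBloch u₁ k) :
    blochToL2 k f =ᵐ[cellMeasure u₁] (f : Plane → ℂ) :=
  MemLp.coeFn_toLp (memLp_cell_of_continuous (smoothBloch_continuous f))

lemma inner_blochToL2 [Fact (u₁ ≠ 0)] {k k' : Plane} (f : smoothBloch u₁ k)
    (g : smoothBloch u₁ k') : ⟪blochToL2 k f, blochToL2 k' g⟫_ℂ = cellInner u₁ f g := by
  rw [L2.inner_def, cellInner]
  refine integral_congr_ae ?_
  filter_upwards [coeFn_blochToL2 f, coeFn_blochToL2 g] with x hf hg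
  rw [hf, hg, RCLike.inner_apply, mul_comm]

lemma inner_blochToL2_left [Fact (u₁ ≠ 0)] {k : Plane} (f : smoothBloch u₁ k)
    (g : CellL2 u₁) : ⟪blochToL2 k f, g⟫_ℂ = cellInner u₁ f g := by
  rw [L2.inner_def, cellInner]
  refine integral_congr_ae ?_
  filter_upwards [coeFn_blochToL2 f] with x hf
  rw [hf, RCLike.inner_apply, mul_comm]

lemma eqOn_closure_of_ae_eq [hu : Fact (u₁ ≠ 0)] {f g : Plane → ℂ} (hf : Continuous f)
    (hg : Continuous g) (h : f =ᵐ[cellMeasure u₁] g) : EqOn f g (closure (cell u₁)) :=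
  (Measure.eqOn_open_of_ae_eq h (isOpen_cell hu.out) hf.continuousOn hg.continuousOn).closure hf hg

/-- `equivIoc` includes the right end point, so the section can hit the boundary of the cell. The
closure is exactly where `eqOn_closure_of_ae_eq` still identifies continuous functions. -/
lemma torusSection_mem_closure (hu : u₁ ≠ 0) (t : UnitAddTorus (Fin 2)) :
    torusSection u₁ t ∈ closure (cell u₁) := by
  have h1 : closure (cell u₁) = coordEquiv hu ⁻¹' closure centredSquare := by
    rw [cell_eq_preimage hu]
    exact ((coordEquiv hu).toHomeomorph.preimage_closure _).symm
  have h2 : torusSection u₁ t = (coordEquiv hu).symm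
      fun i => (AddCircle.equivIoc 1 (-(1 / 2) : ℝ) (t i) : ℝ) := rfl
  rw [h1, mem_preimage, h2, ContinuousLinearEquiv.apply_symm_apply, centredSquare, closure_pi_set]
  intro i _
  rw [closure_Ioo (by norm_num)]
  have := (AddCircle.equivIoc 1 (-(1 / 2) : ℝ) (t i)).2
  exact ⟨this.1.le, this.2.trans_eq (by norm_num)⟩

/-- Plane waves. -/
def planeWave (ξ : Plane) (x : Plane) : ℂ := Complex.exp (Complex.I * (⟪ξ, x⟫_ℝ : ℂ))

@[simp] lemma norm_planeWave (ξ x : Plane) : ‖planeWave ξ x‖ = 1 := by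
  rw [planeWave, mul_comm, Complex.norm_exp_ofReal_mul_I]

@[simp] lemma planeWave_zero (x : Plane) : planeWave 0 x = 1 := by simp [planeWave]

lemma planeWave_add_left (ξ η x : Plane) :
    planeWave (ξ + η) x = planeWave ξ x * planeWave η x := by
  rw [planeWave, planeWave, planeWave, ← Complex.exp_add, inner_add_left]
  push_cast; ring_nf

lemma planeWave_add_right (ξ x y : Plane) :
    planeWave ξ (x + y) = planeWave ξ x * planeWave ξ y := by
  rw [planeWave, planeWave, planeWave, ← Complex.exp_add, inner_add_right]
  push_cast; ring_nf

lemma conj_planeWave (ξ x : Plane) : (starRingEnd ℂ) (planeWave ξ x) = planeWave (-ξ) x := by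
  rw [planeWave, planeWave, ← Complex.exp_conj, map_mul, Complex.conj_I, Complex.conj_ofReal,
    inner_neg_left]
  push_cast; ring_nf

lemma contDiff_planeWave (ξ : Plane) : ContDiff ℝ ∞ (planeWave ξ) := by
  unfold planeWave
  refine ContDiff.cexp (contDiff_const.mul ?_)
  exact Complex.ofRealCLM.contDiff.comp (contDiff_const.inner ℝ contDiff_id)

lemma planeWave_ne_zero (ξ x : Plane) : planeWave ξ x ≠ 0 := Complex.exp_ne_zero _

lemma planeWave_neg_mul (ξ x : Plane) : planeWave (-ξ) x * planeWave ξ x = 1 := by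
  rw [← planeWave_add_left, neg_add_cancel, planeWave_zero]

lemma isPeriodic_phase_mul (f : smoothBloch u₁ k) :
    IsPeriodic u₁ fun x => planeWave (-k) x * f.1 x := by
  have e (v x : Plane) : planeWave (-k) (x + v) * (planeWave k v * f.1 x) =
      planeWave (-k) x * f.1 x := by
    rw [planeWave_add_right]
    linear_combination (planeWave (-k) x * f.1 x) * planeWave_neg_mul k v
  refine ⟨fun x => ?_, fun x => ?_⟩
  · beta_reduce
    rw [smoothBloch_add_period₁, ← e u₁ x]; rfl
  · beta_reduce
    rw [smoothBloch_add_period₂, ← e (period₂ u₁) x]; rfl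

lemma IsPeriodic.conj_mul {f g : Plane → ℂ} (hf : IsPeriodic u₁ f) (hg : IsPeriodic u₁ g) :
    IsPeriodic u₁ fun x => (starRingEnd ℂ) (f x) * g x :=
  ⟨fun x => by simp only [hf.1, hg.1], fun x => by simp only [hf.2, hg.2]⟩

lemma isPeriodic_conj_mul (f g : smoothBloch u₁ k) :
    IsPeriodic u₁ fun x => (starRingEnd ℂ) (f.1 x) * g.1 x := by
  have h := (isPeriodic_phase_mul f).conj_mul (isPeriodic_phase_mul g)
  convert h using 2 with x
  rw [map_mul, conj_planeWave, neg_neg]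
  linear_combination -(starRingEnd ℂ) (f.1 x) * g.1 x * planeWave_neg_mul k x

lemma isPeriodic_of_mem_zero (f : smoothBloch u₁ 0) : IsPeriodic u₁ f.1 := by
  simpa using isPeriodic_phase_mul f

/-- Every point is lattice-equivalent to a point of the closed cell. There continuous functions that
agree almost everywhere agree, and periodicity after removal of the phase carries the equality back.
-/
lemma smoothBloch_eq_of_ae_eq [hu : Fact (u₁ ≠ 0)] {f g : smoothBloch u₁ k}
    (h : blochToL2 k f = blochToL2 k g) : f = g := by
  have h1 : (f : Plane → ℂ) =ᵐ[cellMeasure u₁] g := by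
    have := coeFn_blochToL2 f
    rw [h] at this
    exact this.symm.trans (coeFn_blochToL2 g)
  have h2 := eqOn_closure_of_ae_eq (smoothBloch_continuous f) (smoothBloch_continuous g) h1
  ext x
  have hx : torusMap u₁ x = torusMap u₁ (torusSection u₁ (torusMap u₁ x)) :=
    (torusMap_torusSection hu.out _).symm
  have hf := (isPeriodic_phase_mul f).eq_of_torusMap_eq hu.out hx
  have hg := (isPeriodic_phase_mul g).eq_of_torusMap_eq hu.out hx
  rw [h2 (torusSection_mem_closure hu.out _), ← hg] at hf
  exact mul_left_cancel₀ (planeWave_ne_zero _ _) hf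

lemma blochToL2_injective [Fact (u₁ ≠ 0)] : Function.Injective (blochToL2 (u₁ := u₁) k) :=
  fun _ _ h => smoothBloch_eq_of_ae_eq h

/-! ### The Fourier basis -/

/-- The wave vectors `k + G`, where `G` runs through the dual lattice. -/
def waveVec (u₁ k : Plane) (m : Fin 2 → ℤ) : Plane :=
  k + (2 * Real.pi) • ((m 0 : ℝ) • dualVec u₁ 0 + (m 1 : ℝ) • dualVec u₁ 1)

lemma planeWave_waveVec (m : Fin 2 → ℤ) (x : Plane) :
    planeWave (waveVec u₁ k m) x =
      planeWave k x * UnitAddTorus.mFourier m (torusMap u₁ x) := by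
  rw [waveVec, planeWave_add_left]
  congr 1
  simp only [UnitAddTorus.mFourier, ContinuousMap.coe_mk, Fin.prod_univ_two, torusMap,
    fourier_coe_apply, planeWave, inner_smul_left, inner_add_left, ← Complex.exp_add]
  congr 1
  push_cast
  simp
  ring

lemma planeWave_waveVec_mem [hu : Fact (u₁ ≠ 0)] (k : Plane) (m : Fin 2 → ℤ) :
    planeWave (waveVec u₁ k m) ∈ smoothBloch u₁ k := by
  obtain ⟨h1, h2, h3, h4⟩ := dualVec_inner_periods hu.out
  have t (v x : Plane) (hv : torusMap u₁ v = 0) : planeWave (waveVec u₁ k m) (x + v) =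
      planeWave k v * planeWave (waveVec u₁ k m) x := by
    rw [planeWave_waveVec, planeWave_waveVec, torusMap_add, hv, add_zero, planeWave_add_right]
    ring
  refine ⟨contDiff_planeWave _, fun x => t _ x ?_, fun x => t _ x ?_⟩
  · ext i; fin_cases i <;> simp [torusMap, h1, h3]
  · ext i; fin_cases i <;> simp [torusMap, h2, h4]

/-- The area of the cell. -/
def cellArea (u₁ : Plane) : ℝ := (cellMeasure u₁).real univ

lemma cellArea_pos [hu : Fact (u₁ ≠ 0)] : 0 < cellArea u₁ := by
  have h : (cell u₁).Nonempty := ⟨0, 0, by norm_num, 0, by norm_num, by simp⟩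
  have h2 := (isOpen_cell hu.out).measure_pos volume h
  rw [cellArea, measureReal_def]
  refine ENNReal.toReal_pos ?_ (measure_ne_top _ _)
  simpa using h2.ne'

/-- The normalized plane waves. -/
def wave [Fact (u₁ ≠ 0)] (k : Plane) (m : Fin 2 → ℤ) : smoothBloch u₁ k :=
  ((Real.sqrt (cellArea u₁) : ℂ)⁻¹) • ⟨planeWave (waveVec u₁ k m), planeWave_waveVec_mem k m⟩

lemma wave_apply [Fact (u₁ ≠ 0)] (m : Fin 2 → ℤ) (x : Plane) :
    (wave (u₁ := u₁) k m).1 x = (Real.sqrt (cellArea u₁) : ℂ)⁻¹ * planeWave (waveVec u₁ k m) x :=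
  rfl

/-- Half a wavelength in a lattice direction where `m` does not vanish. This translation changes the
sign of the wave but not its integral over the cell, so the integral is zero. That is the
orthogonality of the plane waves. -/
lemma torusMap_halfPeriod [hu : Fact (u₁ ≠ 0)] {m : Fin 2 → ℤ} (hm : m ≠ 0) :
    ∃ v, planeWave (waveVec u₁ 0 m) v = -1 := by
  obtain ⟨h1, h2, h3, h4⟩ := dualVec_inner_periods hu.out
  obtain ⟨i, hi⟩ := Function.ne_iff.1 hm
  have hi' : ((m i : ℤ) : ℝ) ≠ 0 := by exact_mod_cast hi
  refine ⟨(2 * (m i : ℝ))⁻¹ • (![u₁, period₂ u₁] i), ?_⟩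
  have : ⟪waveVec u₁ 0 m, (2 * (m i : ℝ))⁻¹ • (![u₁, period₂ u₁] i)⟫_ℝ = Real.pi := by
    fin_cases i <;>
    · simp only [Fin.zero_eta, Fin.mk_one] at hi' ⊢
      simp [waveVec, inner_add_left, real_inner_smul_left, real_inner_smul_right, h1, h2, h3, h4]
      field_simp
  rw [planeWave, this, mul_comm, Complex.exp_pi_mul_I]

lemma waveVec_sub (m m' : Fin 2 → ℤ) :
    waveVec u₁ k m' - waveVec u₁ k m = waveVec u₁ 0 (m' - m) := by
  simp only [waveVec, Pi.sub_apply]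
  push_cast
  module

lemma orthonormal_wave [hu : Fact (u₁ ≠ 0)] :
    Orthonormal ℂ fun m => blochToL2 (u₁ := u₁) k (wave k m) := by
  rw [orthonormal_iff_ite]
  intro m m'
  rw [inner_blochToL2, cellInner]
  have hA : (Real.sqrt (cellArea u₁) : ℂ) ^ 2 = (cellArea u₁ : ℂ) := by
    rw [← Complex.ofReal_pow, Real.sq_sqrt cellArea_pos.le]
  have hA0 : (cellArea u₁ : ℂ) ≠ 0 := by exact_mod_cast cellArea_pos.ne'
  have e (x : Plane) : (starRingEnd ℂ) ((wave (u₁ := u₁) k m).1 x) * (wave (u₁ := u₁) k m').1 x =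
      (cellArea u₁ : ℂ)⁻¹ * planeWave (waveVec u₁ 0 (m' - m)) x := by
    rw [wave_apply (u₁ := u₁), wave_apply (u₁ := u₁), map_mul, conj_planeWave, map_inv₀, Complex.conj_ofReal,
      ← waveVec_sub (k := k), sub_eq_neg_add, planeWave_add_left, ← hA, sq, mul_inv]
    ring
  simp_rw [e, integral_const_mul]
  split_ifs with h
  · subst h
    rw [sub_self]
    have : waveVec u₁ 0 0 = 0 := by simp [waveVec]
    simp only [this, planeWave_zero, integral_const]
    rw [Complex.real_smul, mul_one]
    exact inv_mul_cancel₀ hA0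
  · obtain ⟨v, hv⟩ := torusMap_halfPeriod (u₁ := u₁) (m := m' - m)
      (sub_ne_zero.2 (Ne.symm h))
    have hp := (isPeriodic_of_mem_zero ⟨_, planeWave_waveVec_mem (u₁ := u₁) 0 (m' - m)⟩)
    have := hp.setIntegral_add (contDiff_planeWave _).continuous hu.out v
    simp only [planeWave_add_right, hv, mul_neg, mul_one, integral_neg] at this
    rw [show (∫ x in cell u₁, planeWave (waveVec u₁ 0 (m' - m)) x) = 0 by
      linear_combination -(1 / 2 : ℂ) * this, mul_zero]

lemma torus_span_closure [IsFiniteMeasure (torusMeasure u₁)] :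
    (Submodule.span ℂ (range fun m : Fin 2 → ℤ =>
      ContinuousMap.toLp (E := ℂ) 2 (torusMeasure u₁) ℂ
        (UnitAddTorus.mFourier m))).topologicalClosure = ⊤ := by
  simpa only [Submodule.map_span, ContinuousLinearMap.coe_coe, ← range_comp, Function.comp_def]
    using (ContinuousMap.toLp_denseRange ℂ (torusMeasure u₁) ℂ
      (by norm_num : (2 : ENNReal) ≠ ⊤)).topologicalClosure_map_submodule
      UnitAddTorus.span_mFourier_closure_eq_top

/-- Completeness is inherited from the torus. The product of `f` with `e^{-ik·x}`, transported by
the measure preserving section, is orthogonal to all characters, whose span is dense in `L²`. -/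
lemma eq_zero_of_forall_inner_wave [hu : Fact (u₁ ≠ 0)] {f : CellL2 u₁}
    (hf : ∀ m, ⟪blochToL2 k (wave k m), f⟫_ℂ = 0) : f = 0 := by
  have hfin : IsFiniteMeasure (torusMeasure u₁) := by
    unfold torusMeasure; infer_instance
  have hpw : Continuous (planeWave (-k)) := (contDiff_planeWave _).continuous
  set h : Plane → ℂ := fun x => planeWave (-k) x * f x with hh
  have hmem : MemLp h 2 (cellMeasure u₁) :=
    (Lp.memLp f).of_le (hpw.aestronglyMeasurable.mul (Lp.memLp f).1)
      (by filter_upwards with x; simp [hh])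
  have hP := measurePreserving_torusSection hu.out
  have hmemT : MemLp (h ∘ torusSection u₁) 2 (torusMeasure u₁) := hmem.comp_measurePreserving hP
  have hback : (h ∘ torusSection u₁) ∘ torusMap u₁ =ᵐ[cellMeasure u₁] h := by
    filter_upwards [ae_restrict_mem (measurableSet_cell hu.out)] with x hx
    simp [torusSection_torusMap hu.out hx]
  set hT : Lp ℂ 2 (torusMeasure u₁) := hmemT.toLp (h ∘ torusSection u₁) with hTdef
  have hTc : hT =ᵐ[torusMeasure u₁] h ∘ torusSection u₁ := hmemT.coeFn_toLp
  have hzero : hT = 0 := by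
    have h1 := (Submodule.topologicalClosure_eq_top_iff).1 (torus_span_closure (u₁ := u₁))
    rw [← Submodule.mem_bot ℂ, ← h1, Submodule.mem_orthogonal]
    intro w hw
    refine Submodule.span_induction (p := fun w _ => ⟪w, hT⟫_ℂ = 0) ?_ (by simp) ?_ ?_ hw
    · rintro _ ⟨m, rfl⟩
      rw [L2.inner_def]
      have e1 : ∀ᵐ t ∂(torusMeasure u₁),
          ⟪ContinuousMap.toLp (E := ℂ) 2 (torusMeasure u₁) ℂ (UnitAddTorus.mFourier m) t,
            hT t⟫_ℂ = (starRingEnd ℂ) (UnitAddTorus.mFourier m t) *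
              h (torusSection u₁ t) := by
        filter_upwards [ContinuousMap.coeFn_toLp (𝕜 := ℂ) (p := 2) (torusMeasure u₁)
          (UnitAddTorus.mFourier m), hTc] with t h1 h2
        rw [h1, h2, RCLike.inner_apply, mul_comm]; rfl
      rw [integral_congr_ae e1, ← measurePreserving_torusMap.map_eq, integral_map
        measurePreserving_torusMap.measurable.aemeasurable]
      · have := hf m
        rw [inner_blochToL2_left, cellInner] at this
        simp only [wave_apply, planeWave_waveVec, map_mul, conj_planeWave, map_inv₀,
          Complex.conj_ofReal] at this
        simp only [mul_assoc] at this
        rw [integral_const_mul] at this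
        have hA0 : (Real.sqrt (cellArea u₁) : ℂ)⁻¹ ≠ 0 := by
          simpa using (Real.sqrt_pos.2 cellArea_pos).ne'
        rw [← (mul_eq_zero.1 this).resolve_left hA0]
        refine integral_congr_ae ?_
        filter_upwards [hback] with x hx
        simp only [Function.comp_apply] at hx
        rw [hx, hh]; ring
      · rw [measurePreserving_torusMap.map_eq]
        exact (Complex.continuous_conj.comp (map_continuous _)).aestronglyMeasurable.mul hmemT.1
    · intro x y _ _ hx hy; rw [inner_add_left, hx, hy, add_zero]
    · intro c x _ hx; rw [inner_smul_left, hx, mul_zero]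
  have h0 : h ∘ torusSection u₁ =ᵐ[torusMeasure u₁] 0 := by
    have := hTc
    rw [hzero] at this
    exact this.symm.trans (Lp.coeFn_zero _ _ _)
  have h1 := measurePreserving_torusMap.quasiMeasurePreserving.ae_eq_comp h0
  rw [Lp.eq_zero_iff_ae_eq_zero]
  filter_upwards [hback, h1] with x hx hx'
  rw [hx] at hx'
  simpa [hh, planeWave_ne_zero] using hx'

/-- The Hilbert basis of normalized plane waves. -/
def fourierBasis [Fact (u₁ ≠ 0)] (k : Plane) : HilbertBasis (Fin 2 → ℤ) ℂ (CellL2 u₁) :=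
  HilbertBasis.mkOfOrthogonalEqBot (orthonormal_wave (u₁ := u₁) (k := k)) (by
    rw [Submodule.eq_bot_iff]
    intro f hf
    exact eq_zero_of_forall_inner_wave fun m =>
      (Submodule.mem_orthogonal _ _).1 hf _ (Submodule.subset_span ⟨m, rfl⟩))

lemma fourierBasis_apply [Fact (u₁ ≠ 0)] (m : Fin 2 → ℤ) :
    fourierBasis (u₁ := u₁) k m = blochToL2 k (wave k m) := by
  rw [fourierBasis, HilbertBasis.coe_mkOfOrthogonalEqBot]

end

/-! ### The Schrödinger operator on smooth quasi-periodic functions. -/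

section

variable {u₁ : Plane} {k : Plane} {V : Plane → ℝ}

/-! ### Differential operators on smooth quasi-periodic functions -/

lemma smoothBloch_differentiable (f : smoothBloch u₁ k) : Differentiable ℝ (f : Plane → ℂ) :=
  (smoothBloch_contDiff f).differentiable (by simp)

lemma fderiv_quasiPeriodic {f : Plane → ℂ} {u : Plane} {c : ℂ} (hf : Differentiable ℝ f)
    (h : ∀ x, f (x + u) = c * f x) (x v : Plane) :
    fderiv ℝ f (x + u) v = c * fderiv ℝ f x v := by
  rw [← fderiv_comp_add_right, funext h, fderiv_const_mul (hf x)]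
  simp

/-- The directional derivative on smooth quasi-periodic functions. -/
def dirD (k v : Plane) : smoothBloch u₁ k →ₗ[ℂ] smoothBloch u₁ k where
  toFun f := ⟨fun x => fderiv ℝ (f : Plane → ℂ) x v,
    ((smoothBloch_contDiff f).fderiv_right (m := ∞) (by simp)).clm_apply contDiff_const,
    fun x => fderiv_quasiPeriodic (smoothBloch_differentiable f) (smoothBloch_add_period₁ f) x v,
    fun x => fderiv_quasiPeriodic (smoothBloch_differentiable f) (smoothBloch_add_period₂ f) x v⟩
  map_add' f g := by
    ext x
    change fderiv ℝ (f.1 + g.1) x v = _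
    rw [fderiv_add (smoothBloch_differentiable f x) (smoothBloch_differentiable g x)]
    rfl
  map_smul' c f := by
    ext x
    change fderiv ℝ (c • (f : Plane → ℂ)) x v = _
    rw [fderiv_const_smul (smoothBloch_differentiable f x)]
    rfl

lemma dirD_apply (v : Plane) (f : smoothBloch u₁ k) (x : Plane) :
    (dirD k v f).1 x = fderiv ℝ f.1 x v := rfl

lemma dirD_add (v w : Plane) (f : smoothBloch u₁ k) :
    dirD k (v + w) f = dirD k v f + dirD k w f := by
  ext x; simp [dirD_apply]

lemma dirD_smul (c : ℝ) (v : Plane) (f : smoothBloch u₁ k) :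
    dirD k (c • v) f = (c : ℂ) • dirD k v f := by
  ext x; simp [dirD_apply]

/-- The standard basis vectors of the plane. -/
abbrev stdVec (j : Fin 2) : Plane := EuclideanSpace.single j 1

lemma sum_smul_stdVec (v : Plane) : v = v 0 • stdVec 0 + v 1 • stdVec 1 := by
  apply plane_ext <;> simp

lemma dirD_eq (v : Plane) (f : smoothBloch u₁ k) :
    dirD k v f = (v 0 : ℂ) • dirD k (stdVec 0) f + (v 1 : ℂ) • dirD k (stdVec 1) f := by
  conv_lhs => rw [sum_smul_stdVec v]
  rw [dirD_add, dirD_smul, dirD_smul]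

/-- The Laplacian on smooth quasi-periodic functions. -/
def blochLap (k : Plane) : smoothBloch u₁ k →ₗ[ℂ] smoothBloch u₁ k :=
  dirD k (stdVec 0) ∘ₗ dirD k (stdVec 0) + dirD k (stdVec 1) ∘ₗ dirD k (stdVec 1)

lemma blochLap_eq (f : smoothBloch u₁ k) : blochLap k f =
    dirD k (stdVec 0) (dirD k (stdVec 0) f) + dirD k (stdVec 1) (dirD k (stdVec 1) f) := rfl

lemma blochLap_apply (f : smoothBloch u₁ k) (x : Plane) :
    (blochLap k f).1 x = Laplacian.laplacian f.1 x := by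
  rw [InnerProductSpace.laplacian_eq_iteratedFDeriv_orthonormalBasis f.1
    (EuclideanSpace.basisFun (Fin 2) ℝ)]
  have h (v : Plane) : (dirD k v (dirD k v f)).1 x = fderiv ℝ (fderiv ℝ f.1) x v v := by
    change fderiv ℝ (fun y => fderiv ℝ f.1 y v) x v = _
    have hd : DifferentiableAt ℝ (fderiv ℝ f.1) x :=
      (((smoothBloch_contDiff f).fderiv_right (m := ∞) (by simp)).differentiable (by simp)) x
    rw [fderiv_clm_apply hd (differentiableAt_const v)]
    simp
  simp only [Fin.sum_univ_two, iteratedFDeriv_two_apply, EuclideanSpace.basisFun_apply, Matrix.cons_val_zero,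
    Matrix.cons_val_one, ← h]
  rfl

/-- Multiplication by the potential. -/
def potMul (hV : IsSuperHoneycomb u₁ V) (k : Plane) : smoothBloch u₁ k →ₗ[ℂ] smoothBloch u₁ k where
  toFun f := ⟨fun x => (V x : ℂ) * f.1 x,
    (Complex.ofRealCLM.contDiff.comp hV.smooth).mul (smoothBloch_contDiff f),
    fun x => by beta_reduce; rw [hV.periodic₁, smoothBloch_add_period₁]; ring,
    fun x => by beta_reduce; rw [hV.periodic₂, smoothBloch_add_period₂]; ring⟩
  map_add' f g := by ext x; exact mul_add _ _ _
  map_smul' c f := by ext x; exact mul_left_comm _ _ _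

lemma potMul_apply (hV : IsSuperHoneycomb u₁ V) (f : smoothBloch u₁ k) (x : Plane) :
    (potMul hV k f).1 x = (V x : ℂ) * f.1 x := rfl

/-- The Schrödinger operator `-Δ + V` on smooth quasi-periodic functions. -/
def hamiltonian (hV : IsSuperHoneycomb u₁ V) (k : Plane) :
    smoothBloch u₁ k →ₗ[ℂ] smoothBloch u₁ k := -blochLap k + potMul hV k

lemma hamiltonian_eq (hV : IsSuperHoneycomb u₁ V) (f : smoothBloch u₁ k) :
    hamiltonian hV k f = -blochLap k f + potMul hV k f := rfl

lemma hamiltonian_sub_apply (hV : IsSuperHoneycomb u₁ V) (E : ℝ) (f : smoothBloch u₁ k) :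
    (hamiltonian hV k f - (E : ℂ) • f : smoothBloch u₁ k).1 = shifted V E f.1 := by
  ext x
  rw [shifted, ← blochLap_apply]
  rfl

/-! ### Integration by parts -/

lemma smoothBloch_bounded [hu : Fact (u₁ ≠ 0)] (f : smoothBloch u₁ k) :
    ∃ C, ∀ x, ‖f.1 x‖ ≤ C := by
  obtain ⟨C, hC⟩ := ((isBounded_cell hu.out).isCompact_closure).exists_bound_of_continuousOn
    (smoothBloch_continuous f).continuousOn
  refine ⟨C, fun x => ?_⟩
  have h := (isPeriodic_phase_mul f).eq_of_torusMap_eq hu.out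
    (torusMap_torusSection hu.out (torusMap u₁ x))
  have h2 := congrArg norm h
  simp only [norm_mul, norm_planeWave, one_mul] at h2
  rw [← h2]
  exact hC _ (torusSection_mem_closure hu.out _)

/-- The integral of `g (x + t • v)` over the cell does not depend on `t`, and its derivative at `t =
0` is the integral in question. Boundary terms never appear. -/
lemma integral_dirD [hu : Fact (u₁ ≠ 0)] (v : Plane) (g : smoothBloch u₁ 0) :
    ∫ x in cell u₁, (dirD 0 v g).1 x = 0 := by
  obtain ⟨C, hC⟩ := smoothBloch_bounded (dirD 0 v g)
  have hd : HasDerivAt (fun t : ℝ => ∫ x in cell u₁, g.1 (x + t • v))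
      (∫ x in cell u₁, (dirD 0 v g).1 (x + (0 : ℝ) • v)) 0 := by
    refine (hasDerivAt_integral_of_dominated_loc_of_deriv_le (bound := fun _ => C)
      (F' := fun t x => (dirD 0 v g).1 (x + t • v))
      (Metric.ball_mem_nhds (0 : ℝ) one_pos) ?_ ?_ ?_ ?_ (integrable_const C) ?_).2
    · filter_upwards with t
      exact ((smoothBloch_continuous g).comp (by fun_prop)).aestronglyMeasurable
    · exact integrableOn_cell_of_continuous ((smoothBloch_continuous g).comp (by fun_prop))
    · exact ((smoothBloch_continuous (dirD 0 v g)).comp (by fun_prop)).aestronglyMeasurable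
    · filter_upwards with x t _ using hC _
    · filter_upwards with x t _
      have h1 : HasDerivAt (fun t : ℝ => x + t • v) v t := by
        simpa using ((hasDerivAt_id t).smul_const v).const_add x
      exact (smoothBloch_differentiable g (x + t • v)).hasFDerivAt.comp_hasDerivAt t h1
  have hconst : (fun t : ℝ => ∫ x in cell u₁, g.1 (x + t • v)) =
      fun _ => ∫ x in cell u₁, g.1 x := by
    ext t
    exact (isPeriodic_of_mem_zero g).setIntegral_add (smoothBloch_continuous g) hu.out (t • v)
  rw [hconst] at hd
  simpa using hd.unique (hasDerivAt_const 0 _)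

/-- The periodic function `conj f * g`. -/
def conjMul (f g : smoothBloch u₁ k) : smoothBloch u₁ 0 :=
  ⟨fun x => (starRingEnd ℂ) (f.1 x) * g.1 x,
    (Complex.conjCLE.contDiff.comp (smoothBloch_contDiff f)).mul (smoothBloch_contDiff g),
    fun x => by simpa using (isPeriodic_conj_mul f g).1 x,
    fun x => by simpa using (isPeriodic_conj_mul f g).2 x⟩

lemma dirD_conjMul (v : Plane) (f g : smoothBloch u₁ k) :
    dirD 0 v (conjMul f g) = conjMul (dirD k v f) g + conjMul f (dirD k v g) := by
  ext x
  change fderiv ℝ (fun y => (starRingEnd ℂ) (f.1 y) * g.1 y) x v =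
    (starRingEnd ℂ) (fderiv ℝ f.1 x v) * g.1 x + (starRingEnd ℂ) (f.1 x) * fderiv ℝ g.1 x v
  have h1 : HasFDerivAt (fun y => (starRingEnd ℂ) (f.1 y))
      ((Complex.conjCLE : ℂ →L[ℝ] ℂ).comp (fderiv ℝ f.1 x)) x :=
    (Complex.conjCLE : ℂ →L[ℝ] ℂ).hasFDerivAt.comp x
      (smoothBloch_differentiable f x).hasFDerivAt
  rw [HasFDerivAt.fderiv (f := fun y => (starRingEnd ℂ) (f.1 y) * g.1 y)
    (h1.mul (smoothBloch_differentiable g x).hasFDerivAt)]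
  simp
  ring

lemma integral_conjMul [Fact (u₁ ≠ 0)] (f g : smoothBloch u₁ k) :
    ∫ x in cell u₁, (conjMul f g).1 x = ⟪blochToL2 k f, blochToL2 k g⟫_ℂ := by
  rw [inner_blochToL2]; rfl

lemma inner_dirD [hu : Fact (u₁ ≠ 0)] (v : Plane) (f g : smoothBloch u₁ k) :
    ⟪blochToL2 k (dirD k v f), blochToL2 k g⟫_ℂ = -⟪blochToL2 k f, blochToL2 k (dirD k v g)⟫_ℂ := by
  have h := integral_dirD v (conjMul f g)
  rw [dirD_conjMul] at h
  change ∫ x in cell u₁, ((conjMul (dirD k v f) g).1 x + (conjMul f (dirD k v g)).1 x) = 0 at h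
  rw [integral_add (integrableOn_cell_of_continuous (smoothBloch_continuous _))
      (integrableOn_cell_of_continuous (smoothBloch_continuous _)),
    integral_conjMul, integral_conjMul] at h
  exact eq_neg_of_add_eq_zero_left h

lemma inner_blochLap [Fact (u₁ ≠ 0)] (f g : smoothBloch u₁ k) :
    ⟪blochToL2 k (blochLap k f), blochToL2 k g⟫_ℂ =
      ⟪blochToL2 k f, blochToL2 k (blochLap k g)⟫_ℂ := by
  simp only [blochLap_eq, map_add, inner_add_left, inner_add_right, inner_dirD, neg_neg]

lemma inner_potMul [Fact (u₁ ≠ 0)] (hV : IsSuperHoneycomb u₁ V) (f g : smoothBloch u₁ k) :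
    ⟪blochToL2 k (potMul hV k f), blochToL2 k g⟫_ℂ =
      ⟪blochToL2 k f, blochToL2 k (potMul hV k g)⟫_ℂ := by
  rw [inner_blochToL2, inner_blochToL2, cellInner, cellInner]
  congr 1
  ext x
  rw [potMul_apply, potMul_apply, map_mul, Complex.conj_ofReal]
  ring

lemma inner_hamiltonian [Fact (u₁ ≠ 0)] (hV : IsSuperHoneycomb u₁ V) (f g : smoothBloch u₁ k) :
    ⟪blochToL2 k (hamiltonian hV k f), blochToL2 k g⟫_ℂ =
      ⟪blochToL2 k f, blochToL2 k (hamiltonian hV k g)⟫_ℂ := by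
  simp only [hamiltonian_eq, map_add, map_neg, inner_add_left, inner_add_right, inner_neg_left,
    inner_neg_right, inner_blochLap, inner_potMul]

/-! ### Change of the quasi-momentum -/

/-- Multiplication by `e^{i(k'-k)·x}`. -/
def phaseMap (k k' : Plane) : smoothBloch u₁ k →ₗ[ℂ] smoothBloch u₁ k' where
  toFun f := ⟨fun x => planeWave (k' - k) x * f.1 x,
    (contDiff_planeWave _).mul (smoothBloch_contDiff f),
    fun x => by
      beta_reduce
      rw [smoothBloch_add_period₁, planeWave_add_right]
      change _ * _ * (planeWave k u₁ * _) = planeWave k' u₁ * _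
      rw [show k' = (k' - k) + k by abel, planeWave_add_left _ k u₁]
      simp only [add_sub_cancel_right]
      ring,
    fun x => by
      beta_reduce
      rw [smoothBloch_add_period₂, planeWave_add_right]
      change _ * _ * (planeWave k (period₂ u₁) * _) = planeWave k' (period₂ u₁) * _
      rw [show k' = (k' - k) + k by abel, planeWave_add_left _ k (period₂ u₁)]
      simp only [add_sub_cancel_right]
      ring⟩
  map_add' f g := by ext x; exact mul_add _ _ _
  map_smul' c f := by ext x; exact mul_left_comm _ _ _

lemma phaseMap_apply (k' : Plane) (f : smoothBloch u₁ k) (x : Plane) :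
    (phaseMap k k' f).1 x = planeWave (k' - k) x * f.1 x := rfl

lemma inner_phaseMap [Fact (u₁ ≠ 0)] (k' : Plane) (f g : smoothBloch u₁ k) :
    ⟪blochToL2 k' (phaseMap k k' f), blochToL2 k' (phaseMap k k' g)⟫_ℂ =
      ⟪blochToL2 k f, blochToL2 k g⟫_ℂ := by
  rw [inner_blochToL2, inner_blochToL2, cellInner, cellInner]
  congr 1
  ext x
  rw [phaseMap_apply, phaseMap_apply, map_mul, conj_planeWave]
  linear_combination (starRingEnd ℂ) (f.1 x) * g.1 x * planeWave_neg_mul (k' - k) x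

lemma norm_phaseMap [Fact (u₁ ≠ 0)] (k' : Plane) (f : smoothBloch u₁ k) :
    ‖blochToL2 k' (phaseMap k k' f)‖ = ‖blochToL2 k f‖ := by
  have h := inner_phaseMap k' f f
  rw [inner_self_eq_norm_sq_to_K, inner_self_eq_norm_sq_to_K] at h
  exact (sq_eq_sq₀ (norm_nonneg _) (norm_nonneg _)).1 (by exact_mod_cast h)

lemma hasFDerivAt_planeWave (ξ x : Plane) : HasFDerivAt (planeWave ξ)
    ((planeWave ξ x * Complex.I) • (Complex.ofRealCLM.comp (innerSL ℝ ξ))) x := by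
  have h1 : HasFDerivAt (fun y : Plane => Complex.I * (⟪ξ, y⟫_ℝ : ℂ))
      (Complex.I • Complex.ofRealCLM.comp (innerSL ℝ ξ)) x :=
    ((Complex.ofRealCLM.comp (innerSL ℝ ξ)).hasFDerivAt (x := x)).const_mul Complex.I
  have := h1.cexp
  rwa [smul_smul] at this

lemma fderiv_planeWave (ξ x v : Plane) :
    fderiv ℝ (planeWave ξ) x v = Complex.I * (⟪ξ, v⟫_ℝ : ℂ) * planeWave ξ x := by
  rw [(hasFDerivAt_planeWave ξ x).fderiv]
  simp
  ring

lemma dirD_phaseMap (k' v : Plane) (f : smoothBloch u₁ k) :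
    dirD k' v (phaseMap k k' f) =
      phaseMap k k' (dirD k v f + (Complex.I * (⟪k' - k, v⟫_ℝ : ℂ)) • f) := by
  ext x
  change fderiv ℝ (fun y => planeWave (k' - k) y * f.1 y) x v = planeWave (k' - k) x *
    (fderiv ℝ f.1 x v + Complex.I * (⟪k' - k, v⟫_ℝ : ℂ) * f.1 x)
  rw [fderiv_fun_mul (hasFDerivAt_planeWave _ x).differentiableAt (smoothBloch_differentiable f x)]
  simp only [add_apply, smul_apply, fderiv_planeWave,
    smul_eq_mul]
  ring

/-- Conjugation by `e^{iκ·x}` replaces `∇` by `∇ + iκ`, here with `κ = k' - k`. With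
`inner_phaseMap` it compares operators at different quasi-momenta by a unitary change of function.
-/
lemma hamiltonian_phaseMap (hV : IsSuperHoneycomb u₁ V) (k' : Plane) (f : smoothBloch u₁ k) :
    hamiltonian hV k' (phaseMap k k' f) = phaseMap k k' (hamiltonian hV k f -
      (2 * Complex.I) • dirD k (k' - k) f + ((‖k' - k‖ : ℂ) ^ 2) • f) := by
  have hp : potMul hV k' (phaseMap k k' f) = phaseMap k k' (potMul hV k f) := by
    ext x; exact mul_left_comm _ _ _
  have hI : Complex.I ^ 2 = -1 := Complex.I_sq
  have hn : (‖k' - k‖ : ℂ) ^ 2 = ((k' - k) 0 : ℂ) ^ 2 + ((k' - k) 1 : ℂ) ^ 2 := by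
    exact_mod_cast plane_norm_sq (k' - k)
  have hj (j : Fin 2) : ⟪k' - k, stdVec j⟫_ℝ = (k' - k) j := by
    simp [stdVec, EuclideanSpace.inner_single_right]
  rw [hamiltonian_eq, hamiltonian_eq, hp, blochLap_eq, blochLap_eq, dirD_eq (k' - k), hn]
  simp only [dirD_phaseMap, map_add, map_sub, map_neg, map_smul, hj]
  match_scalars <;>
    first
    | ring1
    | linear_combination (-((k' - k) 0 : ℂ) ^ 2 - ((k' - k) 1 : ℂ) ^ 2) * hI

/-! ### Plane waves -/

lemma dirD_wave [Fact (u₁ ≠ 0)] (v : Plane) (m : Fin 2 → ℤ) :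
    dirD k v (wave (u₁ := u₁) k m) = (Complex.I * (⟪waveVec u₁ k m, v⟫_ℝ : ℂ)) • wave k m := by
  rw [wave, map_smul, smul_comm]
  congr 1
  ext x
  exact fderiv_planeWave _ _ _

lemma blochLap_wave [Fact (u₁ ≠ 0)] (m : Fin 2 → ℤ) :
    blochLap k (wave (u₁ := u₁) k m) = (-(‖waveVec u₁ k m‖ : ℂ) ^ 2) • wave k m := by
  have hn : (‖waveVec u₁ k m‖ : ℂ) ^ 2 =
      (waveVec u₁ k m 0 : ℂ) ^ 2 + (waveVec u₁ k m 1 : ℂ) ^ 2 := by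
    exact_mod_cast plane_norm_sq (waveVec u₁ k m)
  have hj (j : Fin 2) : ⟪waveVec u₁ k m, stdVec j⟫_ℝ = waveVec u₁ k m j := by
    simp [stdVec, EuclideanSpace.inner_single_right]
  rw [blochLap_eq]
  simp only [dirD_wave, map_smul, hj, smul_smul, ← add_smul, hn]
  congr 1
  linear_combination ((waveVec u₁ k m 0 : ℂ) ^ 2 + (waveVec u₁ k m 1 : ℂ) ^ 2) * Complex.I_sq

/-! ### Gradient bounds -/

lemma norm_dirD_sq_add [Fact (u₁ ≠ 0)] (f : smoothBloch u₁ k) :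
    ((‖blochToL2 k (dirD k (stdVec 0) f)‖ ^ 2 + ‖blochToL2 k (dirD k (stdVec 1) f)‖ ^ 2 : ℝ) : ℂ) =
      -⟪blochToL2 k f, blochToL2 k (blochLap k f)⟫_ℂ := by
  have h (v : Plane) : ((‖blochToL2 k (dirD k v f)‖ ^ 2 : ℝ) : ℂ) =
      -⟪blochToL2 k f, blochToL2 k (dirD k v (dirD k v f))⟫_ℂ := by
    rw [← inner_dirD, inner_self_eq_norm_sq_to_K]; push_cast; rfl
  rw [Complex.ofReal_add, h, h, blochLap_eq, map_add, inner_add_right]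
  ring

lemma norm_dirD_le [Fact (u₁ ≠ 0)] (v : Plane) (f : smoothBloch u₁ k) :
    ‖blochToL2 k (dirD k v f)‖ ^ 2 ≤ ‖v‖ ^ 2 * (‖blochToL2 k (dirD k (stdVec 0) f)‖ ^ 2 +
      ‖blochToL2 k (dirD k (stdVec 1) f)‖ ^ 2) := by
  rw [dirD_eq v, map_add, map_smul, map_smul, plane_norm_sq]
  set a := blochToL2 k (dirD k (stdVec 0) f)
  set b := blochToL2 k (dirD k (stdVec 1) f)
  have h1 : ‖(v 0 : ℂ) • a + (v 1 : ℂ) • b‖ ≤ |v 0| * ‖a‖ + |v 1| * ‖b‖ := by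
    refine (norm_add_le _ _).trans_eq ?_
    rw [norm_smul, norm_smul, Complex.norm_real, Complex.norm_real, Real.norm_eq_abs,
      Real.norm_eq_abs]
  have h2 : (|v 0| * ‖a‖ + |v 1| * ‖b‖) ^ 2 ≤
      (v 0 ^ 2 + v 1 ^ 2) * (‖a‖ ^ 2 + ‖b‖ ^ 2) := by
    rw [← sq_abs (v 0), ← sq_abs (v 1)]
    nlinarith [sq_nonneg (|v 0| * ‖b‖ - |v 1| * ‖a‖)]
  exact (pow_le_pow_left₀ (norm_nonneg _) h1 2).trans h2

end

/-! ### Decay of Fourier coefficients and elliptic regularity. -/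

section

variable {u₁ : Plane} {k : Plane} {V : Plane → ℝ}

/-! ### Weights on the dual lattice -/

/-- The weight `1 + |k + G|²`. -/
def weight (u₁ k : Plane) (m : Fin 2 → ℤ) : ℝ := 1 + ‖waveVec u₁ k m‖ ^ 2

lemma one_le_weight (m : Fin 2 → ℤ) : 1 ≤ weight u₁ k m := by
  unfold weight; linarith [sq_nonneg ‖waveVec u₁ k m‖]

lemma weight_pos (m : Fin 2 → ℤ) : 0 < weight u₁ k m := one_pos.trans_le (one_le_weight m)

/-- A form of Peetre's inequality. It lets a weight be distributed over the two factors of a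
convolution. -/
lemma one_add_norm_add_sq_le (x y : Plane) :
    1 + ‖x + y‖ ^ 2 ≤ 2 * (1 + ‖x‖ ^ 2) * (1 + ‖y‖ ^ 2) := by
  have h := pow_le_pow_left₀ (norm_nonneg _) (norm_add_le x y) 2
  nlinarith [sq_nonneg (‖x‖ - ‖y‖), mul_nonneg (sq_nonneg ‖x‖) (sq_nonneg ‖y‖)]

lemma weight_le (m m' : Fin 2 → ℤ) :
    weight u₁ k m ≤ 2 * weight u₁ k m' * weight u₁ 0 (m - m') := by
  have : waveVec u₁ k m = waveVec u₁ k m' + waveVec u₁ 0 (m - m') := by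
    rw [← waveVec_sub (k := k)]; abel
  rw [weight, this]
  exact one_add_norm_add_sq_le _ _

lemma weight_zero_le (m : Fin 2 → ℤ) :
    weight u₁ 0 m ≤ 2 * (1 + ‖k‖ ^ 2) * weight u₁ k m := by
  have : waveVec u₁ 0 m = waveVec u₁ k m + -k := by simp [waveVec]
  rw [weight, this]
  refine (one_add_norm_add_sq_le _ _).trans_eq ?_
  rw [norm_neg, weight]; ring

/-- Pairing the wave vector with the periods recovers `2π m i`, so each integer coordinate is
controlled by the length of the wave vector. -/
lemma one_add_sq_le_weight_zero [hu : Fact (u₁ ≠ 0)] :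
    ∃ C, 0 < C ∧ ∀ (m : Fin 2 → ℤ) (i : Fin 2), 1 + (m i : ℝ) ^ 2 ≤ C * weight u₁ 0 m := by
  obtain ⟨h1, h2, h3, h4⟩ := dualVec_inner_periods hu.out
  have key (m : Fin 2 → ℤ) (i : Fin 2) :
      2 * Real.pi * (m i : ℝ) = ⟪waveVec u₁ 0 m, ![u₁, period₂ u₁] i⟫_ℝ := by
    fin_cases i <;> simp [waveVec, inner_add_left, real_inner_smul_left, h1, h2, h3, h4]
  set M : ℝ := ‖u₁‖ ^ 2 + ‖period₂ u₁‖ ^ 2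
  refine ⟨1 + M, by positivity, fun m i => ?_⟩
  have hle : (2 * Real.pi * (m i : ℝ)) ^ 2 ≤ ‖waveVec u₁ 0 m‖ ^ 2 * M := by
    rw [key]
    have := abs_real_inner_le_norm (waveVec u₁ 0 m) (![u₁, period₂ u₁] i)
    rw [← sq_abs]
    refine (pow_le_pow_left₀ (abs_nonneg _) this 2).trans ?_
    rw [mul_pow]
    gcongr
    fin_cases i <;> simp [M]
  have hpi : 1 ≤ (2 * Real.pi) ^ 2 := by nlinarith [Real.pi_gt_three]
  rw [mul_pow] at hle
  have h5 : (m i : ℝ) ^ 2 ≤ (2 * Real.pi) ^ 2 * (m i : ℝ) ^ 2 :=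
    le_mul_of_one_le_left (sq_nonneg _) hpi
  have hM : 0 ≤ M := by positivity
  rw [weight]
  nlinarith [sq_nonneg ‖waveVec u₁ 0 m‖]

lemma summable_inv_one_add_sq : Summable fun n : ℤ => (1 + (n : ℝ) ^ 2)⁻¹ := by
  have h : Summable fun n : ℤ => 1 / (n : ℝ) ^ 2 :=
    Real.summable_one_div_int_pow.2 (by norm_num)
  -- At `n = 0` the majorant `1 / n ^ 2` takes the default value `0`, so `1` is added there.
  refine (h.add (summable_of_ne_finset_zero (s := {0}) (f := fun n : ℤ => if n = 0 then (1 : ℝ)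
    else 0) (by simp +contextual))).of_nonneg_of_le (fun n => by positivity) fun n => ?_
  by_cases hn : n = 0
  · simp [hn]
  · have : (0 : ℝ) < (n : ℝ) ^ 2 := by positivity
    simp only [hn, if_false, add_zero, one_div]
    gcongr
    linarith

/-- Each factor `1 + (m i) ^ 2` is at most a multiple of the weight. Two powers of the weight thus
dominate the product of both factors, whose inverse is summable over `ℤ²`. -/
lemma summable_inv_weight_sq [Fact (u₁ ≠ 0)] (k : Plane) :
    Summable fun m => (weight u₁ k m ^ 2)⁻¹ := by
  obtain ⟨C, hC0, hC⟩ := one_add_sq_le_weight_zero (u₁ := u₁)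
  have h1 : Summable fun m : Fin 2 → ℤ => (1 + (m 0 : ℝ) ^ 2)⁻¹ * (1 + (m 1 : ℝ) ^ 2)⁻¹ := by
    have := summable_inv_one_add_sq.mul_of_nonneg summable_inv_one_add_sq
      (fun n => by positivity) (fun n => by positivity)
    exact (finTwoArrowEquiv ℤ).summable_iff.2 this
  set D := C * (2 * (1 + ‖k‖ ^ 2))
  have hD : 0 < D := by positivity
  refine (h1.mul_left (D ^ 2)).of_nonneg_of_le (fun m => by positivity) fun m => ?_
  have hw := weight_pos (u₁ := u₁) (k := k) m
  have hle (i : Fin 2) : 1 + (m i : ℝ) ^ 2 ≤ D * weight u₁ k m := by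
    refine (hC m i).trans ?_
    rw [mul_assoc]
    gcongr
    exact weight_zero_le m
  have h2 : (1 + (m 0 : ℝ) ^ 2) * (1 + (m 1 : ℝ) ^ 2) ≤ D ^ 2 * weight u₁ k m ^ 2 := by
    rw [← mul_pow, sq (D * _)]
    exact mul_le_mul (hle 0) (hle 1) (by positivity) (by positivity)
  rw [← mul_inv, ← div_eq_mul_inv, inv_eq_one_div,
    div_le_div_iff₀ (by positivity) (by positivity)]
  linarith

/-- Sequences on the dual lattice that decrease faster than every power. -/
def RapidlyDecreasing (u₁ k : Plane) (a : (Fin 2 → ℤ) → ℂ) : Prop :=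
  ∀ N : ℕ, ∃ C, ∀ m, weight u₁ k m ^ N * ‖a m‖ ≤ C

lemma RapidlyDecreasing.summable [Fact (u₁ ≠ 0)] {a : (Fin 2 → ℤ) → ℂ}
    (ha : RapidlyDecreasing u₁ k a) (N : ℕ) : Summable fun m => weight u₁ k m ^ N * ‖a m‖ := by
  -- The two extra powers are spent on `summable_inv_weight_sq`.
  obtain ⟨C, hC⟩ := ha (N + 2)
  refine ((summable_inv_weight_sq (u₁ := u₁) k).mul_left C).of_nonneg_of_le
    (fun m => mul_nonneg (pow_nonneg (weight_pos m).le _) (norm_nonneg _)) fun m => ?_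
  have h2 : 0 < weight u₁ k m ^ 2 := pow_pos (weight_pos m) 2
  rw [← div_eq_mul_inv, le_div_iff₀ h2]
  refine le_trans (le_of_eq ?_) (hC m)
  ring

/-- By Peetre's inequality the weight at `m` is shared between `m'` and `m - m'`. Convolution with a
rapidly decreasing sequence therefore keeps any given order of decay of `a`, which is how the
potential acts on Fourier coefficients. -/
lemma exists_bound_convolution [Fact (u₁ ≠ 0)] {v a : (Fin 2 → ℤ) → ℂ}
    (hv : RapidlyDecreasing u₁ 0 v) {N : ℕ} {C : ℝ}
    (ha : ∀ m, weight u₁ k m ^ N * ‖a m‖ ≤ C) :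
    ∃ C', ∀ m, weight u₁ k m ^ N * ‖∑' m', v (m - m') * a m'‖ ≤ C' := by
  have hs := hv.summable N
  have hC : 0 ≤ C := le_trans (mul_nonneg (pow_nonneg (weight_pos 0).le _) (norm_nonneg _)) (ha 0)
  refine ⟨2 ^ N * C * ∑' l, weight u₁ 0 l ^ N * ‖v l‖, fun m => ?_⟩
  have hw := weight_pos (u₁ := u₁) (k := k)
  have hs' : Summable fun m' => weight u₁ 0 (m - m') ^ N * ‖v (m - m')‖ :=
    (Equiv.subLeft m).summable_iff.2 hs
  have e : ∑' m', weight u₁ 0 (m - m') ^ N * ‖v (m - m')‖ = ∑' l, weight u₁ 0 l ^ N * ‖v l‖ :=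
    (Equiv.subLeft m).tsum_eq fun l => weight u₁ 0 l ^ N * ‖v l‖
  have hle (m' : Fin 2 → ℤ) : weight u₁ k m ^ N * ‖v (m - m') * a m'‖ ≤
      2 ^ N * C * (weight u₁ 0 (m - m') ^ N * ‖v (m - m')‖) := by
    have h1 := pow_le_pow_left₀ (hw m).le (weight_le (u₁ := u₁) (k := k) m m') N
    rw [norm_mul]
    calc weight u₁ k m ^ N * (‖v (m - m')‖ * ‖a m'‖)
        ≤ (2 * weight u₁ k m' * weight u₁ 0 (m - m')) ^ N * (‖v (m - m')‖ * ‖a m'‖) := by gcongr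
      _ = 2 ^ N * (weight u₁ k m' ^ N * ‖a m'‖) *
          (weight u₁ 0 (m - m') ^ N * ‖v (m - m')‖) := by rw [mul_pow, mul_pow]; ring
      _ ≤ _ := by
        have := weight_pos (u₁ := u₁) (k := 0) (m - m')
        gcongr
        exact ha m'
  have hwN : 0 < weight u₁ k m ^ N := pow_pos (hw m) N
  have hsum : Summable fun m' => weight u₁ k m ^ N * ‖v (m - m') * a m'‖ :=
    (hs'.mul_left _).of_nonneg_of_le (fun m' => by positivity) hle
  have hsum' : Summable fun m' => ‖v (m - m') * a m'‖ := by
    simpa [hwN.ne'] using hsum.mul_left (weight u₁ k m ^ N)⁻¹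
  calc weight u₁ k m ^ N * ‖∑' m', v (m - m') * a m'‖
      ≤ weight u₁ k m ^ N * ∑' m', ‖v (m - m') * a m'‖ := by
        gcongr; exact norm_tsum_le_tsum_norm hsum'
    _ = ∑' m', weight u₁ k m ^ N * ‖v (m - m') * a m'‖ := tsum_mul_left.symm
    _ ≤ ∑' m', 2 ^ N * C * (weight u₁ 0 (m - m') ^ N * ‖v (m - m')‖) :=
        hsum.tsum_le_tsum hle (hs'.mul_left _)
    _ = _ := by rw [tsum_mul_left, e]

/-! ### Fourier coefficients of smooth functions -/

/-- The Fourier coefficients of a function on the cell. -/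
def blochCoeff [Fact (u₁ ≠ 0)] (k : Plane) (f : CellL2 u₁) (m : Fin 2 → ℤ) : ℂ :=
  ⟪blochToL2 k (wave k m), f⟫_ℂ

lemma norm_blochCoeff_le [Fact (u₁ ≠ 0)] (f : CellL2 u₁) (m : Fin 2 → ℤ) :
    ‖blochCoeff k f m‖ ≤ ‖f‖ := by
  refine (norm_inner_le_norm _ _).trans_eq ?_
  rw [(orthonormal_wave (u₁ := u₁) (k := k)).1 m, one_mul]

lemma ext_blochCoeff [Fact (u₁ ≠ 0)] {f g : CellL2 u₁}
    (h : ∀ m, blochCoeff k f m = blochCoeff k g m) : f = g := by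
  rw [← sub_eq_zero]
  refine eq_zero_of_forall_inner_wave (k := k) fun m => ?_
  rw [inner_sub_right, sub_eq_zero]
  exact h m

lemma blochCoeff_sub_blochLap [Fact (u₁ ≠ 0)] (f : smoothBloch u₁ k) (m : Fin 2 → ℤ) :
    blochCoeff k (blochToL2 k (f - blochLap k f)) m =
      weight u₁ k m * blochCoeff k (blochToL2 k f) m := by
  rw [blochCoeff, map_sub, inner_sub_right, ← inner_blochLap, blochLap_wave, map_smul,
    inner_smul_left, blochCoeff, weight]
  simp
  ring

/-- Each application of `1 - Δ` multiplies the coefficients by the weight and yields another smooth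
function, whose coefficients are bounded by its norm. -/
lemma rapidlyDecreasing_blochCoeff [Fact (u₁ ≠ 0)] (f : smoothBloch u₁ k) :
    RapidlyDecreasing u₁ k (blochCoeff k (blochToL2 k f)) := by
  intro N
  induction N generalizing f with
  | zero => exact ⟨‖blochToL2 k f‖, fun m => by simpa using norm_blochCoeff_le _ _⟩
  | succ N ih =>
    obtain ⟨C, hC⟩ := ih (f - blochLap k f)
    refine ⟨C, fun m => ?_⟩
    have := hC m
    rw [blochCoeff_sub_blochLap, norm_mul, Complex.norm_real, Real.norm_eq_abs,
      abs_of_pos (weight_pos m)] at this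
    rwa [pow_succ, mul_assoc]

/-- The potential as a smooth periodic function. -/
def potFun (hV : IsSuperHoneycomb u₁ V) : smoothBloch u₁ 0 :=
  ⟨fun x => (V x : ℂ), Complex.ofRealCLM.contDiff.comp hV.smooth,
    fun x => by simp [hV.periodic₁], fun x => by simp [hV.periodic₂]⟩

/-- Only the difference of the frequencies enters, for every `k`: in the Fourier basis the potential
is a convolution. -/
lemma inner_potMul_wave [Fact (u₁ ≠ 0)] (hV : IsSuperHoneycomb u₁ V) (m m' : Fin 2 → ℤ) :
    ⟪blochToL2 k (potMul hV k (wave k m)), blochToL2 k (wave k m')⟫_ℂ =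
      (Real.sqrt (cellArea u₁) : ℂ)⁻¹ * blochCoeff 0 (blochToL2 0 (potFun hV)) (m - m') := by
  rw [blochCoeff, inner_blochToL2, inner_blochToL2, cellInner, cellInner, ← integral_const_mul]
  congr 1
  ext x
  rw [potMul_apply, wave_apply, wave_apply, wave_apply, map_mul, map_mul, map_mul,
    conj_planeWave, conj_planeWave, map_inv₀, Complex.conj_ofReal, Complex.conj_ofReal,
    ← waveVec_sub (k := k), neg_sub, sub_eq_neg_add, planeWave_add_left]
  change _ = _ * (_ * (V x : ℂ))
  ring

lemma inner_potMul_wave_eq_tsum [Fact (u₁ ≠ 0)] (hV : IsSuperHoneycomb u₁ V) (f : CellL2 u₁)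
    (m : Fin 2 → ℤ) : ⟪blochToL2 k (potMul hV k (wave k m)), f⟫_ℂ =
      ∑' m', (Real.sqrt (cellArea u₁) : ℂ)⁻¹ *
        blochCoeff 0 (blochToL2 0 (potFun hV)) (m - m') * blochCoeff k f m' := by
  rw [← (fourierBasis (u₁ := u₁) k).tsum_inner_mul_inner]
  simp only [fourierBasis_apply, inner_potMul_wave, blochCoeff]

/-! ### Elliptic regularity -/

/-- A bootstrap. In the equation solved for `weight * coefficient`, the right side decays as fast as
the coefficients of `f` are already known to decay, and the weight on the left gains one order. -/
lemma rapidlyDecreasing_of_weak [Fact (u₁ ≠ 0)] (hV : IsSuperHoneycomb u₁ V) {E : ℝ}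
    {f : CellL2 u₁} {g : smoothBloch u₁ k}
    (h : ∀ m, ⟪blochToL2 k (hamiltonian hV k (wave k m) - (E : ℂ) • wave k m), f⟫_ℂ =
      ⟪blochToL2 k (wave k m), blochToL2 k g⟫_ℂ) :
    RapidlyDecreasing u₁ k (blochCoeff k f) := by
  have hv : RapidlyDecreasing u₁ 0 fun m => (Real.sqrt (cellArea u₁) : ℂ)⁻¹ *
        blochCoeff 0 (blochToL2 0 (potFun hV)) m := by
    intro N
    obtain ⟨C, hC⟩ := rapidlyDecreasing_blochCoeff (potFun hV) N
    refine ⟨‖(Real.sqrt (cellArea u₁) : ℂ)⁻¹‖ * C, fun m => ?_⟩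
    rw [norm_mul, mul_left_comm]
    gcongr
    exact hC m
  -- The weak equation tested with one plane wave, where `1 - Δ` acts as the weight.
  have eq (m : Fin 2 → ℤ) : (weight u₁ k m : ℂ) * blochCoeff k f m =
      blochCoeff k (blochToL2 k g) m - ⟪blochToL2 k (potMul hV k (wave k m)), f⟫_ℂ +
        ((E + 1 : ℝ) : ℂ) * blochCoeff k f m := by
    have := h m
    rw [hamiltonian_eq, map_sub, map_add, map_neg, map_smul, blochLap_wave, map_smul,
      inner_sub_left, inner_add_left, inner_neg_left, inner_smul_left, inner_smul_left] at this
    simp only [blochCoeff, weight]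
    rw [← this]
    simp
    ring
  intro N
  induction N with
  | zero => exact ⟨‖f‖, fun m => by simpa using norm_blochCoeff_le _ _⟩
  | succ N ih =>
    obtain ⟨C, hC⟩ := ih
    obtain ⟨C₁, hC₁⟩ := rapidlyDecreasing_blochCoeff g N
    obtain ⟨C₂, hC₂⟩ := exists_bound_convolution hv hC
    refine ⟨C₁ + C₂ + |E + 1| * C, fun m => ?_⟩
    have hw := weight_pos (u₁ := u₁) (k := k) m
    have e1 : weight u₁ k m ^ (N + 1) * ‖blochCoeff k f m‖ =
        weight u₁ k m ^ N * ‖(weight u₁ k m : ℂ) * blochCoeff k f m‖ := by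
      rw [norm_mul, Complex.norm_real, Real.norm_eq_abs, abs_of_pos hw]; ring
    rw [e1, eq m]
    have h3 : ‖blochCoeff k (blochToL2 k g) m - ⟪blochToL2 k (potMul hV k (wave k m)), f⟫_ℂ +
        ((E + 1 : ℝ) : ℂ) * blochCoeff k f m‖ ≤ ‖blochCoeff k (blochToL2 k g) m‖ +
        ‖⟪blochToL2 k (potMul hV k (wave k m)), f⟫_ℂ‖ + |E + 1| * ‖blochCoeff k f m‖ := by
      refine (norm_add_le _ _).trans (add_le_add (norm_sub_le _ _) (le_of_eq ?_))
      rw [norm_mul, Complex.norm_real, Real.norm_eq_abs]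
    have h4 := hC₂ m
    rw [← inner_potMul_wave_eq_tsum hV f m] at h4
    calc _ ≤ weight u₁ k m ^ N * (‖blochCoeff k (blochToL2 k g) m‖ +
        ‖⟪blochToL2 k (potMul hV k (wave k m)), f⟫_ℂ‖ + |E + 1| * ‖blochCoeff k f m‖) := by gcongr
      _ = weight u₁ k m ^ N * ‖blochCoeff k (blochToL2 k g) m‖ +
        weight u₁ k m ^ N * ‖⟪blochToL2 k (potMul hV k (wave k m)), f⟫_ℂ‖ +
        |E + 1| * (weight u₁ k m ^ N * ‖blochCoeff k f m‖) := by ring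
      _ ≤ _ := by gcongr; exacts [hC₁ m, hC m]

lemma iteratedDeriv_exp_I (n : ℕ) : iteratedDeriv n (fun t : ℝ => Complex.exp (Complex.I * t)) =
    fun t : ℝ => Complex.I ^ n * Complex.exp (Complex.I * t) := by
  induction n with
  | zero => simp
  | succ n ih =>
    rw [iteratedDeriv_succ, ih]
    ext t
    have h : HasDerivAt (fun t : ℝ => Complex.exp (Complex.I * t))
        (Complex.exp (Complex.I * t) * (Complex.I * 1)) t :=
      ((Complex.ofRealCLM.hasDerivAt (x := t)).const_mul Complex.I).cexp
    rw [(h.const_mul _).deriv]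
    ring

lemma norm_iteratedFDeriv_planeWave (n : ℕ) (ξ x : Plane) :
    ‖iteratedFDeriv ℝ n (planeWave ξ) x‖ ≤ ‖ξ‖ ^ n := by
  have hc : ContDiff ℝ n (fun t : ℝ => Complex.exp (Complex.I * t)) :=
    ContDiff.cexp (contDiff_const.mul Complex.ofRealCLM.contDiff)
  have h := (innerSL ℝ ξ).iteratedFDeriv_comp_right hc x le_rfl
  have e : (fun t : ℝ => Complex.exp (Complex.I * t)) ∘ (innerSL ℝ ξ) = planeWave ξ := rfl
  rw [e] at h
  rw [h]
  refine (ContinuousMultilinearMap.norm_compContinuousLinearMap_le _ _).trans ?_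
  rw [norm_iteratedFDeriv_eq_norm_iteratedDeriv, iteratedDeriv_exp_I]
  simp only [norm_mul, norm_pow, Complex.norm_I, one_pow, one_mul, Finset.prod_const,
    Finset.card_univ, Fintype.card_fin, innerSL_apply_norm]
  rw [mul_comm Complex.I, Complex.norm_exp_ofReal_mul_I, one_mul]

lemma norm_wave_apply [Fact (u₁ ≠ 0)] (m : Fin 2 → ℤ) (x : Plane) :
    ‖(wave (u₁ := u₁) k m).1 x‖ = (Real.sqrt (cellArea u₁))⁻¹ := by
  rw [wave_apply, norm_mul, norm_planeWave, mul_one, norm_inv, Complex.norm_real, Real.norm_eq_abs,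
    abs_of_nonneg (Real.sqrt_nonneg _)]

/-- The smooth quasi-periodic function with given rapidly decreasing Fourier coefficients. -/
def fourierSynthesis [Fact (u₁ ≠ 0)] {a : (Fin 2 → ℤ) → ℂ} (ha : RapidlyDecreasing u₁ k a) :
    smoothBloch u₁ k := by
  refine ⟨fun x => ∑' m, a m * (wave (u₁ := u₁) k m).1 x, ?_, fun x => ?_, fun x => ?_⟩
  -- An `n`-th derivative of a plane wave costs `‖ξ‖ ^ n`, which is at most the `n`-th power of the
  -- weight. Rapid decrease makes the differentiated series converge for every `n`.
  · refine contDiff_tsum (v := fun n m => (Real.sqrt (cellArea u₁))⁻¹ *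
      (weight u₁ k m ^ n * ‖a m‖)) (fun m => contDiff_const.mul (smoothBloch_contDiff _))
      (fun n _ => (ha.summable n).mul_left _) fun n m x _ => ?_
    have e : (fun x => a m * (wave (u₁ := u₁) k m).1 x) =
        (a m * (Real.sqrt (cellArea u₁) : ℂ)⁻¹) • planeWave (waveVec u₁ k m) := by
      ext y; rw [wave_apply]; simp [mul_assoc]
    rw [e, iteratedFDeriv_const_smul_apply ((contDiff_planeWave _).of_le (by exact_mod_cast le_top)
      |>.contDiffAt), norm_smul, norm_mul, norm_inv, Complex.norm_real, Real.norm_eq_abs,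
      abs_of_nonneg (Real.sqrt_nonneg _)]
    have h1 : ‖iteratedFDeriv ℝ n (planeWave (waveVec u₁ k m)) x‖ ≤ weight u₁ k m ^ n := by
      refine (norm_iteratedFDeriv_planeWave n _ x).trans ?_
      gcongr
      rw [weight]
      nlinarith [sq_nonneg (‖waveVec u₁ k m‖ - 1)]
    calc _ ≤ ‖a m‖ * (Real.sqrt (cellArea u₁))⁻¹ * weight u₁ k m ^ n := by gcongr
      _ = _ := by ring
  · rw [← tsum_mul_left]
    refine tsum_congr fun m => ?_
    rw [smoothBloch_add_period₁]; ring
  · rw [← tsum_mul_left]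
    refine tsum_congr fun m => ?_
    rw [smoothBloch_add_period₂]; ring

lemma fourierSynthesis_apply [Fact (u₁ ≠ 0)] {a : (Fin 2 → ℤ) → ℂ}
    (ha : RapidlyDecreasing u₁ k a) (x : Plane) :
    (fourierSynthesis ha).1 x = ∑' m, a m * (wave (u₁ := u₁) k m).1 x := rfl

lemma blochCoeff_fourierSynthesis [Fact (u₁ ≠ 0)] {a : (Fin 2 → ℤ) → ℂ}
    (ha : RapidlyDecreasing u₁ k a) (m : Fin 2 → ℤ) :
    blochCoeff k (blochToL2 k (fourierSynthesis ha)) m = a m := by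
  classical
  rw [blochCoeff, inner_blochToL2, cellInner]
  simp_rw [fourierSynthesis_apply, ← tsum_mul_left]
  have hs : Summable fun m => ‖a m‖ := by simpa using ha.summable 0
  rw [← integral_tsum_of_summable_integral_norm]
  · have e (m' : Fin 2 → ℤ) : ∫ x in cell u₁, (starRingEnd ℂ) ((wave (u₁ := u₁) k m).1 x) *
        (a m' * (wave (u₁ := u₁) k m').1 x) = if m' = m then a m else 0 := by
      have h1 : ∫ x in cell u₁, (starRingEnd ℂ) ((wave (u₁ := u₁) k m).1 x) *
          (a m' * (wave (u₁ := u₁) k m').1 x) =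
          a m' * ⟪blochToL2 k (wave (u₁ := u₁) k m), blochToL2 k (wave k m')⟫_ℂ := by
        rw [inner_blochToL2, cellInner, ← integral_const_mul]
        congr 1; ext x; ring
      rw [h1, orthonormal_iff_ite.1 (orthonormal_wave (u₁ := u₁) (k := k)) m m']
      by_cases h : m = m'
      · simp [h]
      · simp [h, Ne.symm h]
    simp_rw [e, tsum_ite_eq]
  · intro m'
    exact integrableOn_cell_of_continuous ((Complex.continuous_conj.comp
      (smoothBloch_continuous _)).mul (continuous_const.mul (smoothBloch_continuous _)))
  · simp only [norm_mul, RCLike.norm_conj, norm_wave_apply, integral_const]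
    refine Summable.const_smul _ ?_
    exact (hs.mul_right _).mul_left _

/-- **Elliptic regularity**: weak solutions of `(H_V - E) f = g` with smooth `g` are smooth
strong solutions. -/
theorem exists_smooth_of_weak [Fact (u₁ ≠ 0)] (hV : IsSuperHoneycomb u₁ V) {E : ℝ}
    {f : CellL2 u₁} {g : smoothBloch u₁ k}
    (h : ∀ m, ⟪blochToL2 k (hamiltonian hV k (wave k m) - (E : ℂ) • wave k m), f⟫_ℂ =
      ⟪blochToL2 k (wave k m), blochToL2 k g⟫_ℂ) :
    ∃ F : smoothBloch u₁ k, blochToL2 k F = f ∧ hamiltonian hV k F - (E : ℂ) • F = g := by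
  have ha := rapidlyDecreasing_of_weak hV h
  have hF : blochToL2 k (fourierSynthesis ha) = f :=
    ext_blochCoeff (k := k) fun m => blochCoeff_fourierSynthesis ha m
  generalize fourierSynthesis ha = F at hF
  refine ⟨F, hF, blochToL2_injective (ext_blochCoeff (k := k) fun m => ?_)⟩
  rw [blochCoeff, blochCoeff, ← h m, ← hF, map_sub, map_sub, inner_sub_left, inner_sub_right,
    inner_hamiltonian]
  simp only [map_smul, inner_smul_left, inner_smul_right, Complex.conj_ofReal]

end

/-! ### Diagonal operators, eigenvalue counting and the eigenbasis. -/

section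

/-! ### Operators that are diagonal in a Hilbert basis -/

section Diagonal

variable {ι H : Type*} [NormedAddCommGroup H] [InnerProductSpace ℂ H]

lemma hasSum_norm_inner_sq (b : HilbertBasis ι ℂ H) (f : H) :
    HasSum (fun i => ‖⟪b i, f⟫_ℂ‖ ^ 2) (‖f‖ ^ 2) := by
  have h := b.hasSum_inner_mul_inner f f
  have e (i : ι) : ⟪f, b i⟫_ℂ * ⟪b i, f⟫_ℂ = ((‖⟪b i, f⟫_ℂ‖ ^ 2 : ℝ) : ℂ) := by
    rw [← inner_conj_symm, ← Complex.normSq_eq_conj_mul_self, Complex.normSq_eq_norm_sq]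
  have e' : ⟪f, f⟫_ℂ = ((‖f‖ ^ 2 : ℝ) : ℂ) := by
    rw [inner_self_eq_norm_sq_to_K]; push_cast; rfl
  simp_rw [e, e'] at h
  exact Complex.hasSum_ofReal.1 h

lemma norm_le_of_coeff_le (b : HilbertBasis ι ℂ H) {f g : H} {B : ℝ} (hB : 0 ≤ B)
    (h : ∀ i, ‖⟪b i, g⟫_ℂ‖ ≤ B * ‖⟪b i, f⟫_ℂ‖) : ‖g‖ ≤ B * ‖f‖ := by
  refine (pow_le_pow_iff_left₀ (norm_nonneg _) (by positivity) two_ne_zero).1 ?_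
  rw [mul_pow]
  refine hasSum_le (fun i => ?_) (hasSum_norm_inner_sq b g)
    ((hasSum_norm_inner_sq b f).mul_left (B ^ 2))
  rw [← mul_pow]
  exact pow_le_pow_left₀ (norm_nonneg _) (h i) 2

lemma ext_inner_basis (b : HilbertBasis ι ℂ H) {f g : H} (h : ∀ i, ⟪b i, f⟫_ℂ = ⟪b i, g⟫_ℂ) :
    f = g := by
  rw [← sub_eq_zero, ← norm_eq_zero]
  refine le_antisymm ?_ (norm_nonneg _)
  simpa using norm_le_of_coeff_le b (f := 0) (g := f - g) zero_le_one
    fun i => by rw [inner_sub_right, h i]; simp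

/-- A square summable family of coefficients defines a vector. -/
lemma exists_coeff (b : HilbertBasis ι ℂ H) {a : ι → ℂ} (ha : Summable fun i => ‖a i‖ ^ 2) :
    ∃ f, ∀ i, ⟪b i, f⟫_ℂ = a i := by
  have hm : Memℓp a 2 := memℓp_gen (by simpa using ha)
  refine ⟨b.repr.symm ⟨a, hm⟩, fun i => ?_⟩
  rw [← b.repr_apply_apply, LinearIsometryEquiv.apply_symm_apply]

lemma exists_diagonal (b : HilbertBasis ι ℂ H) {t : ι → ℝ} {B : ℝ} (hB : 0 ≤ B)
    (ht : ∀ i, |t i| ≤ B) :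
    ∃ T : H →L[ℂ] H, (∀ i f, ⟪b i, T f⟫_ℂ = t i * ⟪b i, f⟫_ℂ) ∧ ‖T‖ ≤ B := by
  have hn (f : H) (i : ι) : ‖(t i : ℂ) * ⟪b i, f⟫_ℂ‖ ≤ B * ‖⟪b i, f⟫_ℂ‖ := by
    rw [norm_mul, Complex.norm_real, Real.norm_eq_abs]
    gcongr
    exact ht i
  have h (f : H) : ∃ g, ∀ i, ⟪b i, g⟫_ℂ = t i * ⟪b i, f⟫_ℂ := by
    refine exists_coeff b (((hasSum_norm_inner_sq b f).summable.mul_left (B ^ 2)).of_nonneg_of_le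
      (fun i => by positivity) fun i => ?_)
    rw [← mul_pow]
    exact pow_le_pow_left₀ (norm_nonneg _) (hn f i) 2
  choose T hT using h
  have hadd (f g : H) : T (f + g) = T f + T g := ext_inner_basis b fun i => by
    rw [inner_add_right, hT, hT, hT, inner_add_right, mul_add]
  have hsmul (c : ℂ) (f : H) : T (c • f) = c • T f := ext_inner_basis b fun i => by
    rw [inner_smul_right, hT, hT, inner_smul_right, mul_left_comm]
  have hbd (f : H) : ‖T f‖ ≤ B * ‖f‖ :=
    norm_le_of_coeff_le b hB fun i => by rw [hT]; exact hn f i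
  exact ⟨LinearMap.mkContinuous ⟨⟨T, hadd⟩, hsmul⟩ B hbd, fun i f => hT f i,
    LinearMap.mkContinuous_norm_le _ hB _⟩

/-- The operator is a norm limit of finite-rank truncations: off a finite set the diagonal entries
are at most `ε / 2`, and by Parseval so is the error. -/
lemma isCompactOperator_of_diagonal [CompleteSpace H] (b : HilbertBasis ι ℂ H) {t : ι → ℝ}
    (ht : Filter.Tendsto t Filter.cofinite (𝓝 0)) {T : H →L[ℂ] H}
    (hT : ∀ i f, ⟪b i, T f⟫_ℂ = t i * ⟪b i, f⟫_ℂ) : IsCompactOperator T := by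
  classical
  let P (i : ι) : H →L[ℂ] H :=
    (ContinuousLinearMap.toSpanSingleton ℂ (b i)).comp ((t i : ℂ) • innerSL ℂ (b i))
  have hP (i : ι) (f : H) : P i f = ((t i : ℂ) * ⟪b i, f⟫_ℂ) • b i := by
    simp [P, ContinuousLinearMap.toSpanSingleton_apply, mul_smul]
  have hPc (i : ι) : IsCompactOperator (P i) :=
    ((isCompactOperator_id (E := ℂ)).comp_clm ((t i : ℂ) • innerSL ℂ (b i))).clm_comp
      (ContinuousLinearMap.toSpanSingleton ℂ (b i))
  have hsum (s : Finset ι) : IsCompactOperator (∑ i ∈ s, P i : H →L[ℂ] H) := by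
    induction s using Finset.induction_on with
    | empty => simpa using! isCompactOperator_zero
    | insert i s hi ih => rw [Finset.sum_insert hi]; exact (hPc i).add ih
  refine isCompactOperator_of_tendsto (l := Filter.atTop) (F := fun s : Finset ι => ∑ i ∈ s, P i)
    ?_ (Filter.Eventually.of_forall hsum)
  rw [Metric.tendsto_nhds]
  intro ε hε
  have hfin : {i | ¬ |t i| ≤ ε / 2}.Finite := by
    have := (Metric.tendsto_nhds.1 ht) (ε / 2) (by positivity)
    rw [Filter.eventually_cofinite] at this
    refine this.subset fun i hi => ?_
    simp only [mem_ofPred_eq, not_le, Real.dist_eq, sub_zero, not_lt] at hi ⊢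
    exact hi.le
  filter_upwards [Filter.eventually_ge_atTop hfin.toFinset] with s hs
  rw [dist_eq_norm]
  refine lt_of_le_of_lt ?_ (half_lt_self hε)
  refine ContinuousLinearMap.opNorm_le_bound _ (by positivity) fun f => ?_
  refine norm_le_of_coeff_le b (by positivity) fun i => ?_
  have hsP : ⟪b i, (∑ j ∈ s, P j) f⟫_ℂ = if i ∈ s then (t i : ℂ) * ⟪b i, f⟫_ℂ else 0 := by
    rw [sum_apply, inner_sum]
    simp only [hP, inner_smul_right, orthonormal_iff_ite.1 b.orthonormal]
    simp
  rw [sub_apply, inner_sub_right, hsP, hT]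
  split_ifs with hi
  · rw [sub_self, norm_zero]; positivity
  · have : |t i| ≤ ε / 2 := by
      by_contra hcon
      exact hi (hs (hfin.mem_toFinset.2 hcon))
    rw [zero_sub, norm_neg, norm_mul, Complex.norm_real, Real.norm_eq_abs]
    gcongr

/-! ### Eigenvalue counting -/

/-- The dimension argument behind the min-max principle. With more vectors than elements of `s`,
some nontrivial combination `W` is orthogonal to all `b i` with `i ∈ s`. All remaining coefficients
carry weights `p i > 0`, so a nonpositive weighted sum forces `W = 0`, against linear independence.
The two uses are `p = lam - E` and `p = (lam - c) ^ 2 - r ^ 2`. The vectors `z` stand for `H w`, so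
an unbounded operator enters only through its matrix elements. -/
lemma card_le_of_forall_sum {κ : Type*} [Fintype κ] (b : HilbertBasis ι ℂ H)
    (w z : κ → H) (hw : LinearIndependent ℂ w) (lam : ι → ℝ)
    (hz : ∀ i s, ⟪b i, z s⟫_ℂ = lam i * ⟪b i, w s⟫_ℂ) (p : ι → ℝ) (s : Finset ι)
    (hs : ∀ i, p i ≤ 0 → i ∈ s)
    (hform : ∀ a : κ → ℂ, ∃ S ≤ 0, (∀ i, ⟪b i, ∑ j, a j • z j⟫_ℂ =
      lam i * ⟪b i, ∑ j, a j • w j⟫_ℂ) →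
      HasSum (fun i => p i * ‖⟪b i, ∑ j, a j • w j⟫_ℂ‖ ^ 2) S) :
    Fintype.card κ ≤ s.card := by
  by_contra! hlt
  let Φ : (κ → ℂ) →ₗ[ℂ] (s → ℂ) :=
    LinearMap.pi fun i => (innerSL ℂ (b i)).toLinearMap ∘ₗ Fintype.linearCombination ℂ w
  have hker : LinearMap.ker Φ ≠ ⊥ := LinearMap.ker_ne_bot_of_finrank_lt (by simpa using hlt)
  obtain ⟨a, ha, ha0⟩ := Submodule.exists_mem_ne_zero_of_ne_bot hker
  have hΦ (i : ι) (hi : i ∈ s) : ⟪b i, ∑ j, a j • w j⟫_ℂ = 0 := by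
    have := congrFun (LinearMap.mem_ker.1 ha) ⟨i, hi⟩
    change ⟪b i, Fintype.linearCombination ℂ w a⟫_ℂ = 0 at this
    rwa [Fintype.linearCombination_apply] at this
  have hpair (i : ι) : ⟪b i, ∑ j, a j • z j⟫_ℂ = lam i * ⟪b i, ∑ j, a j • w j⟫_ℂ := by
    simp only [inner_sum, inner_smul_right, hz, Finset.mul_sum]
    exact Finset.sum_congr rfl fun j _ => by ring
  obtain ⟨S, hS0, hS⟩ := hform a
  replace hS := hS hpair
  have hnn (i : ι) : 0 ≤ p i * ‖⟪b i, ∑ j, a j • w j⟫_ℂ‖ ^ 2 := by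
    by_cases hi : i ∈ s
    · simp [hΦ i hi]
    · have : 0 < p i := by
        by_contra! h
        exact hi (hs i h)
      positivity
  have hS' : S = 0 := le_antisymm hS0 (hS.nonneg hnn)
  rw [hS', hasSum_zero_iff_of_nonneg hnn] at hS
  have hW : ∑ j, a j • w j = 0 := by
    refine ext_inner_basis b fun i => ?_
    rw [inner_zero_right]
    by_cases hi : i ∈ s
    · exact hΦ i hi
    · have hp : 0 < p i := by
        by_contra! h
        exact hi (hs i h)
      have := congrFun hS i
      simpa [hp.ne'] using this
  exact ha0 (funext fun j => Fintype.linearIndependent_iff.1 hw a hW j)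

/-- If the quadratic form of the operator with eigenbasis `b` and eigenvalues `lam` is at most `E`
on a subspace of dimension `d`, then at least `d` eigenvalues are at most `E`. -/
theorem card_le_of_form_le {κ : Type*} [Fintype κ] (b : HilbertBasis ι ℂ H)
    (w z : κ → H) (hw : LinearIndependent ℂ w) (lam : ι → ℝ)
    (hz : ∀ i s, ⟪b i, z s⟫_ℂ = lam i * ⟪b i, w s⟫_ℂ) (E : ℝ) (s : Finset ι)
    (hs : ∀ i, lam i ≤ E → i ∈ s)
    (hform : ∀ a : κ → ℂ, (⟪∑ j, a j • w j, ∑ j, a j • z j⟫_ℂ).re ≤ E * ‖∑ j, a j • w j‖ ^ 2) :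
    Fintype.card κ ≤ s.card := by
  refine card_le_of_forall_sum b w z hw lam hz (fun i => lam i - E) s
    (fun i hi => hs i (by linarith)) fun a => ⟨_, sub_nonpos.2 (hform a), fun hp => ?_⟩
  set W := ∑ j, a j • w j
  set Z := ∑ j, a j • z j
  have h1 : HasSum (fun i => lam i * ‖⟪b i, W⟫_ℂ‖ ^ 2) (⟪W, Z⟫_ℂ).re := by
    have h := Complex.hasSum_re (b.hasSum_inner_mul_inner W Z)
    convert h using 2 with i
    rw [hp, mul_left_comm, ← inner_conj_symm W, ← Complex.normSq_eq_conj_mul_self,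
      Complex.normSq_eq_norm_sq, ← Complex.ofReal_mul, Complex.ofReal_re]
  simpa only [sub_mul] using h1.sub ((hasSum_norm_inner_sq b W).mul_left E)

/-- If `‖(H - c) w‖ ≤ r ‖w‖` on a subspace of dimension `d`, then at least `d` eigenvalues of `H`
lie in `[c - r, c + r]`. -/
theorem card_le_of_norm_sub_le {κ : Type*} [Fintype κ] (b : HilbertBasis ι ℂ H)
    (w z : κ → H) (hw : LinearIndependent ℂ w) (lam : ι → ℝ)
    (hz : ∀ i s, ⟪b i, z s⟫_ℂ = lam i * ⟪b i, w s⟫_ℂ) (c r : ℝ) (hr : 0 ≤ r) (s : Finset ι)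
    (hs : ∀ i, |lam i - c| ≤ r → i ∈ s)
    (hform : ∀ a : κ → ℂ, ‖∑ j, a j • z j - (c : ℂ) • ∑ j, a j • w j‖ ≤ r * ‖∑ j, a j • w j‖) :
    Fintype.card κ ≤ s.card := by
  refine card_le_of_forall_sum b w z hw lam hz (fun i => (lam i - c) ^ 2 - r ^ 2) s
    (fun i hi => hs i (abs_le_of_sq_le_sq (by linarith) hr)) fun a =>
    ⟨_, sub_nonpos.2 (pow_le_pow_left₀ (norm_nonneg _) (hform a) 2), fun hp => ?_⟩
  set W := ∑ j, a j • w j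
  set Z := ∑ j, a j • z j
  rw [mul_pow]
  have h1 : HasSum (fun i => (lam i - c) ^ 2 * ‖⟪b i, W⟫_ℂ‖ ^ 2) (‖Z - (c : ℂ) • W‖ ^ 2) := by
    convert hasSum_norm_inner_sq b (Z - (c : ℂ) • W) using 2 with i
    rw [inner_sub_right, hp, inner_smul_right, ← sub_mul, ← Complex.ofReal_sub, norm_mul,
      Complex.norm_real, mul_pow, Real.norm_eq_abs, sq_abs]
  simpa only [sub_mul] using h1.sub ((hasSum_norm_inner_sq b W).mul_left (r ^ 2))

/-- A compact symmetric operator has a Hilbert basis of eigenvectors. -/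
theorem exists_hilbertBasis_eigenvectors.{u} {H : Type u} [NormedAddCommGroup H]
    [InnerProductSpace ℂ H] [CompleteSpace H] {T : H →L[ℂ] H} (hTc : IsCompactOperator T)
    (hTs : (T : H →ₗ[ℂ] H).IsSymmetric) :
    ∃ (ι : Type u) (b : HilbertBasis ι ℂ H) (μ : ι → ℝ), ∀ i, T (b i) = (μ i : ℂ) • b i := by
  have hspec := ContinuousLinearMap.orthogonalComplement_iSup_eigenspaces_eq_bot hTc hTs
  have horth := hTs.orthogonalFamily_eigenspaces
  have hclosed (μ : ℂ) : CompleteSpace (Module.End.eigenspace (T : H →ₗ[ℂ] H) μ) := by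
    have : IsClosed (Module.End.eigenspace (T : H →ₗ[ℂ] H) μ : Set H) := by
      have e : (Module.End.eigenspace (T : H →ₗ[ℂ] H) μ : Set H) = {x | T x = μ • x} := by
        ext x; exact Module.End.mem_eigenspace_iff
      rw [e]
      exact isClosed_eq T.continuous (continuous_const_smul μ)
    exact this.completeSpace_coe
  choose w B _ using fun μ : ℂ => exists_hilbertBasis ℂ (Module.End.eigenspace (T : H →ₗ[ℂ] H) μ)
  have hv : Orthonormal ℂ fun a : Σ μ, w μ => ((B a.1 a.2 :) : H) :=
    horth.orthonormal_sigma_orthonormal fun μ => (B μ).orthonormal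
  have hspan : (Submodule.span ℂ (range fun a : Σ μ, w μ => ((B a.1 a.2 :) : H)))ᗮ = ⊥ := by
    rw [eq_bot_iff, ← hspec]
    intro f hf
    rw [Submodule.mem_orthogonal] at hf ⊢
    -- Expansion in the basis of each eigenspace shows that `f` is orthogonal to all eigenspaces; by
    -- the spectral theorem their joint orthogonal complement is zero.
    suffices h : (⨆ μ, Module.End.eigenspace (T : H →ₗ[ℂ] H) μ) ≤ (ℂ ∙ f)ᗮ from fun x hx =>
      (Submodule.mem_orthogonal_singleton_iff_inner_left).1 (h hx)
    refine iSup_le fun μ x hx => ?_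
    rw [Submodule.mem_orthogonal_singleton_iff_inner_left, ← inner_conj_symm]
    have hsum := (((B μ).hasSum_repr ⟨x, hx⟩).mapL (Submodule.subtypeL _)).mapL (innerSL ℂ f)
    have h0 (i : w μ) : (innerSL ℂ f) ((Submodule.subtypeL _)
        ((B μ).repr ⟨x, hx⟩ i • B μ i)) = 0 := by
      have h3 : ⟪((B μ i :) : H), f⟫_ℂ = 0 := hf _ (Submodule.subset_span ⟨⟨μ, i⟩, rfl⟩)
      rw [map_smul, map_smul, innerSL_apply_apply, Submodule.subtypeL_apply, ← inner_conj_symm, h3,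
        map_zero, smul_zero]
    simp only [h0] at hsum
    have h5 : ⟪f, x⟫_ℂ = 0 := hsum.unique hasSum_zero
    rw [h5, map_zero]
  have key (a : Σ μ, w μ) : ∃ μ : ℝ, T (B a.1 a.2 :) = (μ : ℂ) • ((B a.1 a.2 :) : H) := by
    have hmem := (B a.1 a.2).2
    have hreal : (starRingEnd ℂ) a.1 = a.1 := hTs.conj_eigenvalue_eq_self
      (Module.End.hasEigenvalue_of_hasEigenvector ⟨hmem, hv.ne_zero a⟩)
    obtain ⟨μ, hμ⟩ := Complex.conj_eq_iff_real.1 hreal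
    exact ⟨μ, by rw [← hμ]; exact Module.End.mem_eigenspace_iff.1 hmem⟩
  choose μ hμ using key
  exact ⟨_, HilbertBasis.mkOfOrthogonalEqBot hv hspan, μ,
    fun i => by rw [HilbertBasis.coe_mkOfOrthogonalEqBot]; exact hμ i⟩

end Diagonal

/-! ### The resolvent -/

variable {u₁ : Plane} {k : Plane} {V : Plane → ℝ}

lemma exists_potential_bound [Fact (u₁ ≠ 0)] (hV : IsSuperHoneycomb u₁ V) :
    ∃ C, 0 ≤ C ∧ ∀ x, |V x| ≤ C := by
  obtain ⟨C, hC⟩ := smoothBloch_bounded (potFun hV)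
  have h (x : Plane) : |V x| ≤ C := by
    have := hC x
    change ‖(V x : ℂ)‖ ≤ C at this
    simpa using this
  exact ⟨C, (abs_nonneg _).trans (h 0), h⟩

/-- Multiplication by `V` on the cell does not see the quasi-momentum, so one bounded operator
serves all `k`. -/
lemma exists_potential_operator [Fact (u₁ ≠ 0)] (hV : IsSuperHoneycomb u₁ V) {C : ℝ}
    (hC0 : 0 ≤ C) (hC : ∀ x, |V x| ≤ C) :
    ∃ M : CellL2 u₁ →L[ℂ] CellL2 u₁, ‖M‖ ≤ C ∧ (∀ f g, ⟪M f, g⟫_ℂ = ⟪f, M g⟫_ℂ) ∧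
      ∀ (k : Plane) (f : smoothBloch u₁ k), M (blochToL2 k f) = blochToL2 k (potMul hV k f) := by
  have hVm : AEStronglyMeasurable (fun x => (V x : ℂ)) (cellMeasure u₁) :=
    (smoothBloch_continuous (potFun hV)).aestronglyMeasurable
  have hb (f : CellL2 u₁) : ∀ᵐ x ∂(cellMeasure u₁), ‖(V x : ℂ) * f x‖ ≤ C * ‖f x‖ := by
    filter_upwards with x
    rw [norm_mul, Complex.norm_real, Real.norm_eq_abs]
    gcongr
    exact hC x
  have hm (f : CellL2 u₁) : MemLp (fun x => (V x : ℂ) * f x) 2 (cellMeasure u₁) :=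
    (Lp.memLp f).of_le_mul (hVm.mul (Lp.memLp f).1) (hb f)
  let T (f : CellL2 u₁) : CellL2 u₁ := (hm f).toLp (fun x => (V x : ℂ) * f x)
  have hT (f : CellL2 u₁) : T f =ᵐ[cellMeasure u₁] fun x => (V x : ℂ) * f x := (hm f).coeFn_toLp
  have hadd (f g : CellL2 u₁) : T (f + g) = T f + T g := by
    refine Lp.ext ?_
    filter_upwards [hT (f + g), hT f, hT g, Lp.coeFn_add f g, Lp.coeFn_add (T f) (T g)] with
      x h1 h2 h3 h4 h5
    rw [h1, h5, h4, Pi.add_apply, Pi.add_apply, h2, h3, mul_add]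
  have hsmul (c : ℂ) (f : CellL2 u₁) : T (c • f) = c • T f := by
    refine Lp.ext ?_
    filter_upwards [hT (c • f), hT f, Lp.coeFn_smul c f, Lp.coeFn_smul c (T f)] with x h1 h2 h3 h4
    rw [h1, h4, h3, Pi.smul_apply, Pi.smul_apply, h2, smul_eq_mul, smul_eq_mul, mul_left_comm]
  have hbd (f : CellL2 u₁) : ‖T f‖ ≤ C * ‖f‖ := by
    refine Lp.norm_le_mul_norm_of_ae_le_mul ?_
    filter_upwards [hT f, hb f] with x h1 h2
    rwa [h1]
  refine ⟨LinearMap.mkContinuous ⟨⟨T, hadd⟩, hsmul⟩ C hbd, LinearMap.mkContinuous_norm_le _ hC0 _,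
    fun f g => ?_, fun k f => ?_⟩
  · change ⟪T f, g⟫_ℂ = ⟪f, T g⟫_ℂ
    rw [L2.inner_def, L2.inner_def]
    refine integral_congr_ae ?_
    filter_upwards [hT f, hT g] with x h1 h2
    rw [h1, h2, RCLike.inner_apply, RCLike.inner_apply, map_mul, Complex.conj_ofReal]
    ring
  · change T (blochToL2 k f) = _
    refine Lp.ext ?_
    filter_upwards [hT (blochToL2 k f), coeFn_blochToL2 f, coeFn_blochToL2 (potMul hV k f)] with
      x h1 h2 h3
    rw [h1, h2, h3, potMul_apply]

/-- A compact symmetric injective operator whose eigenvectors are weak eigenfunctions of the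
Schrödinger operator. -/
lemma exists_resolvent [Fact (u₁ ≠ 0)] (hV : IsSuperHoneycomb u₁ V) (k : Plane) :
    ∃ (T : CellL2 u₁ →L[ℂ] CellL2 u₁) (c : ℝ), IsCompactOperator T ∧
      (T : CellL2 u₁ →ₗ[ℂ] CellL2 u₁).IsSymmetric ∧ (∀ f, T f = 0 → f = 0) ∧
      ∀ (f : CellL2 u₁) (μ : ℝ), μ ≠ 0 → T f = (μ : ℂ) • f → ∀ m,
        ⟪blochToL2 k (hamiltonian hV k (wave k m) - ((μ⁻¹ - c : ℝ) : ℂ) • wave k m), f⟫_ℂ = 0 := by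
  obtain ⟨C, hC0, hC⟩ := exists_potential_bound hV
  obtain ⟨M, hM, hMs, hMb⟩ := exists_potential_operator hV hC0 hC
  set b := fourierBasis (u₁ := u₁) k
  -- The symbol of `(-Δ + 1 + C)⁻¹`, where `C` bounds `|V|`.
  set t : (Fin 2 → ℤ) → ℝ := fun m => (weight u₁ k m + C)⁻¹
  have hw := one_le_weight (u₁ := u₁) (k := k)
  have htpos (m) : 0 < t m := inv_pos.2 (by linarith [hw m])
  have htle (m) : |t m| ≤ (1 + C)⁻¹ := by
    rw [abs_of_pos (htpos m)]
    exact inv_anti₀ (by positivity) (by linarith [hw m])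
  obtain ⟨T₀, hT₀, hT₀n⟩ := exists_diagonal b (by positivity : 0 ≤ (1 + C)⁻¹) htle
  have ht0 : Filter.Tendsto t Filter.cofinite (𝓝 0) := by
    have h1 := (summable_inv_weight_sq (u₁ := u₁) k).tendsto_cofinite_zero.sqrt
    rw [Real.sqrt_zero] at h1
    refine squeeze_zero (fun m => (htpos m).le) (fun m => ?_) h1
    rw [Real.sqrt_inv, Real.sqrt_sq (by linarith [hw m])]
    exact inv_anti₀ (by linarith [hw m]) (by linarith)
  have hT₀c := isCompactOperator_of_diagonal b ht0 hT₀
  have hT₀s (f g : CellL2 u₁) : ⟪T₀ f, g⟫_ℂ = ⟪f, T₀ g⟫_ℂ := by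
    rw [← b.tsum_inner_mul_inner, ← b.tsum_inner_mul_inner]
    refine tsum_congr fun m => ?_
    rw [hT₀, ← inner_conj_symm, hT₀, map_mul, Complex.conj_ofReal, inner_conj_symm]
    ring
  -- The shift by `C` makes `‖T₀ M‖ ≤ C / (1 + C)`, so `1 + T₀ M` is invertible. Then `T = (1 + T₀
  -- M)⁻¹ T₀` is the resolvent `(H + 1 + C)⁻¹`, and an eigenvalue `μ` of `T` corresponds to the
  -- energy `μ⁻¹ - (1 + C)`.
  have hnorm : ‖-(T₀ * M)‖ < 1 := by
    rw [norm_neg]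
    calc ‖T₀ * M‖ ≤ ‖T₀‖ * ‖M‖ := norm_mul_le _ _
      _ ≤ (1 + C)⁻¹ * C := by gcongr
      _ < 1 := by rw [inv_mul_lt_iff₀ (by positivity)]; linarith
  obtain ⟨U, hU⟩ := isUnit_one_sub_of_norm_lt_one hnorm
  rw [sub_neg_eq_add] at hU
  set T : CellL2 u₁ →L[ℂ] CellL2 u₁ := (↑U⁻¹ : CellL2 u₁ →L[ℂ] CellL2 u₁) * T₀ with hTdef
  have hT (f : CellL2 u₁) : T f + T₀ (M (T f)) = T₀ f := by
    have h1 : (1 + T₀ * M) * T = T₀ := by rw [hTdef, ← hU, Units.mul_inv_cancel_left]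
    exact congrArg (· f) h1
  refine ⟨T, 1 + C, hT₀c.clm_comp _, fun f g => ?_, fun f hf => ?_, fun f μ hμ hf m => ?_⟩
  -- In this form the symmetry of `T` follows from that of `T₀` and `M`, without handling the
  -- inverse.
  · have h1 : T f = T₀ (f - M (T f)) := by rw [map_sub, ← hT f]; abel
    have h2 : T g = T₀ (g - M (T g)) := by rw [map_sub, ← hT g]; abel
    have h3 : ⟪T f, g - M (T g)⟫_ℂ = ⟪f - M (T f), T g⟫_ℂ := by
      conv_lhs => rw [h1]
      conv_rhs => rw [h2]
      exact hT₀s _ _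
    rw [inner_sub_right, inner_sub_left, hMs] at h3
    exact sub_left_injective h3
  · have h1 := hT f
    rw [hf, map_zero, map_zero, zero_add] at h1
    refine ext_inner_basis b fun m => ?_
    have := hT₀ m f
    rw [← h1, inner_zero_right, zero_eq_mul] at this
    rw [inner_zero_right]
    exact this.resolve_left (by exact_mod_cast (htpos m).ne')
  · have h1 := hT f
    rw [hf, map_smul, map_smul] at h1
    have h2 := congrArg (fun x => ⟪b m, x⟫_ℂ) h1
    simp only [inner_add_right, inner_smul_right, hT₀] at h2
    rw [show b m = blochToL2 k (wave k m) from fourierBasis_apply m] at h2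
    rw [← hMs, hMb] at h2
    rw [hamiltonian_eq, map_sub, map_add, map_neg, map_smul, blochLap_wave, map_smul,
      inner_sub_left, inner_add_left, inner_neg_left, inner_smul_left, inner_smul_left]
    have hwc : ((weight u₁ k m + C : ℝ) : ℂ) ≠ 0 := by
      exact_mod_cast (by linarith [hw m] : (0 : ℝ) < weight u₁ k m + C).ne'
    have hμc : (μ : ℂ) ≠ 0 := by exact_mod_cast hμ
    simp only [t] at h2
    push_cast at h2 hwc
    field_simp at h2
    simp only [weight] at h2
    push_cast at h2 ⊢
    simp only [map_neg, map_pow, Complex.conj_ofReal, map_sub, map_inv₀, map_add, map_one]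
    field_simp
    linear_combination h2

/-- A Hilbert basis of `L²(Ω)` consisting of smooth quasi-periodic eigenfunctions. -/
structure EigenBasis [Fact (u₁ ≠ 0)] (hV : IsSuperHoneycomb u₁ V) (k : Plane) where
  /-- The index set. -/
  ι : Type
  /-- The basis. -/
  basis : HilbertBasis ι ℂ (CellL2 u₁)
  /-- The eigenvalues. -/
  eig : ι → ℝ
  /-- The smooth eigenfunctions. -/
  fn : ι → smoothBloch u₁ k
  basis_eq : ∀ i, basis i = blochToL2 k (fn i)
  eig_fn : ∀ i, hamiltonian hV k (fn i) = (eig i : ℂ) • fn i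

/-- Eigenvectors of the compact resolvent form a basis. Injectivity excludes the eigenvalue `0`, so
each is a weak eigenfunction of the Hamiltonian, and elliptic regularity makes it smooth. -/
theorem nonempty_eigenBasis [Fact (u₁ ≠ 0)] (hV : IsSuperHoneycomb u₁ V) (k : Plane) :
    Nonempty (EigenBasis hV k) := by
  obtain ⟨T, c, hTc, hTs, hT0, hTe⟩ := exists_resolvent hV k
  obtain ⟨ι, b, μ, hb⟩ := exists_hilbertBasis_eigenvectors hTc hTs
  have key (i : ι) : ∃ (E : ℝ) (F : smoothBloch u₁ k),
      b i = blochToL2 k F ∧ hamiltonian hV k F = (E : ℂ) • F := by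
    have hne : b i ≠ 0 := b.orthonormal.ne_zero i
    have hμ0 : μ i ≠ 0 := by
      intro h
      refine hne (hT0 _ ?_)
      rw [hb, h, Complex.ofReal_zero, zero_smul]
    obtain ⟨F, hF1, hF2⟩ := exists_smooth_of_weak hV (g := 0) (f := b i) fun m => by
      rw [hTe (b i) (μ i) hμ0 (hb i) m, map_zero, inner_zero_right]
    exact ⟨_, F, hF1.symm, sub_eq_zero.1 hF2⟩
  choose E F hF1 hF2 using key
  exact ⟨⟨ι, b, E, F, hF1, hF2⟩⟩

end

/-! ### Form bounds, band functions and stability of eigenvalue counts. -/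

section

variable {u₁ : Plane} {k : Plane} {V : Plane → ℝ}

/-! ### Form bounds -/

/-- A bounded potential changes the form by at most `C ‖f‖²`. The same `C` for all `k` gives
semiboundedness, and uniform control of gradients at bounded energy. -/
lemma exists_form_bound [Fact (u₁ ≠ 0)] (hV : IsSuperHoneycomb u₁ V) :
    ∃ C, 0 ≤ C ∧ ∀ (k : Plane) (f : smoothBloch u₁ k),
      -(⟪blochToL2 k f, blochToL2 k (blochLap k f)⟫_ℂ).re ≤
        (⟪blochToL2 k f, blochToL2 k (hamiltonian hV k f)⟫_ℂ).re + C * ‖blochToL2 k f‖ ^ 2 := by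
  obtain ⟨C, hC0, hC⟩ := exists_potential_bound hV
  obtain ⟨M, hM, -, hMb⟩ := exists_potential_operator hV hC0 hC
  refine ⟨C, hC0, fun k f => ?_⟩
  rw [hamiltonian_eq, map_add, map_neg, inner_add_right, inner_neg_right, ← hMb, Complex.add_re,
    Complex.neg_re]
  have h1 : ‖⟪blochToL2 k f, M (blochToL2 k f)⟫_ℂ‖ ≤ C * ‖blochToL2 k f‖ ^ 2 := by
    refine (norm_inner_le_norm _ _).trans ?_
    have := (M.le_opNorm (blochToL2 k f)).trans
      (mul_le_mul_of_nonneg_right hM (norm_nonneg _))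
    nlinarith [norm_nonneg (blochToL2 k f)]
  have h2 := (abs_le.1 ((Complex.abs_re_le_norm _).trans h1)).1
  linarith

lemma neg_inner_blochLap_nonneg [Fact (u₁ ≠ 0)] (f : smoothBloch u₁ k) :
    0 ≤ -(⟪blochToL2 k f, blochToL2 k (blochLap k f)⟫_ℂ).re := by
  rw [← Complex.neg_re, ← norm_dirD_sq_add, Complex.ofReal_re]
  positivity

lemma norm_dirD_sq_le [Fact (u₁ ≠ 0)] (v : Plane) (f : smoothBloch u₁ k) :
    ‖blochToL2 k (dirD k v f)‖ ^ 2 ≤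
      ‖v‖ ^ 2 * -(⟪blochToL2 k f, blochToL2 k (blochLap k f)⟫_ℂ).re := by
  rw [← Complex.neg_re, ← norm_dirD_sq_add, Complex.ofReal_re]
  exact norm_dirD_le v f

/-! ### Properties of the eigenbasis -/

/-- A choice of an eigenbasis. -/
def eigenBasis [Fact (u₁ ≠ 0)] (hV : IsSuperHoneycomb u₁ V) (k : Plane) : EigenBasis hV k :=
  (nonempty_eigenBasis hV k).some

namespace EigenBasis

variable [Fact (u₁ ≠ 0)] {hV : IsSuperHoneycomb u₁ V} (B : EigenBasis hV k)

lemma inner_hamiltonian (i : B.ι) (f : smoothBloch u₁ k) :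
    ⟪B.basis i, blochToL2 k (hamiltonian hV k f)⟫_ℂ = B.eig i * ⟪B.basis i, blochToL2 k f⟫_ℂ := by
  rw [B.basis_eq, ← SuperHoneycomb.inner_hamiltonian, B.eig_fn, map_smul, inner_smul_left,
    Complex.conj_ofReal]

lemma orthonormal_fn : Orthonormal ℂ fun i => blochToL2 k (B.fn i) := by
  simpa only [← B.basis_eq] using B.basis.orthonormal

variable {κ : Type*} [Fintype κ] (e : κ ↪ B.ι) (a : κ → ℂ)

lemma norm_sq_sum : ‖blochToL2 k (∑ j, a j • B.fn (e j))‖ ^ 2 = ∑ j, ‖a j‖ ^ 2 := by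
  have h := (B.orthonormal_fn.comp e e.injective).inner_sum a a Finset.univ
  have h2 : ((‖blochToL2 k (∑ j, a j • B.fn (e j))‖ ^ 2 : ℝ) : ℂ) =
      ((∑ j, ‖a j‖ ^ 2 : ℝ) : ℂ) := by
    simp only [map_sum, map_smul]
    push_cast
    refine (inner_self_eq_norm_sq_to_K (𝕜 := ℂ) _).symm.trans (h.trans ?_)
    refine Finset.sum_congr rfl fun j _ => ?_
    rw [← Complex.normSq_eq_conj_mul_self, Complex.normSq_eq_norm_sq, Complex.ofReal_pow]
  exact_mod_cast h2

lemma re_inner_hamiltonian_sum :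
    (⟪blochToL2 k (∑ j, a j • B.fn (e j)),
      blochToL2 k (hamiltonian hV k (∑ j, a j • B.fn (e j)))⟫_ℂ).re =
      ∑ j, B.eig (e j) * ‖a j‖ ^ 2 := by
  have h := (B.orthonormal_fn.comp e e.injective).inner_sum a
    (fun j => a j * B.eig (e j)) Finset.univ
  have h2 : ⟪blochToL2 k (∑ j, a j • B.fn (e j)),
      blochToL2 k (hamiltonian hV k (∑ j, a j • B.fn (e j)))⟫_ℂ =
      ((∑ j, B.eig (e j) * ‖a j‖ ^ 2 : ℝ) : ℂ) := by
    simp only [map_sum, map_smul, B.eig_fn, smul_smul]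
    push_cast
    refine h.trans (Finset.sum_congr rfl fun j _ => ?_)
    rw [← mul_assoc, ← Complex.normSq_eq_conj_mul_self, Complex.normSq_eq_norm_sq,
      Complex.ofReal_pow, mul_comm]
  rw [h2, Complex.ofReal_re]

lemma re_inner_hamiltonian_le {E : ℝ} (hE : ∀ j, B.eig (e j) ≤ E) :
    (⟪blochToL2 k (∑ j, a j • B.fn (e j)),
      blochToL2 k (hamiltonian hV k (∑ j, a j • B.fn (e j)))⟫_ℂ).re ≤
      E * ‖blochToL2 k (∑ j, a j • B.fn (e j))‖ ^ 2 := by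
  rw [re_inner_hamiltonian_sum, norm_sq_sum, Finset.mul_sum]
  exact Finset.sum_le_sum fun j _ => mul_le_mul_of_nonneg_right (hE j) (sq_nonneg _)

end EigenBasis

lemma finite_setOf_waveVec_le [Fact (u₁ ≠ 0)] (k : Plane) (R : ℝ) :
    {m | ‖waveVec u₁ k m‖ ^ 2 ≤ R}.Finite := by
  have h := (summable_inv_weight_sq (u₁ := u₁) k).tendsto_cofinite_zero
  have hR : (0 : ℝ) < ((2 + |R|) ^ 2)⁻¹ := by positivity
  have h2 := h.eventually (gt_mem_nhds hR)
  rw [Filter.eventually_cofinite] at h2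
  refine h2.subset fun m hm => ?_
  rw [mem_ofPred_eq, not_lt]
  have hw := weight_pos (u₁ := u₁) (k := k) m
  refine inv_anti₀ (by positivity) (pow_le_pow_left₀ hw.le ?_ 2)
  have hm' : ‖waveVec u₁ k m‖ ^ 2 ≤ R := hm
  rw [weight]
  linarith [le_abs_self R]

namespace EigenBasis

variable [Fact (u₁ ≠ 0)] {hV : IsSuperHoneycomb u₁ V} (B : EigenBasis hV k)

/-- Eigenfunctions with energy at most `E` span a space on which the form of `-Δ` is at most `E +
C`. Counting against the plane waves, the eigenbasis of `-Δ`, bounds their number by that of the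
finitely many wave vectors with square at most `E + C`. -/
lemma finite_setOf_eig_le (E : ℝ) : {i | B.eig i ≤ E}.Finite := by
  obtain ⟨C, -, hC⟩ := exists_form_bound hV
  have hfin := finite_setOf_waveVec_le (u₁ := u₁) k (E + C)
  by_contra hinf
  obtain ⟨s, hs, hcard⟩ := (show {i | B.eig i ≤ E}.Infinite from hinf).exists_subset_card_eq
    (hfin.toFinset.card + 1)
  let e : s ↪ B.ι := Function.Embedding.subtype _
  have h := card_le_of_form_le (fourierBasis (u₁ := u₁) k) (fun j : s => blochToL2 k (B.fn (e j)))
    (fun j : s => blochToL2 k (-blochLap k (B.fn (e j))))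
    (B.orthonormal_fn.comp e e.injective).linearIndependent
    (fun m => ‖waveVec u₁ k m‖ ^ 2) (fun m j => ?_) (E + C) hfin.toFinset
    (fun m hm => hfin.mem_toFinset.2 hm) fun a => ?_
  · rw [Fintype.card_coe, hcard] at h
    omega
  · rw [fourierBasis_apply, map_neg, inner_neg_right, ← inner_blochLap, blochLap_wave, map_smul,
      inner_smul_left]
    simp
  · have e1 : ∑ j, a j • blochToL2 k (B.fn (e j)) = blochToL2 k (∑ j, a j • B.fn (e j)) := by
      simp
    have e2 : ∑ j, a j • blochToL2 k (-blochLap k (B.fn (e j))) =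
        -blochToL2 k (blochLap k (∑ j, a j • B.fn (e j))) := by
      simp
    rw [e1, e2, inner_neg_right, Complex.neg_re, add_mul]
    refine (hC k _).trans (add_le_add_left ?_ _)
    exact B.re_inner_hamiltonian_le e a fun j => hs j.2

/-- The number of eigenvalues that are at most `E`. -/
def count (E : ℝ) : ℕ := (B.finite_setOf_eig_le E).toFinset.card

lemma count_mono : Monotone B.count := fun E E' h =>
  Finset.card_le_card fun i hi => by
    simp only [Set.Finite.mem_toFinset, mem_ofPred_eq] at hi ⊢
    exact hi.trans h

lemma infinite_index : Infinite B.ι := by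
  by_contra h
  rw [not_infinite_iff_finite] at h
  have := Fintype.ofFinite B.ι
  have : FiniteDimensional ℂ (CellL2 u₁) := B.basis.toOrthonormalBasis.toBasis.finiteDimensional_of_finite
  have h2 := (fourierBasis (u₁ := u₁) k).orthonormal.linearIndependent
  exact (inferInstance : Infinite (Fin 2 → ℤ)).not_finite h2.finite

/-- Nonemptiness of the set in `band_eq`, so that its infimum is not a default value. -/
lemma exists_le_count (n : ℕ) : ∃ E, n ≤ B.count E := by
  have := B.infinite_index
  obtain ⟨s, hs⟩ := Infinite.exists_subset_card_eq B.ι n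
  obtain ⟨E, hE⟩ := (s.image B.eig).exists_le
  refine ⟨E, hs ▸ Finset.card_le_card fun i hi => ?_⟩
  simpa using hE _ (Finset.mem_image_of_mem _ hi)

lemma exists_eig_lower_bound : ∃ C, ∀ i, C ≤ B.eig i := by
  obtain ⟨C, -, hC⟩ := exists_form_bound hV
  refine ⟨-C, fun i => ?_⟩
  have h1 := (neg_inner_blochLap_nonneg (B.fn i)).trans (hC k (B.fn i))
  rw [B.eig_fn, map_smul, inner_smul_right, inner_self_eq_norm_sq_to_K,
    B.orthonormal_fn.1 i] at h1
  simp at h1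
  linarith

/-! ### The band functions -/

lemma basis_mem_eigenspace (i : B.ι) : B.basis i ∈ eigenspace u₁ V k (B.eig i) := by
  rw [eigenspace, Submodule.mem_orthogonal]
  intro g hg
  refine Submodule.span_induction (p := fun g _ => ⟪g, B.basis i⟫_ℂ = 0) ?_ (by simp) ?_ ?_ hg
  · rintro g ⟨ψ, hψ, hg⟩
    have e : g = blochToL2 k (hamiltonian hV k ⟨ψ, hψ⟩ - (B.eig i : ℂ) • ⟨ψ, hψ⟩) := by
      refine Lp.ext (hg.trans ?_)
      have := coeFn_blochToL2 (hamiltonian hV k ⟨ψ, hψ⟩ - (B.eig i : ℂ) • ⟨ψ, hψ⟩)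
      rw [hamiltonian_sub_apply] at this
      exact this.symm
    rw [e, B.basis_eq, map_sub, inner_sub_left, SuperHoneycomb.inner_hamiltonian, B.eig_fn,
      map_smul, map_smul, inner_smul_left, inner_smul_right, Complex.conj_ofReal, sub_self]
  · intro x y _ _ hx hy; rw [inner_add_left, hx, hy, add_zero]
  · intro c x _ hx; rw [inner_smul_left, hx, mul_zero]

/-- A smooth basis eigenfunction is itself an admissible test function in the weak definition. -/
lemma inner_eq_zero_of_mem_eigenspace {E : ℝ} {f : CellL2 u₁} (hf : f ∈ eigenspace u₁ V k E)
    {i : B.ι} (hi : B.eig i ≠ E) : ⟪B.basis i, f⟫_ℂ = 0 := by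
  rw [eigenspace, Submodule.mem_orthogonal] at hf
  have h := hf (blochToL2 k (hamiltonian hV k (B.fn i) - (E : ℂ) • B.fn i))
    (Submodule.subset_span ⟨_, (B.fn i).2, by
      rw [← hamiltonian_sub_apply hV]; exact coeFn_blochToL2 _⟩)
  rw [B.eig_fn, map_sub, map_smul, map_smul, ← sub_smul, inner_smul_left, ← B.basis_eq,
    mul_eq_zero] at h
  refine h.resolve_left ?_
  rw [← Complex.ofReal_sub, Complex.conj_ofReal]
  exact Complex.ofReal_ne_zero.2 (sub_ne_zero.2 hi)

lemma mem_span_of_inner_eq_zero (s : Finset B.ι) {f : CellL2 u₁}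
    (hf : ∀ i ∉ s, ⟪B.basis i, f⟫_ℂ = 0) :
    f ∈ Submodule.span ℂ (range fun i : s => B.basis i) := by
  classical
  have : f = ∑ i : s, ⟪B.basis i, f⟫_ℂ • B.basis i := by
    refine ext_inner_basis B.basis fun i => ?_
    simp only [inner_sum, inner_smul_right, orthonormal_iff_ite.1 B.basis.orthonormal]
    rw [Finset.sum_coe_sort s fun j => ⟪B.basis j, f⟫_ℂ * if i = j then 1 else 0]
    by_cases hi : i ∈ s
    · simp [hi]
    · simp [hi, hf i hi]
  rw [this]
  exact Submodule.sum_mem _ fun i _ => Submodule.smul_mem _ _ (Submodule.subset_span ⟨i, rfl⟩)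

/-- The link between the definition of the bands and counting: the weak eigenspaces up to `E` span
exactly the basis vectors with eigenvalue at most `E`, so the rank does not depend on the chosen
basis. -/
lemma rank_iSup_eigenspace (E : ℝ) :
    Module.rank ℂ (⨆ (l : ℝ) (_ : l ≤ E), eigenspace u₁ V k l : Submodule ℂ (CellL2 u₁)) =
      B.count E := by
  set s := (B.finite_setOf_eig_le E).toFinset with hs
  have h : (⨆ (l : ℝ) (_ : l ≤ E), eigenspace u₁ V k l : Submodule ℂ (CellL2 u₁)) =
      Submodule.span ℂ (range fun i : s => B.basis i) := by
    refine le_antisymm (iSup₂_le fun l hl f hf => B.mem_span_of_inner_eq_zero s fun i hi =>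
      B.inner_eq_zero_of_mem_eigenspace hf ?_) (Submodule.span_le.2 ?_)
    · rintro rfl
      exact hi (by simpa [hs] using hl)
    · rintro _ ⟨⟨i, hi⟩, rfl⟩
      have hi' : B.eig i ≤ E := by simpa [hs] using hi
      exact Submodule.mem_iSup_of_mem _ (Submodule.mem_iSup_of_mem hi' (B.basis_mem_eigenspace i))
  have hl : LinearIndependent ℂ fun i : s => B.basis i :=
    (B.basis.orthonormal.comp _ Subtype.val_injective).linearIndependent
  rw [h, rank_span hl, Cardinal.mk_range_eq _ hl.injective, count, Cardinal.mk_coe_finset]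

lemma band_eq (n : ℕ) : band u₁ V n k = sInf {E : ℝ | n ≤ B.count E} := by
  rw [band]
  congr 1
  ext E
  rw [mem_ofPred_eq, mem_ofPred_eq, B.rank_iSup_eigenspace, Nat.cast_le]

/-- For `n = 0` the set is all of `ℝ`; for `n ≥ 1` any admissible `E` dominates some eigenvalue. -/
lemma bddBelow_setOf_le_count {n : ℕ} (hn : 1 ≤ n) : BddBelow {E : ℝ | n ≤ B.count E} := by
  obtain ⟨C, hC⟩ := B.exists_eig_lower_bound
  refine ⟨C, fun E hE => ?_⟩
  have : 0 < B.count E := lt_of_lt_of_le hn hE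
  obtain ⟨i, hi⟩ := Finset.card_pos.1 this
  exact (hC i).trans (by simpa using hi)

lemma band_le {n : ℕ} (hn : 1 ≤ n) {E : ℝ} (h : n ≤ B.count E) : band u₁ V n k ≤ E := by
  rw [B.band_eq]
  exact csInf_le (B.bddBelow_setOf_le_count hn) h

lemma le_band {n : ℕ} {E : ℝ} (h : ∀ E' < E, B.count E' < n) : E ≤ band u₁ V n k := by
  rw [B.band_eq]
  refine le_csInf (B.exists_le_count n) fun E' hE' => ?_
  by_contra! hlt
  exact (h E' hlt).not_ge hE'

lemma count_lt_of_lt_band {n : ℕ} (hn : 1 ≤ n) {E : ℝ} (h : E < band u₁ V n k) :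
    B.count E < n := by
  by_contra! hle
  exact (B.band_le hn hle).not_gt h

lemma exists_le_count_of_band_lt {n : ℕ} {E : ℝ} (h : band u₁ V n k < E) :
    ∃ E' < E, n ≤ B.count E' := by
  rw [B.band_eq] at h
  obtain ⟨E', h1, h2⟩ := exists_lt_of_csInf_lt (B.exists_le_count n) h
  exact ⟨E', h2, h1⟩

end EigenBasis

/-! ### Continuity of the counting function in the quasi-momentum -/

/-- The cross term `2i(k' - k)·∇` is estimated by Cauchy–Schwarz. The form bound controls the
gradient by `√(E + C) ‖f‖` at energy at most `E`. -/
lemma re_inner_hamiltonian_phaseMap_le [Fact (u₁ ≠ 0)] (hV : IsSuperHoneycomb u₁ V) {C E : ℝ}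
    (hC : ∀ (k : Plane) (f : smoothBloch u₁ k),
      -(⟪blochToL2 k f, blochToL2 k (blochLap k f)⟫_ℂ).re ≤
        (⟪blochToL2 k f, blochToL2 k (hamiltonian hV k f)⟫_ℂ).re + C * ‖blochToL2 k f‖ ^ 2)
    (hE : 0 ≤ E + C) (k' : Plane) (f : smoothBloch u₁ k)
    (hf : (⟪blochToL2 k f, blochToL2 k (hamiltonian hV k f)⟫_ℂ).re ≤ E * ‖blochToL2 k f‖ ^ 2) :
    (⟪blochToL2 k' (phaseMap k k' f), blochToL2 k' (hamiltonian hV k' (phaseMap k k' f))⟫_ℂ).re ≤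
      (E + 2 * ‖k' - k‖ * Real.sqrt (E + C) + ‖k' - k‖ ^ 2) *
        ‖blochToL2 k' (phaseMap k k' f)‖ ^ 2 := by
  rw [hamiltonian_phaseMap, inner_phaseMap, norm_phaseMap, map_add, map_sub, map_smul, map_smul,
    inner_add_right, inner_sub_right, inner_smul_right, inner_smul_right, Complex.add_re,
    Complex.sub_re]
  set F := blochToL2 k f
  set D := blochToL2 k (dirD k (k' - k) f)
  have h1 : ‖D‖ ≤ ‖k' - k‖ * Real.sqrt (E + C) * ‖F‖ := by
    refine (pow_le_pow_iff_left₀ (norm_nonneg _) (by positivity) two_ne_zero).1 ?_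
    refine (norm_dirD_sq_le (k' - k) f).trans ?_
    rw [mul_pow, mul_pow, Real.sq_sqrt hE, mul_assoc]
    gcongr
    exact (hC k f).trans (by rw [add_mul]; exact add_le_add_left hf _)
  have h2 : |(2 * Complex.I * ⟪F, D⟫_ℂ).re| ≤ 2 * (‖F‖ * ‖D‖) := by
    refine (Complex.abs_re_le_norm _).trans ?_
    rw [norm_mul, norm_mul, Complex.norm_I, mul_one, Complex.norm_ofNat]
    gcongr
    exact norm_inner_le_norm _ _
  have h3 : (((‖k' - k‖ : ℂ) ^ 2) * ⟪F, F⟫_ℂ).re = ‖k' - k‖ ^ 2 * ‖F‖ ^ 2 := by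
    have e : ⟪F, F⟫_ℂ = ((‖F‖ ^ 2 : ℝ) : ℂ) := by
      rw [inner_self_eq_norm_sq_to_K]; push_cast; rfl
    rw [e, ← Complex.ofReal_pow, ← Complex.ofReal_mul, Complex.ofReal_re]
  rw [h3]
  have h4 := (abs_le.1 h2).1
  have h5 : ‖F‖ * ‖D‖ ≤ ‖k' - k‖ * Real.sqrt (E + C) * ‖F‖ ^ 2 := by
    rw [sq, ← mul_assoc]
    nlinarith [norm_nonneg F]
  linarith

/-- The spectral subspace at `k`, transported by the phase, is a trial space at `k'` of the same
dimension and almost the same energy. Since `δ` is uniform in both momenta, the estimate applies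
from `0` to `k` and from `k` to `0`. -/
lemma count_le_count_of_norm_le [Fact (u₁ ≠ 0)] (hV : IsSuperHoneycomb u₁ V) (E : ℝ) {ε : ℝ}
    (hε : 0 < ε) : ∃ δ > 0, ∀ (k k' : Plane), ‖k' - k‖ < δ → ∀ (B : EigenBasis hV k)
      (B' : EigenBasis hV k'), B.count E ≤ B'.count (E + ε) := by
  obtain ⟨C₀, hC₀, hC⟩ := exists_form_bound hV
  -- Enlarging the constant by `|E|` ensures `E + C ≥ 0` under the square root.
  set C := C₀ + |E| with hCdef
  replace hC : ∀ (k : Plane) (f : smoothBloch u₁ k),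
      -(⟪blochToL2 k f, blochToL2 k (blochLap k f)⟫_ℂ).re ≤
        (⟪blochToL2 k f, blochToL2 k (hamiltonian hV k f)⟫_ℂ).re + C * ‖blochToL2 k f‖ ^ 2 := by
    intro k f
    refine (hC k f).trans (add_le_add_right (mul_le_mul_of_nonneg_right ?_ (sq_nonneg _)) _)
    rw [hCdef]; linarith [abs_nonneg E]
  have hE : 0 ≤ E + C := by rw [hCdef]; linarith [neg_abs_le E]
  have hcont : Filter.Tendsto (fun t : ℝ => 2 * t * Real.sqrt (E + C) + t ^ 2) (𝓝 0) (𝓝 0) := by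
    have : Continuous fun t : ℝ => 2 * t * Real.sqrt (E + C) + t ^ 2 := by fun_prop
    simpa using this.tendsto 0
  obtain ⟨δ, hδ, hδ'⟩ := Metric.eventually_nhds_iff.1 (hcont.eventually (gt_mem_nhds hε))
  refine ⟨δ, hδ, fun k k' hk B B' => ?_⟩
  have hsmall := hδ' (y := ‖k' - k‖) (by simpa using hk)
  set s := (B.finite_setOf_eig_le E).toFinset with hs
  let e : s ↪ B.ι := Function.Embedding.subtype _
  have heig (j : s) : B.eig (e j) ≤ E :=
    (Set.Finite.mem_toFinset (B.finite_setOf_eig_le E)).1 j.2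
  have horth : Orthonormal ℂ fun j : s => blochToL2 k' (phaseMap k k' (B.fn (e j))) := by
    have := B.orthonormal_fn.comp e e.injective
    classical
    rw [orthonormal_iff_ite] at this ⊢
    intro i j
    rw [inner_phaseMap]
    exact this i j
  have h := card_le_of_form_le B'.basis _
    (fun j : s => blochToL2 k' (hamiltonian hV k' (phaseMap k k' (B.fn (e j)))))
    horth.linearIndependent B'.eig (fun i j => B'.inner_hamiltonian i _) (E + ε)
    (B'.finite_setOf_eig_le (E + ε)).toFinset (fun i hi => by simpa using hi) fun a => ?_
  · rwa [Fintype.card_coe] at h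
  · have e1 : ∑ j, a j • blochToL2 k' (phaseMap k k' (B.fn (e j))) =
        blochToL2 k' (phaseMap k k' (∑ j, a j • B.fn (e j))) := by simp
    have e2 : ∑ j, a j • blochToL2 k' (hamiltonian hV k' (phaseMap k k' (B.fn (e j)))) =
        blochToL2 k' (hamiltonian hV k' (phaseMap k k' (∑ j, a j • B.fn (e j)))) := by simp
    rw [e1, e2]
    refine (re_inner_hamiltonian_phaseMap_le hV hC hE k' _
      (B.re_inner_hamiltonian_le e a heig)).trans ?_
    exact mul_le_mul_of_nonneg_right (by linarith) (sq_nonneg _)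

end

/-! ### Symmetries at zero quasi-momentum and the reduced resolvent. -/

section

variable {u₁ : Plane} {k : Plane} {V : Plane → ℝ}

/-! ### Symmetries of the smooth periodic functions -/

lemma smoothBloch_zero_add_period₁ (f : smoothBloch u₁ 0) (x : Plane) : f.1 (x + u₁) = f.1 x :=
  (isPeriodic_of_mem_zero f).1 x

lemma smoothBloch_zero_add_period₂ (f : smoothBloch u₁ 0) (x : Plane) :
    f.1 (x + period₂ u₁) = f.1 x := (isPeriodic_of_mem_zero f).2 x

lemma smoothBloch_zero_sub_period₁ (f : smoothBloch u₁ 0) (x : Plane) : f.1 (x - u₁) = f.1 x := by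
  rw [← smoothBloch_zero_add_period₁ f (x - u₁), sub_add_cancel]

lemma smoothBloch_zero_sub_period₂ (f : smoothBloch u₁ 0) (x : Plane) :
    f.1 (x - period₂ u₁) = f.1 x := by
  rw [← smoothBloch_zero_add_period₂ f (x - period₂ u₁), sub_add_cancel]

lemma mem_smoothBloch_zero {f : Plane → ℂ} (hf : ContDiff ℝ ∞ f) (h₁ : ∀ x, f (x + u₁) = f x)
    (h₂ : ∀ x, f (x + period₂ u₁) = f x) : f ∈ smoothBloch u₁ 0 :=
  ⟨hf, fun x => by simpa using h₁ x, fun x => by simpa using h₂ x⟩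

/-- The reflection `f ↦ f(-·)`. -/
def parityMap : smoothBloch u₁ 0 →ₗ[ℂ] smoothBloch u₁ 0 where
  toFun f := ⟨fun x => f.1 (-x), mem_smoothBloch_zero ((smoothBloch_contDiff f).comp contDiff_neg)
    (fun x => by rw [neg_add, ← sub_eq_add_neg, smoothBloch_zero_sub_period₁])
    (fun x => by rw [neg_add, ← sub_eq_add_neg, smoothBloch_zero_sub_period₂])⟩
  map_add' _ _ := rfl
  map_smul' _ _ := rfl

/-- The translation `f ↦ f(· + w)`. -/
def translateMap (w : Plane) : smoothBloch u₁ 0 →ₗ[ℂ] smoothBloch u₁ 0 where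
  toFun f := ⟨fun x => f.1 (x + w),
    mem_smoothBloch_zero ((smoothBloch_contDiff f).comp (contDiff_id.add contDiff_const))
    (fun x => by rw [add_right_comm, smoothBloch_zero_add_period₁])
    (fun x => by rw [add_right_comm, smoothBloch_zero_add_period₂])⟩
  map_add' _ _ := rfl
  map_smul' _ _ := rfl

/-- The rotation `f ↦ f(R* ·)`. -/
def rotMap : smoothBloch u₁ 0 →ₗ[ℂ] smoothBloch u₁ 0 where
  toFun f := ⟨fun x => f.1 (rot x),
    mem_smoothBloch_zero ((smoothBloch_contDiff f).comp rotCLM.contDiff)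
    (fun x => by rw [rot_add, rot_period₁ (u₁ := u₁), ← sub_eq_add_neg,
      smoothBloch_zero_sub_period₂])
    (fun x => by rw [rot_add, rot_period₂, ← add_sub_assoc, smoothBloch_zero_sub_period₂,
      smoothBloch_zero_add_period₁])⟩
  map_add' _ _ := rfl
  map_smul' _ _ := rfl

/-- The antilinear symmetry `f ↦ conj f(-·)`. -/
def partnerMap : smoothBloch u₁ 0 →ₛₗ[starRingEnd ℂ] smoothBloch u₁ 0 where
  toFun f := ⟨partner f.1,
    mem_smoothBloch_zero (Complex.conjCLE.contDiff.comp (smoothBloch_contDiff (parityMap f)))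
    (fun x => congrArg (starRingEnd ℂ) (smoothBloch_zero_add_period₁ (parityMap f) x))
    (fun x => congrArg (starRingEnd ℂ) (smoothBloch_zero_add_period₂ (parityMap f) x))⟩
  map_add' f g := by ext x; exact map_add (starRingEnd ℂ) (f.1 (-x)) (g.1 (-x))
  map_smul' c f := by ext x; exact map_mul (starRingEnd ℂ) c (f.1 (-x))

lemma parityMap_apply (f : smoothBloch u₁ 0) (x : Plane) : (parityMap f).1 x = f.1 (-x) := rfl

lemma translateMap_apply (w : Plane) (f : smoothBloch u₁ 0) (x : Plane) :
    (translateMap w f).1 x = f.1 (x + w) := rfl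

lemma partnerMap_apply (f : smoothBloch u₁ 0) (x : Plane) :
    (partnerMap f).1 x = (starRingEnd ℂ) (f.1 (-x)) := rfl

@[simp] lemma parityMap_parityMap (f : smoothBloch u₁ 0) : parityMap (parityMap f) = f := by
  ext x; simp [parityMap_apply]

@[simp] lemma partnerMap_partnerMap (f : smoothBloch u₁ 0) : partnerMap (partnerMap f) = f := by
  ext x; simp [partnerMap_apply]

@[simp] lemma translateMap_neg_translateMap (w : Plane) (f : smoothBloch u₁ 0) :
    translateMap (-w) (translateMap w f) = f := by
  ext x; simp [translateMap_apply]

@[simp] lemma translateMap_translateMap_neg (w : Plane) (f : smoothBloch u₁ 0) :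
    translateMap w (translateMap (-w) f) = f := by
  ext x; simp [translateMap_apply]

section Inner

variable [hu : Fact (u₁ ≠ 0)]

lemma inner_parityMap (f g : smoothBloch u₁ 0) :
    ⟪blochToL2 0 (parityMap f), blochToL2 0 (parityMap g)⟫_ℂ = ⟪blochToL2 0 f, blochToL2 0 g⟫_ℂ := by
  rw [← integral_conjMul, ← integral_conjMul]
  exact (isPeriodic_of_mem_zero (conjMul f g)).setIntegral_neg (smoothBloch_continuous _) hu.out

lemma inner_translateMap (w : Plane) (f g : smoothBloch u₁ 0) :
    ⟪blochToL2 0 (translateMap w f), blochToL2 0 (translateMap w g)⟫_ℂ =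
      ⟪blochToL2 0 f, blochToL2 0 g⟫_ℂ := by
  rw [← integral_conjMul, ← integral_conjMul]
  exact (isPeriodic_of_mem_zero (conjMul f g)).setIntegral_add (smoothBloch_continuous _) hu.out w

lemma inner_rotMap (f g : smoothBloch u₁ 0) :
    ⟪blochToL2 0 (rotMap f), blochToL2 0 (rotMap g)⟫_ℂ = ⟪blochToL2 0 f, blochToL2 0 g⟫_ℂ := by
  rw [← integral_conjMul, ← integral_conjMul]
  exact (isPeriodic_of_mem_zero (conjMul f g)).setIntegral_rot (smoothBloch_continuous _) hu.out

lemma inner_partnerMap (f g : smoothBloch u₁ 0) :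
    ⟪blochToL2 0 (partnerMap f), blochToL2 0 (partnerMap g)⟫_ℂ =
      ⟪blochToL2 0 g, blochToL2 0 f⟫_ℂ := by
  rw [← inner_parityMap g f, ← integral_conjMul, ← integral_conjMul]
  refine integral_congr_ae (Filter.Eventually.of_forall fun x => ?_)
  change (starRingEnd ℂ) ((starRingEnd ℂ) (f.1 (-x))) * (starRingEnd ℂ) (g.1 (-x)) =
    (starRingEnd ℂ) (g.1 (-x)) * f.1 (-x)
  rw [Complex.conj_conj, mul_comm]

end Inner

lemma dirD_parityMap (v : Plane) (f : smoothBloch u₁ 0) :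
    dirD 0 v (parityMap f) = -parityMap (dirD 0 v f) := by
  ext x
  change fderiv ℝ (fun y => f.1 (-y)) x v = -(fderiv ℝ f.1 (-x) v)
  have h1 : HasFDerivAt (fun y : Plane => -y) (-ContinuousLinearMap.id ℝ Plane) x :=
    (hasFDerivAt_id x).neg
  have h := (smoothBloch_differentiable f (-x)).hasFDerivAt.comp x h1
  rw [HasFDerivAt.fderiv (f := fun y => f.1 (-y)) h]
  simp

lemma dirD_translateMap (w v : Plane) (f : smoothBloch u₁ 0) :
    dirD 0 v (translateMap w f) = translateMap w (dirD 0 v f) := by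
  ext x
  change fderiv ℝ (fun y => f.1 (y + w)) x v = fderiv ℝ f.1 (x + w) v
  rw [fderiv_comp_add_right]

lemma dirD_rotMap (v : Plane) (f : smoothBloch u₁ 0) :
    dirD 0 v (rotMap f) = rotMap (dirD 0 (rot v) f) := by
  ext x
  change fderiv ℝ (f.1 ∘ rotCLM) x v = fderiv ℝ f.1 (rot x) (rot v)
  rw [fderiv_comp x (smoothBloch_differentiable f _) rotCLM.differentiableAt, rotCLM.fderiv]
  rfl

lemma dirD_partnerMap (v : Plane) (f : smoothBloch u₁ 0) :
    dirD 0 v (partnerMap f) = -partnerMap (dirD 0 v f) := by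
  have h := dirD_parityMap v f
  ext x
  have hx : (dirD 0 v (parityMap f)).1 x = -(parityMap (dirD 0 v f)).1 x := by rw [h]; rfl
  change fderiv ℝ (fun y => (Complex.conjCLE : ℂ →L[ℝ] ℂ) ((parityMap f).1 y)) x v =
    -(starRingEnd ℂ) ((parityMap (dirD 0 v f)).1 x)
  rw [← map_neg, ← hx, HasFDerivAt.fderiv (f := fun y => (Complex.conjCLE : ℂ →L[ℝ] ℂ)
    ((parityMap f).1 y)) ((Complex.conjCLE : ℂ →L[ℝ] ℂ).hasFDerivAt.comp x
    (smoothBloch_differentiable (parityMap f) x).hasFDerivAt)]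
  rfl

lemma hamiltonian_parityMap (hV : IsSuperHoneycomb u₁ V) (f : smoothBloch u₁ 0) :
    hamiltonian hV 0 (parityMap f) = parityMap (hamiltonian hV 0 f) := by
  have h : potMul hV 0 (parityMap f) = parityMap (potMul hV 0 f) := by
    ext x
    rw [potMul_apply, parityMap_apply, parityMap_apply, potMul_apply, hV.even]
  simp only [hamiltonian_eq, blochLap_eq, dirD_parityMap, map_neg, map_add, h, neg_neg]

lemma hamiltonian_translateMap (hV : IsSuperHoneycomb u₁ V) {w : Plane}
    (hw : ∀ x, V (x + w) = V x) (f : smoothBloch u₁ 0) :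
    hamiltonian hV 0 (translateMap w f) = translateMap w (hamiltonian hV 0 f) := by
  have h : potMul hV 0 (translateMap w f) = translateMap w (potMul hV 0 f) := by
    ext x
    rw [potMul_apply, translateMap_apply, translateMap_apply, potMul_apply, hw]
  simp only [hamiltonian_eq, blochLap_eq, dirD_translateMap, map_neg, map_add, h]

lemma hamiltonian_partnerMap (hV : IsSuperHoneycomb u₁ V) (f : smoothBloch u₁ 0) :
    hamiltonian hV 0 (partnerMap f) = partnerMap (hamiltonian hV 0 f) := by
  have h : potMul hV 0 (partnerMap f) = partnerMap (potMul hV 0 f) := by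
    ext x
    rw [potMul_apply, partnerMap_apply, partnerMap_apply, potMul_apply, hV.even, map_mul,
      Complex.conj_ofReal]
  simp only [hamiltonian_eq, blochLap_eq, dirD_partnerMap, map_neg, map_add, h, neg_neg]

/-! ### The reduced resolvent -/

section Resolvent

variable (hV : IsSuperHoneycomb u₁ V) (E : ℝ)

/-- The eigenspace of the Hamiltonian on the smooth periodic functions. -/
def smoothKer : Submodule ℂ (smoothBloch u₁ 0) :=
  LinearMap.ker (hamiltonian hV 0 - (E : ℂ) • LinearMap.id)

variable {hV E}

lemma mem_smoothKer {f : smoothBloch u₁ 0} :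
    f ∈ smoothKer hV E ↔ hamiltonian hV 0 f = (E : ℂ) • f := by
  rw [smoothKer, LinearMap.mem_ker, LinearMap.sub_apply, LinearMap.smul_apply, LinearMap.id_apply,
    sub_eq_zero]

lemma mem_periodicKer_iff {f : smoothBloch u₁ 0} :
    f.1 ∈ periodicKer u₁ V E ↔ f ∈ smoothKer hV E := by
  rw [mem_smoothKer, ← sub_eq_zero]
  constructor
  · rintro ⟨-, h⟩
    ext x
    rw [hamiltonian_sub_apply]
    exact h x
  · refine fun h => ⟨f.2, fun x => ?_⟩
    rw [← hamiltonian_sub_apply hV, h]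
    rfl

variable [hu : Fact (u₁ ≠ 0)]

/-- The property that `ψ` is orthogonal to the kernel of `H - E` and `(H - E) ψ` is the
component of `g` orthogonal to the kernel. -/
def IsResolved (hV : IsSuperHoneycomb u₁ V) (E : ℝ) (g ψ : smoothBloch u₁ 0) : Prop :=
  (∀ h ∈ smoothKer hV E, ⟪blochToL2 0 h, blochToL2 0 ψ⟫_ℂ = 0) ∧
    g - (hamiltonian hV 0 ψ - (E : ℂ) • ψ) ∈ smoothKer hV E

lemma inner_sub_smul_of_mem_smoothKer {h : smoothBloch u₁ 0} (hh : h ∈ smoothKer hV E)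
    (f : smoothBloch u₁ 0) :
    ⟪blochToL2 0 h, blochToL2 0 (hamiltonian hV 0 f - (E : ℂ) • f)⟫_ℂ = 0 := by
  rw [map_sub, map_smul, inner_sub_right, ← inner_hamiltonian, mem_smoothKer.1 hh, map_smul,
    inner_smul_left, inner_smul_right, Complex.conj_ofReal, sub_self]

lemma eq_zero_of_mem_smoothKer_of_orthogonal {f : smoothBloch u₁ 0} (hf : f ∈ smoothKer hV E)
    (h : ∀ g ∈ smoothKer hV E, ⟪blochToL2 0 g, blochToL2 0 f⟫_ℂ = 0) : f = 0 := by
  have := h f hf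
  rw [inner_self_eq_zero] at this
  exact blochToL2_injective (this.trans (map_zero _).symm)

/-- `(H - E)(ψ - ψ')` lies in the kernel and is orthogonal to it, hence vanishes. Then `ψ - ψ'`
itself lies in the kernel and is orthogonal to it. -/
lemma IsResolved.unique {g ψ ψ' : smoothBloch u₁ 0} (h : IsResolved hV E g ψ)
    (h' : IsResolved hV E g ψ') : ψ = ψ' := by
  have h1 := Submodule.sub_mem _ h'.2 h.2
  have h2 : (g - (hamiltonian hV 0 ψ' - (E : ℂ) • ψ')) - (g - (hamiltonian hV 0 ψ - (E : ℂ) • ψ)) =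
      hamiltonian hV 0 (ψ - ψ') - (E : ℂ) • (ψ - ψ') := by
    rw [map_sub, smul_sub]; abel
  rw [h2] at h1
  have h3 := eq_zero_of_mem_smoothKer_of_orthogonal h1
    fun f hf => inner_sub_smul_of_mem_smoothKer hf _
  refine sub_eq_zero.1 (eq_zero_of_mem_smoothKer_of_orthogonal (mem_smoothKer.2 (sub_eq_zero.1 h3))
    fun f hf => ?_)
  rw [map_sub, inner_sub_right, h.1 f hf, h'.1 f hf, sub_zero]

lemma IsResolved.add {g g' ψ ψ' : smoothBloch u₁ 0} (h : IsResolved hV E g ψ)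
    (h' : IsResolved hV E g' ψ') : IsResolved hV E (g + g') (ψ + ψ') := by
  refine ⟨fun f hf => by rw [map_add, inner_add_right, h.1 f hf, h'.1 f hf, add_zero], ?_⟩
  convert Submodule.add_mem _ h.2 h'.2 using 1
  rw [map_add, smul_add]; abel

lemma IsResolved.smul {g ψ : smoothBloch u₁ 0} (h : IsResolved hV E g ψ) (c : ℂ) :
    IsResolved hV E (c • g) (c • ψ) := by
  refine ⟨fun f hf => by rw [map_smul, inner_smul_right, h.1 f hf, mul_zero], ?_⟩
  convert Submodule.smul_mem _ c h.2 using 1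
  rw [map_smul, smul_sub, smul_sub, smul_comm (E : ℂ) c]

variable (hV E) in
-- The solution is first built in `L²` by dividing the eigenbasis coefficients by `eig - E`. It
-- solves the equation weakly with the smooth right side `g - p`, where `p` is the projection of `g`
-- onto the kernel, so elliptic regularity applies.
theorem exists_isResolved (g : smoothBloch u₁ 0) : ∃ ψ, IsResolved hV E g ψ := by
  classical
  let B := eigenBasis hV 0
  set s := (B.finite_setOf_eig_le (E + 1)).toFinset with hs
  have hmem (i : B.ι) : i ∈ s ↔ B.eig i ≤ E + 1 := Set.Finite.mem_toFinset _
  have hfin : {i | B.eig i = E}.Finite :=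
    (B.finite_setOf_eig_le E).subset fun i hi => (show B.eig i = E from hi).le
  set t := hfin.toFinset
  have htmem (i : B.ι) : i ∈ t ↔ B.eig i = E := Set.Finite.mem_toFinset _
  obtain ⟨C, hC⟩ : ∃ C : ℝ, ∀ i, |(B.eig i - E)⁻¹| ≤ C := by
    -- Only finitely many eigenvalues are at most `E + 1`, and these are covered by the sum; beyond
    -- them the inverse is at most `1`.
    refine ⟨1 + ∑ i ∈ s, |(B.eig i - E)⁻¹|, fun i => ?_⟩
    have h0 : 0 ≤ ∑ i ∈ s, |(B.eig i - E)⁻¹| := Finset.sum_nonneg fun _ _ => abs_nonneg _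
    by_cases hi : i ∈ s
    · have := Finset.single_le_sum (f := fun i => |(B.eig i - E)⁻¹|) (fun _ _ => abs_nonneg _) hi
      linarith
    · have h1 : 1 ≤ B.eig i - E := by rw [hmem, not_le] at hi; linarith
      rw [abs_of_pos (inv_pos.2 (by linarith))]
      linarith [inv_le_one_of_one_le₀ h1]
  obtain ⟨T, hT, -⟩ := exists_diagonal B.basis ((abs_nonneg _).trans (hC (B.infinite_index.nonempty.some))) hC
  -- For `eig i = E` the inverse is `0⁻¹ = 0`, so `T` annihilates the kernel and already includes
  -- the projection `Q_⊥`.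
  have hTi (i : B.ι) (f : CellL2 u₁) : ⟪B.basis i, T f⟫_ℂ =
      ((B.eig i - E)⁻¹ : ℝ) * ⟪B.basis i, f⟫_ℂ := hT i f
  set p : smoothBloch u₁ 0 := ∑ i ∈ t, ⟪B.basis i, blochToL2 0 g⟫_ℂ • B.fn i with hp
  have hpi (i : B.ι) : ⟪B.basis i, blochToL2 0 p⟫_ℂ =
      if i ∈ t then ⟪B.basis i, blochToL2 0 g⟫_ℂ else 0 := by
    simp only [hp, map_sum, map_smul, inner_sum, inner_smul_right, ← B.basis_eq,
      orthonormal_iff_ite.1 B.basis.orthonormal]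
    simp
  have hweak (f : smoothBloch u₁ 0) : ⟪blochToL2 0 (hamiltonian hV 0 f - (E : ℂ) • f),
      T (blochToL2 0 g)⟫_ℂ = ⟪blochToL2 0 f, blochToL2 0 (g - p)⟫_ℂ := by
    rw [← B.basis.tsum_inner_mul_inner, ← B.basis.tsum_inner_mul_inner]
    refine tsum_congr fun i => ?_
    rw [hTi, map_sub, map_sub, inner_sub_right, hpi, map_smul, inner_sub_left, inner_smul_left,
      Complex.conj_ofReal, ← inner_conj_symm, B.inner_hamiltonian, map_mul, Complex.conj_ofReal,
      inner_conj_symm]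
    by_cases hi : i ∈ t
    · rw [if_pos hi, (htmem i).1 hi]; ring
    · rw [if_neg hi]
      rw [htmem] at hi
      have : ((B.eig i : ℂ) - E) ≠ 0 := by
        rw [← Complex.ofReal_sub]
        exact Complex.ofReal_ne_zero.2 (sub_ne_zero.2 hi)
      push_cast
      field_simp
      ring
  obtain ⟨ψ, hψ, hψ'⟩ := exists_smooth_of_weak hV (E := E) (f := T (blochToL2 0 g)) (g := g - p)
    fun m => hweak (wave 0 m)
  refine ⟨ψ, fun h hh => ?_, ?_⟩
  · rw [hψ, ← B.basis.tsum_inner_mul_inner]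
    refine (tsum_congr fun i => ?_).trans tsum_zero
    rw [hTi]
    have h1 := B.inner_hamiltonian i h
    rw [mem_smoothKer.1 hh, map_smul, inner_smul_right] at h1
    by_cases hi : B.eig i = E
    · simp [hi]
    · have : ⟪B.basis i, blochToL2 0 h⟫_ℂ = 0 := by
        have h2 : ((B.eig i : ℂ) - E) * ⟪B.basis i, blochToL2 0 h⟫_ℂ = 0 := by
          rw [sub_mul, h1, sub_self]
        refine (mul_eq_zero.1 h2).resolve_left ?_
        rw [← Complex.ofReal_sub]
        exact Complex.ofReal_ne_zero.2 (sub_ne_zero.2 hi)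
      rw [← inner_conj_symm, this]
      simp
  · rw [hψ', sub_sub_cancel, hp]
    refine Submodule.sum_mem _ fun i hi => Submodule.smul_mem _ _ (mem_smoothKer.2 ?_)
    rw [B.eig_fn, (htmem i).1 hi]

variable (hV E) in
/-- The reduced resolvent `(H - E)⁻¹ Q_⊥` on the smooth periodic functions. -/
def resolvent : smoothBloch u₁ 0 →ₗ[ℂ] smoothBloch u₁ 0 where
  toFun g := (exists_isResolved hV E g).choose
  map_add' g g' := (exists_isResolved hV E (g + g')).choose_spec.unique
    ((exists_isResolved hV E g).choose_spec.add (exists_isResolved hV E g').choose_spec)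
  map_smul' c g := (exists_isResolved hV E (c • g)).choose_spec.unique
    ((exists_isResolved hV E g).choose_spec.smul c)

lemma isResolved_resolvent (g : smoothBloch u₁ 0) : IsResolved hV E g (resolvent hV E g) :=
  (exists_isResolved hV E g).choose_spec

/-- With `F`, `G` the two resolved functions, both sides equal `⟨F, (H - E) G⟩`: the kernel
components of `f` and `g` are orthogonal to `G` and `F`. -/
lemma inner_resolvent (f g : smoothBloch u₁ 0) :
    ⟪blochToL2 0 (resolvent hV E f), blochToL2 0 g⟫_ℂ =
      ⟪blochToL2 0 f, blochToL2 0 (resolvent hV E g)⟫_ℂ := by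
  obtain ⟨hf1, hf2⟩ := isResolved_resolvent (hV := hV) (E := E) f
  obtain ⟨hg1, hg2⟩ := isResolved_resolvent (hV := hV) (E := E) g
  set F := resolvent hV E f
  set G := resolvent hV E g
  have h1 : ⟪blochToL2 0 F, blochToL2 0 (g - (hamiltonian hV 0 G - (E : ℂ) • G))⟫_ℂ = 0 := by
    rw [← inner_conj_symm, hf1 _ hg2, map_zero]
  have h2 := hg1 _ hf2
  simp only [map_sub, map_smul, inner_sub_left, inner_sub_right, inner_smul_left, inner_smul_right,
    Complex.conj_ofReal, inner_hamiltonian] at h1 h2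
  linear_combination h1 - h2

/-- A symmetry that preserves inner products, commutes with the Hamiltonian and hence maps the
kernel to itself carries a solution to a solution. Uniqueness then gives commutation; the same
applies to the partner map and to translations. -/
lemma resolvent_parityMap (g : smoothBloch u₁ 0) :
    resolvent hV E (parityMap g) = parityMap (resolvent hV E g) := by
  have hker (h : smoothBloch u₁ 0) (hh : h ∈ smoothKer hV E) : parityMap h ∈ smoothKer hV E := by
    rw [mem_smoothKer, hamiltonian_parityMap, mem_smoothKer.1 hh, map_smul]
  obtain ⟨h1, h2⟩ := isResolved_resolvent (hV := hV) (E := E) g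
  refine (isResolved_resolvent _).unique ⟨fun h hh => ?_, ?_⟩
  · rw [← parityMap_parityMap h, inner_parityMap, h1 _ (hker h hh)]
  · rw [hamiltonian_parityMap, ← map_smul, ← map_sub, ← map_sub]
    exact hker _ h2

lemma resolvent_partnerMap (g : smoothBloch u₁ 0) :
    resolvent hV E (partnerMap g) = partnerMap (resolvent hV E g) := by
  have hs (f : smoothBloch u₁ 0) : (E : ℂ) • partnerMap f = partnerMap ((E : ℂ) • f) := by
    rw [LinearMap.map_smulₛₗ, Complex.conj_ofReal]
  have hker (h : smoothBloch u₁ 0) (hh : h ∈ smoothKer hV E) : partnerMap h ∈ smoothKer hV E := by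
    rw [mem_smoothKer, hamiltonian_partnerMap, mem_smoothKer.1 hh, hs]
  obtain ⟨h1, h2⟩ := isResolved_resolvent (hV := hV) (E := E) g
  refine (isResolved_resolvent _).unique ⟨fun h hh => ?_, ?_⟩
  · rw [← partnerMap_partnerMap h, inner_partnerMap, ← inner_conj_symm, h1 _ (hker h hh), map_zero]
  · rw [hamiltonian_partnerMap, hs, ← map_sub, ← map_sub]
    exact hker _ h2

lemma resolvent_translateMap {w : Plane} (hw : ∀ x, V (x + w) = V x) (g : smoothBloch u₁ 0) :
    resolvent hV E (translateMap w g) = translateMap w (resolvent hV E g) := by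
  have hw' (x : Plane) : V (x + -w) = V x := by rw [← hw (x + -w), neg_add_cancel_right]
  have hker {w : Plane} (hw : ∀ x, V (x + w) = V x) (h : smoothBloch u₁ 0)
      (hh : h ∈ smoothKer hV E) : translateMap w h ∈ smoothKer hV E := by
    rw [mem_smoothKer, hamiltonian_translateMap hV hw, mem_smoothKer.1 hh, map_smul]
  obtain ⟨h1, h2⟩ := isResolved_resolvent (hV := hV) (E := E) g
  refine (isResolved_resolvent _).unique ⟨fun h hh => ?_, ?_⟩
  · rw [← translateMap_translateMap_neg w h, inner_translateMap, h1 _ (hker hw' h hh)]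
  · rw [hamiltonian_translateMap hV hw, ← map_smul, ← map_sub, ← map_sub]
    exact hker hw _ h2

lemma perpKer_iff {f : smoothBloch u₁ 0} : PerpKer u₁ V E f.1 ↔
    ∀ h ∈ smoothKer hV E, ⟪blochToL2 0 h, blochToL2 0 f⟫_ℂ = 0 := by
  constructor
  · intro h g hg
    rw [inner_blochToL2]
    exact h _ (mem_periodicKer_iff.2 hg)
  · intro h g hg
    have := h ⟨g, hg.1⟩ (mem_periodicKer_iff.1 hg)
    rwa [inner_blochToL2] at this

lemma isReducedResolvent_iff {g ψ : smoothBloch u₁ 0} :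
    IsReducedResolvent u₁ V E g.1 ψ.1 ↔ IsResolved hV E g ψ := by
  rw [IsReducedResolvent, IsPerpPart, ← hamiltonian_sub_apply hV, perpKer_iff (hV := hV),
    perpKer_iff (hV := hV), IsResolved, ← mem_periodicKer_iff (hV := hV) (E := E)]
  refine ⟨fun h => ⟨h.2.1, h.2.2.1⟩, fun h => ⟨ψ.2, h.1, h.2, fun f hf => ?_⟩⟩
  exact inner_sub_smul_of_mem_smoothKer hf _

variable (hV) in
-- Existence excludes the default value `0`, and uniqueness makes the choice in the definition
-- immaterial.
lemma reducedResolvent_eq (g : smoothBloch u₁ 0) :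
    reducedResolvent u₁ V E g.1 = (resolvent hV E g).1 := by
  have h : ∃ ψ, IsReducedResolvent u₁ V E g.1 ψ :=
    ⟨_, (isReducedResolvent_iff (hV := hV)).2 (isResolved_resolvent g)⟩
  rw [reducedResolvent, dif_pos h]
  have h1 := h.choose_spec
  exact congrArg Subtype.val (((isReducedResolvent_iff (ψ := ⟨_, h1.1⟩)).1 h1).unique
    (isResolved_resolvent g))

end Resolvent

end

/-! ### The kernel at the Dirac point and its matrix elements. -/

section

variable {u₁ : Plane} {k : Plane} {V : Plane → ℝ} {ED : ℝ} {φ : Plane → ℂ}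

/-! ### The cube root of unity -/

lemma tau_eq : tau = -(1 / 2) + (Real.sqrt 3 / 2 : ℝ) * Complex.I := by
  have h : (2 * Real.pi * Complex.I / 3 : ℂ) = ((Real.pi - Real.pi / 3 : ℝ) : ℂ) * Complex.I := by
    push_cast; ring
  rw [tau, h, Complex.exp_mul_I, ← Complex.ofReal_cos, ← Complex.ofReal_sin, Real.cos_pi_sub,
    Real.sin_pi_sub, Real.cos_pi_div_three, Real.sin_pi_div_three]
  push_cast; ring

lemma conj_tau : (starRingEnd ℂ) tau = -(1 / 2) - (Real.sqrt 3 / 2 : ℝ) * Complex.I := by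
  rw [tau_eq, map_add, map_mul, Complex.conj_I, Complex.conj_ofReal, map_neg, map_div₀, map_one,
    Complex.conj_ofNat]
  ring

lemma sqrt_three_sq_complex : ((Real.sqrt 3 : ℝ) : ℂ) ^ 2 = 3 := by
  rw [← Complex.ofReal_pow, Real.sq_sqrt (by norm_num)]; norm_num

lemma conj_tau_mul_tau : (starRingEnd ℂ) tau * tau = 1 := by
  rw [conj_tau, tau_eq]
  push_cast
  linear_combination (-(1 / 4) * Complex.I ^ 2) * sqrt_three_sq_complex - (3 / 4) * Complex.I_sq

lemma conj_tau_sq : (starRingEnd ℂ) tau * (starRingEnd ℂ) tau = tau := by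
  rw [conj_tau, tau_eq]
  push_cast
  linear_combination (1 / 4 * Complex.I ^ 2) * sqrt_three_sq_complex + (3 / 4) * Complex.I_sq

lemma tau_sq : tau * tau = (starRingEnd ℂ) tau := by
  have h := congrArg (starRingEnd ℂ) conj_tau_sq
  rwa [map_mul, Complex.conj_conj] at h

lemma tau_ne_one : tau ≠ 1 := by
  intro h
  have := congrArg Complex.re h
  rw [tau_eq] at this
  norm_num at this

lemma conj_tau_ne_one : (starRingEnd ℂ) tau ≠ 1 := by
  intro h
  have := congrArg (starRingEnd ℂ) h
  rw [Complex.conj_conj, map_one] at this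
  exact tau_ne_one this

/-! ### The operator `2ik·∇` -/

/-- The operator `2ik·∇` on smooth periodic functions. -/
def gradOp (k : Plane) : smoothBloch u₁ 0 →ₗ[ℂ] smoothBloch u₁ 0 :=
  (2 * Complex.I) • dirD 0 k

lemma gradOp_apply (k : Plane) (f : smoothBloch u₁ 0) :
    gradOp k f = (2 * Complex.I) • dirD 0 k f := rfl

lemma gradOp_coe (k : Plane) (f : smoothBloch u₁ 0) : (gradOp k f).1 = twoIkGrad k f.1 := rfl

lemma gradOp_eq (k : Plane) (f : smoothBloch u₁ 0) :
    gradOp k f = (k 0 : ℂ) • gradOp (stdVec 0) f + (k 1 : ℂ) • gradOp (stdVec 1) f := by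
  rw [gradOp_apply, dirD_eq, smul_add, smul_comm, smul_comm _ (k 1 : ℂ)]
  rfl

lemma gradOp_parityMap (k : Plane) (f : smoothBloch u₁ 0) :
    gradOp k (parityMap f) = -parityMap (gradOp k f) := by
  rw [gradOp_apply, dirD_parityMap, gradOp_apply, map_smul, smul_neg]

lemma gradOp_translateMap (w k : Plane) (f : smoothBloch u₁ 0) :
    gradOp k (translateMap w f) = translateMap w (gradOp k f) := by
  rw [gradOp_apply, dirD_translateMap, gradOp_apply, map_smul]

lemma gradOp_rotMap (k : Plane) (f : smoothBloch u₁ 0) :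
    gradOp k (rotMap f) = rotMap (gradOp (rot k) f) := by
  rw [gradOp_apply, dirD_rotMap, gradOp_apply, map_smul]

lemma gradOp_partnerMap (k : Plane) (f : smoothBloch u₁ 0) :
    gradOp k (partnerMap f) = partnerMap (gradOp k f) := by
  rw [gradOp_apply, dirD_partnerMap, gradOp_apply, LinearMap.map_smulₛₗ, map_mul, Complex.conj_I,
    Complex.conj_ofNat, smul_neg, ← neg_smul, mul_neg]

lemma gradOp_add (k k' : Plane) (f : smoothBloch u₁ 0) :
    gradOp (k + k') f = gradOp k f + gradOp k' f := by
  rw [gradOp_apply, dirD_add, smul_add]; rfl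

section

variable [hu : Fact (u₁ ≠ 0)]

lemma inner_gradOp (k : Plane) (f g : smoothBloch u₁ 0) :
    ⟪blochToL2 0 (gradOp k f), blochToL2 0 g⟫_ℂ = ⟪blochToL2 0 f, blochToL2 0 (gradOp k g)⟫_ℂ := by
  rw [gradOp_apply, gradOp_apply, map_smul, map_smul, inner_smul_left, inner_smul_right, inner_dirD,
    map_mul, Complex.conj_I, Complex.conj_ofNat]
  ring

/-- Eigenvectors of an isometry to different eigenvalues are orthogonal; for unimodular `a` the
condition says `a ≠ b`. -/
lemma inner_eq_zero_of_inner_eq_mul {U : smoothBloch u₁ 0 → smoothBloch u₁ 0}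
    (hU : ∀ f g, ⟪blochToL2 0 (U f), blochToL2 0 (U g)⟫_ℂ = ⟪blochToL2 0 f, blochToL2 0 g⟫_ℂ)
    {f g : smoothBloch u₁ 0} {a b : ℂ} (hf : U f = a • f) (hg : U g = b • g)
    (hab : (starRingEnd ℂ) a * b ≠ 1) : ⟪blochToL2 0 f, blochToL2 0 g⟫_ℂ = 0 := by
  have h := hU f g
  rw [hf, hg, map_smul, map_smul, inner_smul_left, inner_smul_right, ← mul_assoc] at h
  have h2 : ((starRingEnd ℂ) a * b - 1) * ⟪blochToL2 0 f, blochToL2 0 g⟫_ℂ = 0 := by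
    rw [sub_mul, h, one_mul, sub_self]
  exact (mul_eq_zero.1 h2).resolve_left (sub_ne_zero.2 hab)

lemma inner_gradOp_rot {f g : smoothBloch u₁ 0} {a b : ℂ} (hf : rotMap f = a • f)
    (hg : rotMap g = b • g) (k : Plane) :
    ⟪blochToL2 0 f, blochToL2 0 (gradOp (rot k) g)⟫_ℂ =
      (starRingEnd ℂ) a * b * ⟪blochToL2 0 f, blochToL2 0 (gradOp k g)⟫_ℂ := by
  rw [← inner_rotMap, ← gradOp_rotMap, hf, hg, map_smul, map_smul, map_smul, inner_smul_left,
    inner_smul_right, mul_assoc]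

/-- Equal rotation characters make the values at `k`, `R k` and `R² k` coincide. These vectors add
up to zero and the expression is linear in `k`, so three times the value vanishes. -/
lemma inner_gradOp_eq_zero {f g : smoothBloch u₁ 0} {a b : ℂ} (hf : rotMap f = a • f)
    (hg : rotMap g = b • g) (hab : (starRingEnd ℂ) a * b = 1) (k : Plane) :
    ⟪blochToL2 0 f, blochToL2 0 (gradOp k g)⟫_ℂ = 0 := by
  have h0 : ⟪blochToL2 0 f, blochToL2 0 (gradOp (k + rot k + rot (rot k)) g)⟫_ℂ = 0 := by
    have : gradOp (0 : Plane) g = 0 := by rw [gradOp_eq]; simp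
    rw [add_rot_add_rot_rot, this, map_zero, inner_zero_right]
  rw [gradOp_add, gradOp_add, map_add, map_add, inner_add_right, inner_add_right,
    inner_gradOp_rot hf hg (rot k), inner_gradOp_rot hf hg k, hab] at h0
  linear_combination h0 / 3

end

/-! ### The kernel at the Dirac point -/

namespace IsDiracState

section

variable (hφ : IsDiracState u₁ V ED φ)

/-- The state `φ₁` (for `true`) and its partner `φ₂` (for `false`). -/
def pair (j : Bool) : smoothBloch u₁ 0 :=
  if j then ⟨φ, hφ.mem⟩ else partnerMap ⟨φ, hφ.mem⟩

lemma pair_false : hφ.pair false = partnerMap (hφ.pair true) := rfl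

lemma rotMap_pair (j : Bool) :
    rotMap (hφ.pair j) = (if j then tau else (starRingEnd ℂ) tau) • hφ.pair j := by
  have h (x : Plane) : φ (rot x) = tau * φ x := hφ.rotation x
  have hneg (x : Plane) : rot (-x) = -rot x := by rw [← rotCLM_apply, map_neg, rotCLM_apply]
  cases j
  · ext x
    change (starRingEnd ℂ) (φ (-(rot x))) = (starRingEnd ℂ) tau * (starRingEnd ℂ) (φ (-x))
    rw [← hneg, h, map_mul]
  · ext x
    exact h x

/-- Conjugation and reflection each invert the translation character, so `φ₂` stays in the sector of
`φ₁`. Reflection commutes with rotation, so there only the conjugation acts and `φ₂` acquires the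
conjugate character. -/
lemma translateMap_pair (j : Bool) :
    translateMap (fold₁ u₁) (hφ.pair j) = tau • hφ.pair j := by
  cases j
  · ext x
    change (starRingEnd ℂ) (φ (-(x + fold₁ u₁))) = tau * (starRingEnd ℂ) (φ (-x))
    have h := hφ.folding (-(x + fold₁ u₁))
    rw [neg_add_rev, add_comm (-fold₁ u₁), neg_add_cancel_right] at h
    rw [neg_add_rev, add_comm (-fold₁ u₁), h, map_mul, ← mul_assoc, mul_comm tau, conj_tau_mul_tau,
      one_mul]
  · ext x
    exact hφ.folding x

lemma translateMap_parityMap_pair (j : Bool) : translateMap (fold₁ u₁) (parityMap (hφ.pair j)) =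
    (starRingEnd ℂ) tau • parityMap (hφ.pair j) := by
  have h : translateMap (-fold₁ u₁) (hφ.pair j) = (starRingEnd ℂ) tau • hφ.pair j := by
    have h1 := congrArg (translateMap (-fold₁ u₁)) (hφ.translateMap_pair j)
    rw [translateMap_neg_translateMap, map_smul] at h1
    conv_rhs => rw [h1, smul_smul, conj_tau_mul_tau, one_smul]
  rw [← map_smul, ← h]
  ext x
  change (hφ.pair j).1 (-(x + fold₁ u₁)) = (hφ.pair j).1 (-x + -fold₁ u₁)
  rw [neg_add]

lemma pair_mem (hV : IsSuperHoneycomb u₁ V) (j : Bool) : hφ.pair j ∈ smoothKer hV ED := by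
  have h : hφ.pair true ∈ smoothKer hV ED := mem_periodicKer_iff.1 ⟨hφ.mem, hφ.eigen⟩
  cases j
  · rw [pair_false, mem_smoothKer, hamiltonian_partnerMap, mem_smoothKer.1 h,
      LinearMap.map_smulₛₗ, Complex.conj_ofReal]
  · exact h

/-- The identity for `true`, the reflection for `false`. -/
def _root_.SuperHoneycomb.reflect (ε : Bool) : smoothBloch u₁ 0 →ₗ[ℂ] smoothBloch u₁ 0 :=
  if ε then LinearMap.id else parityMap

/-- The sign `1` for `true` and `-1` for `false`. -/
def _root_.SuperHoneycomb.sgn (ε : Bool) : ℝ := if ε then 1 else -1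

lemma _root_.SuperHoneycomb.gradOp_reflect (ε : Bool) (k : Plane) (f : smoothBloch u₁ 0) :
    gradOp k (reflect ε f) = (sgn ε : ℂ) • reflect ε (gradOp k f) := by
  cases ε
  · change gradOp k (parityMap f) = ((-1 : ℝ) : ℂ) • parityMap _
    rw [gradOp_parityMap, Complex.ofReal_neg, Complex.ofReal_one]
    exact (neg_one_smul ℂ (parityMap (gradOp k f))).symm
  · change gradOp k f = ((1 : ℝ) : ℂ) • gradOp k f
    simp

lemma _root_.SuperHoneycomb.sgn_mul_self (ε : Bool) : sgn ε * sgn ε = 1 := by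
  cases ε <;> norm_num [sgn]

/-- The basis `φ₁, φ₂, φ₃, φ₄` of the kernel: `(true, true)` stands for `φ₁`, `(true, false)` for
`φ₂`, `(false, true)` for `φ₃` and `(false, false)` for `φ₄`. -/
def state (s : Bool × Bool) : smoothBloch u₁ 0 := reflect s.1 (hφ.pair s.2)

lemma state_mem (hV : IsSuperHoneycomb u₁ V) (s : Bool × Bool) : hφ.state s ∈ smoothKer hV ED := by
  obtain ⟨ε, j⟩ := s
  cases ε
  · change parityMap _ ∈ _
    rw [mem_smoothKer, hamiltonian_parityMap, mem_smoothKer.1 (hφ.pair_mem hV j), map_smul]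
  · exact hφ.pair_mem hV j

lemma translateMap_state (s : Bool × Bool) : translateMap (fold₁ u₁) (hφ.state s) =
    (if s.1 then tau else (starRingEnd ℂ) tau) • hφ.state s := by
  obtain ⟨ε, j⟩ := s
  cases ε
  · exact hφ.translateMap_parityMap_pair j
  · exact hφ.translateMap_pair j

end

section

variable [hu : Fact (u₁ ≠ 0)] (hφ : IsDiracState u₁ V ED φ)

lemma _root_.SuperHoneycomb.inner_reflect (ε : Bool) (f g : smoothBloch u₁ 0) :
    ⟪blochToL2 0 (reflect ε f), blochToL2 0 (reflect ε g)⟫_ℂ = ⟪blochToL2 0 f, blochToL2 0 g⟫_ℂ := by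
  cases ε
  · exact inner_parityMap f g
  · rfl

lemma _root_.SuperHoneycomb.resolvent_reflect (hV : IsSuperHoneycomb u₁ V) (E : ℝ) (ε : Bool)
    (f : smoothBloch u₁ 0) : resolvent hV E (reflect ε f) = reflect ε (resolvent hV E f) := by
  cases ε
  · exact resolvent_parityMap f
  · rfl

/-- An element of the kernel sector `ε` is orthogonal to the translation class of the other. -/
lemma inner_state_eq_zero {s : Bool × Bool} {ε : Bool} (hs : s.1 ≠ ε) {g : smoothBloch u₁ 0}
    (hg : translateMap (fold₁ u₁) g = (if ε then tau else (starRingEnd ℂ) tau) • g) :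
    ⟪blochToL2 0 (hφ.state s), blochToL2 0 g⟫_ℂ = 0 := by
  refine inner_eq_zero_of_inner_eq_mul (inner_translateMap _) (hφ.translateMap_state s) hg ?_
  obtain ⟨ε', j⟩ := s
  cases ε <;> cases ε' <;> first | exact absurd rfl hs | skip
  · simpa [conj_tau_sq] using tau_ne_one
  · simpa [tau_sq] using conj_tau_ne_one

lemma inner_pair (i j : Bool) : ⟪blochToL2 0 (hφ.pair i), blochToL2 0 (hφ.pair j)⟫_ℂ =
    if i = j then 1 else 0 := by
  have h1 : ⟪blochToL2 0 (hφ.pair true), blochToL2 0 (hφ.pair true)⟫_ℂ = 1 := by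
    rw [inner_blochToL2]; exact hφ.normalized
  cases i <;> cases j
  · rw [pair_false, inner_partnerMap, h1]; rfl
  · refine inner_eq_zero_of_inner_eq_mul inner_rotMap (hφ.rotMap_pair _) (hφ.rotMap_pair _) ?_
    simpa [tau_sq] using conj_tau_ne_one
  · refine inner_eq_zero_of_inner_eq_mul inner_rotMap (hφ.rotMap_pair _) (hφ.rotMap_pair _) ?_
    simpa [conj_tau_sq] using tau_ne_one
  · exact h1

lemma inner_state (s t : Bool × Bool) :
    ⟪blochToL2 0 (hφ.state s), blochToL2 0 (hφ.state t)⟫_ℂ = if s = t then 1 else 0 := by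
  by_cases h : s.1 = t.1
  · obtain ⟨ε, i⟩ := s
    obtain ⟨ε', j⟩ := t
    obtain rfl : ε = ε' := h
    rw [state, state, inner_reflect, inner_pair]
    simp
  · rw [hφ.inner_state_eq_zero h (hφ.translateMap_state t), if_neg fun e => h (by rw [e])]

lemma orthonormal_state : Orthonormal ℂ fun s => blochToL2 0 (hφ.state s) :=
  orthonormal_iff_ite.2 hφ.inner_state

/-- Gap around the eigenvalue `E_D` at `k = 0`. -/
lemma _root_.SuperHoneycomb.FourfoldDegeneracy.exists_gap {n : ℕ} (hV : IsSuperHoneycomb u₁ V)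
    (hdeg : FourfoldDegeneracy u₁ V n ED) (B : EigenBasis hV 0) :
    ∃ d > 0, n ≤ B.count (ED - d) ∧ B.count (ED + d) ≤ n + 4 := by
  obtain ⟨E₁, h1, h1'⟩ := B.exists_le_count_of_band_lt hdeg.below
  obtain ⟨E₂, h2, h2'⟩ := exists_between hdeg.above
  refine ⟨min (ED - E₁) (E₂ - ED), lt_min (by linarith) (by linarith), ?_, ?_⟩
  · refine h1'.trans (B.count_mono ?_)
    linarith [min_le_left (ED - E₁) (E₂ - ED)]
  · have h3 := B.count_lt_of_lt_band (by omega) h2'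
    have h4 : B.count (ED + min (ED - E₁) (E₂ - ED)) ≤ B.count E₂ :=
      B.count_mono (by linarith [min_le_right (ED - E₁) (E₂ - ED)])
    omega

/-- Converts eigenvalues found in a window into a difference of counting functions. -/
lemma _root_.SuperHoneycomb.EigenBasis.card_le_count_sub {hV : IsSuperHoneycomb u₁ V}
    (B : EigenBasis hV k) {E₁ E₂ : ℝ} (hE : E₁ ≤ E₂) (s : Finset B.ι)
    (hs : ∀ i ∈ s, E₁ < B.eig i ∧ B.eig i ≤ E₂) : s.card + B.count E₁ ≤ B.count E₂ := by
  classical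
  rw [EigenBasis.count, EigenBasis.count, ← Finset.card_union_of_disjoint]
  · refine Finset.card_le_card fun i hi => ?_
    rw [Finset.mem_union, Set.Finite.mem_toFinset] at hi
    rw [Set.Finite.mem_toFinset]
    exact hi.elim (fun h => (hs i h).2) fun h => (show B.eig i ≤ E₁ from h).trans hE
  · rw [Finset.disjoint_left]
    intro i hi hi'
    rw [Set.Finite.mem_toFinset] at hi'
    exact (hs i hi).1.not_ge hi'

/-- The four states span the kernel. -/
lemma eq_sum_of_mem_smoothKer {n : ℕ} (hV : IsSuperHoneycomb u₁ V)
    (hdeg : FourfoldDegeneracy u₁ V n ED) {h : smoothBloch u₁ 0} (hh : h ∈ smoothKer hV ED) :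
    h = ∑ s, ⟪blochToL2 0 (hφ.state s), blochToL2 0 h⟫_ℂ • hφ.state s := by
  classical
  let B := eigenBasis hV 0
  obtain ⟨d, hd, hd1, hd2⟩ := hdeg.exists_gap hV B
  have hfin : {i | B.eig i = ED}.Finite :=
    (B.finite_setOf_eig_le ED).subset fun i hi => (show B.eig i = ED from hi).le
  have hmem (i : B.ι) : i ∈ hfin.toFinset ↔ B.eig i = ED := Set.Finite.mem_toFinset _
  -- At least `n` eigenvalues lie at or below `ED - d` and at most `n + 4` at or below `ED + d`.
  have hcard : hfin.toFinset.card ≤ 4 := by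
    have := B.card_le_count_sub (E₁ := ED - d) (E₂ := ED + d) (by linarith) hfin.toFinset fun i hi => by
      rw [(hmem i).1 hi]; constructor <;> linarith
    omega
  have : FiniteDimensional ℂ (Submodule.span ℂ (range fun i : hfin.toFinset => B.basis i)) :=
    FiniteDimensional.span_of_finite ℂ (finite_range _)
  set W := Submodule.span ℂ (range fun s => blochToL2 0 (hφ.state s))
  set W' := Submodule.span ℂ (range fun i : hfin.toFinset => B.basis i)
  have hker {f : smoothBloch u₁ 0} (hf : f ∈ smoothKer hV ED) : blochToL2 0 f ∈ W' := by
    refine B.mem_span_of_inner_eq_zero _ fun i hi => ?_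
    have h1 := B.inner_hamiltonian i f
    rw [mem_smoothKer.1 hf, map_smul, inner_smul_right] at h1
    have h2 : ((ED : ℂ) - B.eig i) * ⟪B.basis i, blochToL2 0 f⟫_ℂ = 0 := by
      rw [sub_mul, h1, sub_self]
    refine (mul_eq_zero.1 h2).resolve_left ?_
    rw [← Complex.ofReal_sub]
    exact Complex.ofReal_ne_zero.2 (sub_ne_zero.2 fun e => hi ((hmem i).2 e.symm))
  -- Four orthonormal states inside a space of dimension at most four fill it.
  have hWW' : W = W' := by
    refine Submodule.eq_of_le_of_finrank_le (Submodule.span_le.2 ?_) ?_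
    · rintro _ ⟨s, rfl⟩
      exact hker (hφ.state_mem hV s)
    · rw [finrank_span_eq_card (b := fun s => blochToL2 0 (hφ.state s)) hφ.orthonormal_state.linearIndependent]
      refine (finrank_range_le_card _).trans ?_
      rw [Fintype.card_coe]
      exact hcard
  have hW := hker hh
  rw [← hWW', Submodule.mem_span_range_iff_exists_fun] at hW
  obtain ⟨c, hc⟩ := hW
  refine blochToL2_injective ?_
  rw [map_sum, ← hc]
  refine Finset.sum_congr rfl fun s _ => ?_
  rw [map_smul]
  congr 1
  exact (hφ.orthonormal_state.inner_right_fintype c s).symm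

/-- The equation solved by the reduced resolvent. -/
lemma hamiltonian_resolvent {n : ℕ} (hV : IsSuperHoneycomb u₁ V)
    (hdeg : FourfoldDegeneracy u₁ V n ED) (f : smoothBloch u₁ 0) :
    hamiltonian hV 0 (resolvent hV ED f) = (ED : ℂ) • resolvent hV ED f + f -
      ∑ s, ⟪blochToL2 0 (hφ.state s), blochToL2 0 f⟫_ℂ • hφ.state s := by
  have h1 := hφ.eq_sum_of_mem_smoothKer hV hdeg (isResolved_resolvent (hV := hV) (E := ED) f).2
  have h2 (s : Bool × Bool) : ⟪blochToL2 0 (hφ.state s), blochToL2 0 (f -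
      (hamiltonian hV 0 (resolvent hV ED f) - (ED : ℂ) • resolvent hV ED f))⟫_ℂ =
      ⟪blochToL2 0 (hφ.state s), blochToL2 0 f⟫_ℂ := by
    rw [map_sub, inner_sub_right, inner_sub_smul_of_mem_smoothKer (hφ.state_mem hV s), sub_zero]
  simp only [h2] at h1
  rw [← h1]
  abel

/-! ### Matrix elements -/

/-- The matrix element `⟨φ₁, 2ik·∇ φ₂⟩`. -/
lemma inner_pair_gradOp (k : Plane) :
    ⟪blochToL2 0 (hφ.pair true), blochToL2 0 (gradOp k (hφ.pair false))⟫_ℂ =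
      twoIkDot k (vSharp u₁ φ) := by
  have h (j : Fin 2) : ⟪blochToL2 0 (hφ.pair true),
      blochToL2 0 (dirD 0 (stdVec j) (hφ.pair false))⟫_ℂ = vSharp u₁ φ j := inner_blochToL2 _ _
  rw [gradOp_apply, dirD_eq, map_smul, inner_smul_right, map_add, inner_add_right, map_smul,
    map_smul, inner_smul_right, inner_smul_right, h, h, twoIkDot, Fin.sum_univ_two]

lemma inner_pair_gradOp_self (j : Bool) (k : Plane) :
    ⟪blochToL2 0 (hφ.pair j), blochToL2 0 (gradOp k (hφ.pair j))⟫_ℂ = 0 := by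
  refine inner_gradOp_eq_zero (hφ.rotMap_pair j) (hφ.rotMap_pair j) ?_ k
  cases j
  · simpa [mul_comm] using conj_tau_mul_tau
  · simpa using conj_tau_mul_tau

/-- The rotation symmetry forces `v_♯` to be a multiple of `(1, i)`. -/
lemma vSharp_one (hφ : IsDiracState u₁ V ED φ) : vSharp u₁ φ 1 = Complex.I * vSharp u₁ φ 0 := by
  -- The characters `τ` and `τ̄` produce the factor `τ̄² = τ`. For `k = e₁` this reads `-½ v₀ +
  -- (√3/2) v₁ = τ v₀`, that is, `v₁ = i v₀`.
  have h := inner_gradOp_rot (hφ.rotMap_pair true) (hφ.rotMap_pair false) (stdVec 0)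
  rw [hφ.inner_pair_gradOp, hφ.inner_pair_gradOp, if_pos rfl, if_neg (by simp), conj_tau_sq,
    tau_eq] at h
  simp only [twoIkDot, Fin.sum_univ_two, rot_zero_coord, rot_one_coord] at h
  simp at h
  have h3 : ((Real.sqrt 3 : ℝ) : ℂ) ≠ 0 := by simp
  have hI := Complex.I_ne_zero
  have h4 : (Complex.I * (Real.sqrt 3 : ℝ)) * (vSharp u₁ φ 1 - Complex.I * vSharp u₁ φ 0) = 0 := by
    linear_combination h
  exact sub_eq_zero.1 ((mul_eq_zero.1 h4).resolve_left (mul_ne_zero hI h3))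

lemma norm_twoIkDot (hφ : IsDiracState u₁ V ED φ) (k : Plane) :
    ‖twoIkDot k (vSharp u₁ φ)‖ = Real.sqrt 2 * ‖vSharp u₁ φ‖ * ‖k‖ := by
  have h1 : ‖vSharp u₁ φ‖ ^ 2 = 2 * ‖vSharp u₁ φ 0‖ ^ 2 := by
    rw [EuclideanSpace.norm_sq_eq, Fin.sum_univ_two, hφ.vSharp_one, norm_mul, Complex.norm_I]
    ring
  have h2 : twoIkDot k (vSharp u₁ φ) =
      2 * Complex.I * (((k 0 : ℝ) + (k 1 : ℝ) * Complex.I) * vSharp u₁ φ 0) := by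
    rw [twoIkDot, Fin.sum_univ_two, hφ.vSharp_one]; ring
  have h3 : ‖((k 0 : ℝ) + (k 1 : ℝ) * Complex.I : ℂ)‖ ^ 2 = ‖k‖ ^ 2 := by
    rw [← Complex.normSq_eq_norm_sq, Complex.normSq_add_mul_I, plane_norm_sq]
  rw [← sq_eq_sq₀ (norm_nonneg _) (by positivity), h2, mul_pow, mul_pow, h1, norm_mul, norm_mul,
    norm_mul, Complex.norm_I, Complex.norm_ofNat, Real.sq_sqrt zero_le_two, mul_pow, mul_pow,
    mul_pow, h3]
  ring

/-- The second order operator `2ik·∇ (H - E)⁻¹ Q_⊥ 2ik·∇`. -/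
def _root_.SuperHoneycomb.secondOp (hV : IsSuperHoneycomb u₁ V) (E : ℝ) (k : Plane) :
    smoothBloch u₁ 0 →ₗ[ℂ] smoothBloch u₁ 0 := gradOp k ∘ₗ resolvent hV E ∘ₗ gradOp k

variable (hV : IsSuperHoneycomb u₁ V)

lemma _root_.SuperHoneycomb.secondOp_apply (E : ℝ) (f : smoothBloch u₁ 0) :
    secondOp hV E k f = gradOp k (resolvent hV E (gradOp k f)) := rfl

lemma inner_secondOp (f g : smoothBloch u₁ 0) :
    ⟪blochToL2 0 (secondOp hV ED k f), blochToL2 0 g⟫_ℂ =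
      ⟪blochToL2 0 f, blochToL2 0 (secondOp hV ED k g)⟫_ℂ := by
  rw [secondOp_apply, inner_gradOp, inner_resolvent, inner_gradOp, secondOp_apply]

lemma secondOp_partnerMap (f : smoothBloch u₁ 0) :
    secondOp hV ED k (partnerMap f) = partnerMap (secondOp hV ED k f) := by
  rw [secondOp_apply, secondOp_apply, gradOp_partnerMap, resolvent_partnerMap, gradOp_partnerMap]

/-- Two gradients change sign twice. Hence `m` and `b` are the same in both sectors, whereas the
first-order term changes sign; this is the origin of the two couplings `±2ik·v_♯ + b`. -/
lemma secondOp_reflect (ε : Bool) (f : smoothBloch u₁ 0) :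
    secondOp hV ED k (reflect ε f) = reflect ε (secondOp hV ED k f) := by
  rw [secondOp_apply, secondOp_apply, gradOp_reflect, map_smul, map_smul, resolvent_reflect,
    gradOp_reflect, smul_smul, ← Complex.ofReal_mul, sgn_mul_self, Complex.ofReal_one, one_smul]

lemma mTerm_eq : mTerm u₁ V ED φ k =
    ⟪blochToL2 0 (hφ.pair true), blochToL2 0 (secondOp hV ED k (hφ.pair true))⟫_ℂ := by
  rw [inner_blochToL2, secondOp_apply, gradOp_coe, ← reducedResolvent_eq, gradOp_coe]
  rfl

lemma bTerm_eq : bTerm u₁ V ED φ k =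
    ⟪blochToL2 0 (hφ.pair true), blochToL2 0 (secondOp hV ED k (hφ.pair false))⟫_ℂ := by
  rw [inner_blochToL2, secondOp_apply, gradOp_coe, ← reducedResolvent_eq, gradOp_coe]
  rfl

lemma conj_mTerm (hφ : IsDiracState u₁ V ED φ) (hV : IsSuperHoneycomb u₁ V) : (starRingEnd ℂ) (mTerm u₁ V ED φ k) = mTerm u₁ V ED φ k := by
  rw [hφ.mTerm_eq hV, inner_conj_symm, inner_secondOp]

/-- The matrix of the first order operator in the pair `φ₁, φ₂`. -/
lemma inner_pair_gradOp_pair (i j : Bool) :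
    ⟪blochToL2 0 (hφ.pair i), blochToL2 0 (gradOp k (hφ.pair j))⟫_ℂ =
      if i = j then 0 else if i then twoIkDot k (vSharp u₁ φ) else
        (starRingEnd ℂ) (twoIkDot k (vSharp u₁ φ)) := by
  cases i <;> cases j
  · exact hφ.inner_pair_gradOp_self _ _
  · rw [← inner_conj_symm, inner_gradOp, hφ.inner_pair_gradOp]; rfl
  · exact hφ.inner_pair_gradOp k
  · exact hφ.inner_pair_gradOp_self _ _

/-- The matrix of the second order operator in the pair `φ₁, φ₂`. -/
lemma inner_pair_secondOp_pair (i j : Bool) :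
    ⟪blochToL2 0 (hφ.pair i), blochToL2 0 (secondOp hV ED k (hφ.pair j))⟫_ℂ =
      if i = j then mTerm u₁ V ED φ k else if i then bTerm u₁ V ED φ k else
        (starRingEnd ℂ) (bTerm u₁ V ED φ k) := by
  cases i <;> cases j
  · rw [pair_false, secondOp_partnerMap, inner_partnerMap, inner_secondOp, hφ.mTerm_eq hV]; rfl
  · rw [← inner_conj_symm, inner_secondOp, ← hφ.bTerm_eq hV]; rfl
  · exact (hφ.bTerm_eq hV).symm
  · exact (hφ.mTerm_eq hV).symm

/-- Differentiation commutes with translation by `v₁`, so the sectors do not couple; inside a sector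
only the reflection sign is left. -/
lemma inner_state_gradOp (s : Bool × Bool) (ε j : Bool) :
    ⟪blochToL2 0 (hφ.state s), blochToL2 0 (gradOp k (hφ.state (ε, j)))⟫_ℂ =
      if s.1 = ε then (sgn ε : ℂ) * ⟪blochToL2 0 (hφ.pair s.2), blochToL2 0 (gradOp k (hφ.pair j))⟫_ℂ
        else 0 := by
  obtain ⟨ε', i⟩ := s
  split_ifs with h
  · obtain rfl : ε' = ε := h
    rw [state, state, gradOp_reflect, map_smul, inner_smul_right, inner_reflect]
  · refine hφ.inner_state_eq_zero h ?_
    rw [← gradOp_translateMap, hφ.translateMap_state, map_smul]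

lemma inner_state_secondOp (s : Bool × Bool) (ε j : Bool) :
    ⟪blochToL2 0 (hφ.state s), blochToL2 0 (secondOp hV ED k (hφ.state (ε, j)))⟫_ℂ =
      if s.1 = ε then ⟪blochToL2 0 (hφ.pair s.2), blochToL2 0 (secondOp hV ED k (hφ.pair j))⟫_ℂ
        else 0 := by
  obtain ⟨ε', i⟩ := s
  split_ifs with h
  · obtain rfl : ε' = ε := h
    rw [state, state, secondOp_reflect, inner_reflect]
  · refine hφ.inner_state_eq_zero h ?_
    rw [secondOp_apply, ← gradOp_translateMap, ← resolvent_translateMap hV.folding₁,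
      ← gradOp_translateMap, hφ.translateMap_state, map_smul, map_smul, map_smul]

end

end IsDiracState

end

/-! ### Quasimodes with third-order residual. -/

section

variable {u₁ : Plane} {k : Plane} {V : Plane → ℝ} {ED : ℝ} {φ : Plane → ℂ}

/-! ### Families of a given order in the quasi-momentum -/

section Order

variable {M N : Type*} [AddCommGroup M] [Module ℂ M] [AddCommGroup N] [Module ℂ N]

/-- The finite sums of families `k ↦ c(k) • d` with `c(k) = O(‖k‖^j)`. -/
def ofOrder (M : Type*) [AddCommGroup M] [Module ℂ M] (j : ℕ) : Submodule ℂ (Plane → M) :=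
  Submodule.span ℂ {f | ∃ (c : Plane → ℂ) (d : M), (c =O[𝓝 0] fun k => ‖k‖ ^ j) ∧
    f = fun k => c k • d}

lemma smul_mem_ofOrder {j : ℕ} {c : Plane → ℂ} (hc : c =O[𝓝 0] fun k => ‖k‖ ^ j) (d : M) :
    (fun k => c k • d) ∈ ofOrder M j := Submodule.subset_span ⟨c, d, hc, rfl⟩

/-- A linear map acts on the fixed vectors `d` and leaves the coefficients alone. No norm on the
smooth functions is needed, nor any bound on derivatives or on the resolvent. -/
lemma map_mem_ofOrder {j : ℕ} (T : M →ₗ[ℂ] N) {f : Plane → M} (hf : f ∈ ofOrder M j) :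
    (fun k => T (f k)) ∈ ofOrder N j := by
  induction hf using Submodule.span_induction with
  | mem f hf =>
    obtain ⟨c, d, hc, rfl⟩ := hf
    simpa only [map_smul] using smul_mem_ofOrder hc (T d)
  | zero => simp only [Pi.zero_apply, map_zero]; exact Submodule.zero_mem (ofOrder N j)
  | add f g _ _ hf hg =>
    simp only [Pi.add_apply, map_add]; exact Submodule.add_mem _ hf hg
  | smul a f _ hf => simp only [Pi.smul_apply, map_smul]; exact Submodule.smul_mem _ a hf

lemma smul_mem_ofOrder_add {i j l : ℕ} {c : Plane → ℂ} (hc : c =O[𝓝 0] fun k => ‖k‖ ^ i)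
    {f : Plane → M} (hf : f ∈ ofOrder M j) (hl : l = i + j := by norm_num) :
    (fun k => c k • f k) ∈ ofOrder M l := by
  subst hl
  induction hf using Submodule.span_induction with
  | mem f hf =>
    obtain ⟨c', d, hc', rfl⟩ := hf
    simp only [smul_smul]
    refine smul_mem_ofOrder ?_ d
    simpa only [pow_add] using hc.mul hc'
  | zero => simp only [Pi.zero_apply, smul_zero]; exact Submodule.zero_mem (ofOrder M (i + j))
  | add f g _ _ hf hg =>
    simp only [Pi.add_apply, smul_add]; exact Submodule.add_mem _ hf hg
  | smul a f _ hf =>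
    simp only [Pi.smul_apply, smul_comm _ a]; exact Submodule.smul_mem _ a hf

lemma isBigO_pow_of_le {i j : ℕ} (h : i ≤ j) :
    (fun k : Plane => ‖k‖ ^ j) =O[𝓝 0] fun k => ‖k‖ ^ i := by
  refine Asymptotics.IsBigO.of_bound 1 ?_
  filter_upwards [Metric.ball_mem_nhds (0 : Plane) one_pos] with k hk
  rw [mem_ball_zero_iff] at hk
  simpa using pow_le_pow_of_le_one (norm_nonneg k) hk.le h

lemma ofOrder_antitone : Antitone (ofOrder M) := fun i j h => by
  refine Submodule.span_mono ?_
  rintro _ ⟨c, d, hc, rfl⟩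
  exact ⟨c, d, hc.trans (isBigO_pow_of_le h), rfl⟩

lemma isBigO_of_mem_ofOrder {j : ℕ} {F : Type*} [NormedAddCommGroup F] [NormedSpace ℂ F]
    {f : Plane → F} (hf : f ∈ ofOrder F j) : f =O[𝓝 0] fun k => ‖k‖ ^ j := by
  induction hf using Submodule.span_induction with
  | mem f hf =>
    obtain ⟨c, d, hc, rfl⟩ := hf
    simpa using hc.smul (Asymptotics.isBigO_const_const d (one_ne_zero (α := ℝ)) (𝓝 (0 : Plane)))
  | zero => exact Asymptotics.isBigO_zero _ _
  | add f g _ _ hf hg => exact hf.add hg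
  | smul a f _ hf => exact hf.const_smul_left a

lemma isBigO_coord (j : Fin 2) : (fun k : Plane => (k j : ℂ)) =O[𝓝 0] fun k => ‖k‖ ^ 1 := by
  refine Asymptotics.IsBigO.of_bound 1 (Filter.Eventually.of_forall fun k => ?_)
  simpa using PiLp.norm_apply_le k j

lemma isBigO_norm_sq : (fun k : Plane => (‖k‖ : ℂ) ^ 2) =O[𝓝 0] fun k => ‖k‖ ^ 2 :=
  Asymptotics.IsBigO.of_bound 1 (Filter.Eventually.of_forall fun k => by simp)

lemma gradOp_mem_ofOrder {j l : ℕ} {f : Plane → smoothBloch u₁ 0}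
    (hf : f ∈ ofOrder (smoothBloch u₁ 0) j) (hl : l = 1 + j := by norm_num) :
    (fun k => gradOp k (f k)) ∈ ofOrder (smoothBloch u₁ 0) l := by
  have h (i : Fin 2) := smul_mem_ofOrder_add (isBigO_coord i)
    (map_mem_ofOrder (gradOp (u₁ := u₁) (stdVec i)) hf) hl
  convert Submodule.add_mem _ (h 0) (h 1) using 1
  ext1 k
  exact gradOp_eq k (f k)

lemma const_mem_ofOrder (f : M) :
    (fun _ => f) ∈ ofOrder M 0 := by
  simpa using smul_mem_ofOrder (j := 0) (c := fun _ => 1)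
    (by simpa using Asymptotics.isBigO_refl (fun _ : Plane => (1 : ℝ)) (𝓝 0)) f

end Order

/-! ### Approximate eigenfunctions -/

/-- The phase of a complex number, equal to `1` at zero. -/
def phase (c : ℂ) : ℂ := if c = 0 then 1 else c / ‖c‖

lemma norm_mul_phase (c : ℂ) : (‖c‖ : ℂ) * phase c = c := by
  rw [phase]
  split_ifs with h
  · simp [h]
  · exact mul_div_cancel₀ c (Complex.ofReal_ne_zero.2 (norm_ne_zero_iff.2 h))

lemma norm_phase (c : ℂ) : ‖phase c‖ = 1 := by
  rw [phase]
  split_ifs with h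
  · simp
  · rw [norm_div, Complex.norm_real, norm_norm, div_self (norm_ne_zero_iff.2 h)]

lemma conj_phase_mul_phase (c : ℂ) : (starRingEnd ℂ) (phase c) * phase c = 1 := by
  rw [← Complex.normSq_eq_conj_mul_self, Complex.normSq_eq_norm_sq, norm_phase]
  simp

lemma phase_mul_conj (c : ℂ) : phase c * (starRingEnd ℂ) c = ‖c‖ := by
  have h := congrArg (starRingEnd ℂ) (norm_mul_phase c)
  rw [map_mul, Complex.conj_ofReal] at h
  rw [← h]
  linear_combination (‖c‖ : ℂ) * conj_phase_mul_phase c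

/-- The off-diagonal entry of the effective Hamiltonian, up to sign, in the sector `ε`. -/
def coupling (u₁ : Plane) (V : Plane → ℝ) (ED : ℝ) (φ : Plane → ℂ) (ε : Bool) (k : Plane) : ℂ :=
  (sgn ε : ℂ) * twoIkDot k (vSharp u₁ φ) + bTerm u₁ V ED φ k

/-- The eigenvalues of the effective Hamiltonian. -/
def modeEig (u₁ : Plane) (V : Plane → ℝ) (ED : ℝ) (φ : Plane → ℂ) (s : Bool × Bool) (k : Plane) :
    ℝ :=
  ‖k‖ ^ 2 - (mTerm u₁ V ED φ k).re + sgn s.2 * ‖coupling u₁ V ED φ s.1 k‖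

namespace IsDiracState

/-- The eigenvectors of the effective Hamiltonian. -/
def mode (hφ : IsDiracState u₁ V ED φ) (s : Bool × Bool) (k : Plane) : smoothBloch u₁ 0 :=
  ((Real.sqrt 2)⁻¹ : ℂ) • ((-(sgn s.2 : ℂ) * phase (coupling u₁ V ED φ s.1 k)) •
    hφ.state (s.1, true) + hφ.state (s.1, false))

/-- The phase of the coupling need not be continuous in `k`; order zero only asks for bounded
coefficients. -/
lemma mode_mem_ofOrder (hφ : IsDiracState u₁ V ED φ) (s : Bool × Bool) :
    (fun k => hφ.mode s k) ∈ ofOrder (smoothBloch u₁ 0) 0 := by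
  have h : (fun k => -(sgn s.2 : ℂ) * phase (coupling u₁ V ED φ s.1 k)) =O[𝓝 0]
      fun k => ‖k‖ ^ 0 := by
    refine Asymptotics.IsBigO.of_bound 1 (Filter.Eventually.of_forall fun k => ?_)
    rw [norm_mul, norm_phase, norm_neg, Complex.norm_real]
    cases s.2 <;> simp [sgn]
  exact Submodule.smul_mem _ _ (Submodule.add_mem _ (smul_mem_ofOrder h _) (const_mem_ofOrder _))

lemma mode_mem (hφ : IsDiracState u₁ V ED φ) (hV : IsSuperHoneycomb u₁ V) (s : Bool × Bool) (k : Plane) :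
    hφ.mode s k ∈ smoothKer hV ED :=
  Submodule.smul_mem _ _ (Submodule.add_mem _ (Submodule.smul_mem _ _ (hφ.state_mem hV _))
    (hφ.state_mem hV _))

variable [hu : Fact (u₁ ≠ 0)] (hφ : IsDiracState u₁ V ED φ) (hV : IsSuperHoneycomb u₁ V)

/-- The first order correction to the eigenvectors. -/
def corr₁ (s : Bool × Bool) (k : Plane) : smoothBloch u₁ 0 :=
  resolvent hV ED (gradOp k (hφ.mode s k))

/-- The second order correction to the eigenvectors. -/
def corr₂ (s : Bool × Bool) (k : Plane) : smoothBloch u₁ 0 :=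
  resolvent hV ED (gradOp k (hφ.corr₁ hV s k) + (modeEig u₁ V ED φ s k : ℂ) • hφ.corr₁ hV s k)

/-- The correction to the eigenvectors. -/
def corr (s : Bool × Bool) (k : Plane) : smoothBloch u₁ 0 := hφ.corr₁ hV s k + hφ.corr₂ hV s k

/-- The residual of the corrected eigenvectors. -/
def residual (s : Bool × Bool) (k : Plane) : smoothBloch u₁ 0 :=
  (‖k‖ : ℂ) ^ 2 • hφ.corr hV s k - gradOp k (hφ.corr₂ hV s k) -
    (modeEig u₁ V ED φ s k : ℂ) • hφ.corr₂ hV s k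

lemma inner_mode (s t : Bool × Bool) (k : Plane) :
    ⟪blochToL2 0 (hφ.mode s k), blochToL2 0 (hφ.mode t k)⟫_ℂ = if s = t then 1 else 0 := by
  have h2 : (((Real.sqrt 2 : ℝ) : ℂ)⁻¹) * (((Real.sqrt 2 : ℝ) : ℂ)⁻¹) = 1 / 2 := by
    rw [← Complex.ofReal_inv, ← Complex.ofReal_mul, ← mul_inv, Real.mul_self_sqrt zero_le_two]
    norm_num
  obtain ⟨ε, σ⟩ := s
  obtain ⟨ε', σ'⟩ := t
  rw [mode, mode, map_smul, map_smul, inner_smul_left, inner_smul_right, ← mul_assoc, map_inv₀,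
    Complex.conj_ofReal, h2]
  simp only [map_smul, map_add, inner_smul_left, inner_smul_right, inner_add_left,
    inner_add_right, inner_state, map_mul, map_neg, Complex.conj_ofReal]
  by_cases h : ε = ε'
  · subst h
    have hp := conj_phase_mul_phase (coupling u₁ V ED φ ε k)
    cases σ <;> cases σ' <;> simp [sgn, mul_comm (phase _), hp] <;> norm_num
  · simp [h]

lemma orthonormal_mode (k : Plane) : Orthonormal ℂ fun s => blochToL2 0 (hφ.mode s k) :=
  orthonormal_iff_ite.2 fun s t => hφ.inner_mode s t k

/-- The effective eigenvalue equation. -/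
lemma sum_inner_mode (s : Bool × Bool) (k : Plane) :
    ∑ t, ⟪blochToL2 0 (hφ.state t), blochToL2 0 (gradOp k (hφ.mode s k))⟫_ℂ • hφ.state t +
      ∑ t, ⟪blochToL2 0 (hφ.state t), blochToL2 0 (secondOp hV ED k (hφ.mode s k))⟫_ℂ •
        hφ.state t =
      ((‖k‖ : ℂ) ^ 2 - modeEig u₁ V ED φ s k) • hφ.mode s k := by
  obtain ⟨ε, σ⟩ := s
  set m := mTerm u₁ V ED φ k with hm
  set c := coupling u₁ V ED φ ε k with hc
  have hre : ((m.re : ℝ) : ℂ) = m := Complex.conj_eq_iff_re.1 (hφ.conj_mTerm hV)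
  -- Only the sector `ε` contributes. There the sum of the first and second order matrices has
  -- diagonal `m` and off-diagonal entries `c` and its conjugate, and it is applied to the vector
  -- `(-σ phase c, 1) / √2`.
  have h1 (t : Bool × Bool) : ⟪blochToL2 0 (hφ.state t), blochToL2 0 (gradOp k (hφ.mode (ε, σ) k))⟫_ℂ
      + ⟪blochToL2 0 (hφ.state t), blochToL2 0 (secondOp hV ED k (hφ.mode (ε, σ) k))⟫_ℂ =
      if t.1 = ε then (Real.sqrt 2 : ℂ)⁻¹ * (if t.2 then c - sgn σ * phase c * m else
        m - sgn σ * (phase c * (starRingEnd ℂ) c)) else 0 := by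
    simp only [mode, map_smul, map_add, inner_smul_right, inner_add_right, inner_state_gradOp,
      inner_state_secondOp, inner_pair_gradOp_pair, inner_pair_secondOp_pair]
    split_ifs with h <;> simp_all [coupling] <;> ring
  rw [← Finset.sum_add_distrib]
  simp only [← add_smul, h1]
  rw [Fintype.sum_prod_type]
  simp only [Fintype.sum_bool, ite_smul, zero_smul, if_true]
  have h3 : (sgn σ : ℂ) * sgn σ = 1 := by rw [← Complex.ofReal_mul, sgn_mul_self]; simp
  have h2 : ((‖k‖ : ℂ) ^ 2 - modeEig u₁ V ED φ (ε, σ) k) = m - sgn σ * ‖c‖ := by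
    rw [modeEig]
    push_cast
    rw [hre]
    ring
  rw [h2, mode]
  -- The mode is an eigenvector with eigenvalue `m - σ|c|`, because `|c| phase c = c` and `σ² = 1`.
  have h4 : c - sgn σ * phase c * m = (m - sgn σ * ‖c‖) * (-(sgn σ : ℂ) * phase c) := by
    linear_combination -norm_mul_phase c - (‖c‖ : ℂ) * phase c * h3
  rw [h4, phase_mul_conj]
  cases ε <;> simp <;> module

/-- The corrected eigenvectors solve the eigenvalue equation up to the residual. -/
lemma hamiltonian_mode_add_corr {n : ℕ} (hdeg : FourfoldDegeneracy u₁ V n ED) (s : Bool × Bool)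
    (k : Plane) :
    hamiltonian hV 0 (hφ.mode s k + hφ.corr hV s k) - gradOp k (hφ.mode s k + hφ.corr hV s k) +
      (‖k‖ : ℂ) ^ 2 • (hφ.mode s k + hφ.corr hV s k) =
      ((ED + modeEig u₁ V ED φ s k : ℝ) : ℂ) • (hφ.mode s k + hφ.corr hV s k) +
        hφ.residual hV s k := by
  have h1 : hamiltonian hV 0 (hφ.corr₁ hV s k) = (ED : ℂ) • hφ.corr₁ hV s k +
      gradOp k (hφ.mode s k) - ∑ t, ⟪blochToL2 0 (hφ.state t),
        blochToL2 0 (gradOp k (hφ.mode s k))⟫_ℂ • hφ.state t :=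
    hφ.hamiltonian_resolvent hV hdeg _
  have h2 := hφ.hamiltonian_resolvent hV hdeg
    (gradOp k (hφ.corr₁ hV s k) + (modeEig u₁ V ED φ s k : ℂ) • hφ.corr₁ hV s k)
  -- `corr₁` is orthogonal to the kernel, so the multiple of it in the source of `corr₂` has no
  -- kernel component.
  have h3 (t : Bool × Bool) : ⟪blochToL2 0 (hφ.state t), blochToL2 0 (gradOp k (hφ.corr₁ hV s k) +
      (modeEig u₁ V ED φ s k : ℂ) • hφ.corr₁ hV s k)⟫_ℂ =
      ⟪blochToL2 0 (hφ.state t), blochToL2 0 (secondOp hV ED k (hφ.mode s k))⟫_ℂ := by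
    have : ⟪blochToL2 0 (hφ.state t), blochToL2 0 (hφ.corr₁ hV s k)⟫_ℂ = 0 :=
      (isResolved_resolvent (hV := hV) (E := ED) _).1 _ (hφ.state_mem hV t)
    rw [map_add, map_smul, inner_add_right, inner_smul_right, this, mul_zero, add_zero]
    rfl
  simp only [h3] at h2
  change hamiltonian hV 0 (hφ.corr₂ hV s k) = (ED : ℂ) • hφ.corr₂ hV s k + _ - _ at h2
  -- The kernel components removed by the two resolvents add up to `(‖k‖² - modeEig)` times the
  -- mode, exactly what the term `‖k‖²` and the energy shift require.
  have h4 := hφ.sum_inner_mode hV s k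
  rw [← eq_sub_iff_add_eq] at h4
  rw [h4] at h1
  simp only [corr, residual, map_add, mem_smoothKer.1 (hφ.mode_mem hV s k), h1, h2,
    Complex.ofReal_add]
  module

/-- Both corrections lie in the range of the reduced resolvent. This orthogonality makes the
perturbation of norms quadratic in the correction. -/
lemma inner_mode_corr (s t : Bool × Bool) (k : Plane) :
    ⟪blochToL2 0 (hφ.mode s k), blochToL2 0 (hφ.corr hV t k)⟫_ℂ = 0 := by
  have h (g : smoothBloch u₁ 0) :
      ⟪blochToL2 0 (hφ.mode s k), blochToL2 0 (resolvent hV ED g)⟫_ℂ = 0 :=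
    (isResolved_resolvent (hV := hV) (E := ED) g).1 _ (hφ.mode_mem hV s k)
  rw [corr, map_add, inner_add_right, corr₁, corr₂, h, h, add_zero]

/-! ### Orders of magnitude -/

lemma isBigO_inner {j : ℕ} {g : Plane → smoothBloch u₁ 0} (hg : g ∈ ofOrder (smoothBloch u₁ 0) j)
    (f : smoothBloch u₁ 0) :
    (fun k => ⟪blochToL2 0 f, blochToL2 0 (g k)⟫_ℂ) =O[𝓝 0] fun k => ‖k‖ ^ j :=
  isBigO_of_mem_ofOrder
    (map_mem_ofOrder ((innerSL ℂ (blochToL2 0 f)).toLinearMap ∘ₗ blochToL2 0) hg)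

lemma secondOp_mem_ofOrder (f : smoothBloch u₁ 0) :
    (fun k => secondOp hV ED k f) ∈ ofOrder (smoothBloch u₁ 0) 2 :=
  gradOp_mem_ofOrder (j := 1)
    (map_mem_ofOrder (resolvent hV ED) (gradOp_mem_ofOrder (const_mem_ofOrder f)))

lemma isBigO_twoIkDot (hφ : IsDiracState u₁ V ED φ) :
    (fun k => twoIkDot k (vSharp u₁ φ)) =O[𝓝 0] fun k => ‖k‖ ^ 1 := by
  simp only [← hφ.inner_pair_gradOp]
  exact isBigO_inner (gradOp_mem_ofOrder (const_mem_ofOrder _)) _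

lemma isBigO_bTerm (hφ : IsDiracState u₁ V ED φ) (hV : IsSuperHoneycomb u₁ V) : (fun k => bTerm u₁ V ED φ k) =O[𝓝 0] fun k => ‖k‖ ^ 2 := by
  simp only [hφ.bTerm_eq hV]
  exact isBigO_inner (secondOp_mem_ofOrder hV _) _

lemma isBigO_mTerm (hφ : IsDiracState u₁ V ED φ) (hV : IsSuperHoneycomb u₁ V) : (fun k => mTerm u₁ V ED φ k) =O[𝓝 0] fun k => ‖k‖ ^ 2 := by
  simp only [hφ.mTerm_eq hV]
  exact isBigO_inner (secondOp_mem_ofOrder hV _) _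

lemma isBigO_coupling (hφ : IsDiracState u₁ V ED φ) (hV : IsSuperHoneycomb u₁ V) (ε : Bool) : coupling u₁ V ED φ ε =O[𝓝 0] fun k => ‖k‖ ^ 1 :=
  (hφ.isBigO_twoIkDot.const_mul_left _).add
    ((hφ.isBigO_bTerm hV).trans (isBigO_pow_of_le one_le_two))

lemma isBigO_modeEig (hφ : IsDiracState u₁ V ED φ) (hV : IsSuperHoneycomb u₁ V) (s : Bool × Bool) :
    (fun k => (modeEig u₁ V ED φ s k : ℂ)) =O[𝓝 0] fun k => ‖k‖ ^ 1 := by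
  have h1 := (hφ.isBigO_mTerm hV).trans (isBigO_pow_of_le one_le_two)
  have h2 : (fun k => (((mTerm u₁ V ED φ k).re : ℝ) : ℂ)) =O[𝓝 0] fun k : Plane => ‖k‖ ^ 1 := by
    refine Asymptotics.IsBigO.trans (Asymptotics.IsBigO.of_bound 1
      (Filter.Eventually.of_forall fun k => ?_)) h1
    rw [Complex.norm_real, one_mul]
    exact Complex.abs_re_le_norm _
  have h3 : (fun k => ((‖coupling u₁ V ED φ s.1 k‖ : ℝ) : ℂ)) =O[𝓝 0] fun k : Plane => ‖k‖ ^ 1 := by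
    refine Asymptotics.IsBigO.trans (Asymptotics.IsBigO.of_bound 1
      (Filter.Eventually.of_forall fun k => ?_)) (hφ.isBigO_coupling hV s.1)
    rw [Complex.norm_real, one_mul, norm_norm]
  have h4 := ((isBigO_norm_sq.trans (isBigO_pow_of_le one_le_two)).sub h2).add
    (h3.const_mul_left (sgn s.2 : ℂ))
  refine h4.congr_left fun k => ?_
  rw [modeEig]
  push_cast
  ring

lemma corr₁_mem_ofOrder (s : Bool × Bool) :
    (fun k => hφ.corr₁ hV s k) ∈ ofOrder (smoothBloch u₁ 0) 1 :=
  map_mem_ofOrder _ (gradOp_mem_ofOrder (hφ.mode_mem_ofOrder s))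

lemma corr₂_mem_ofOrder (s : Bool × Bool) :
    (fun k => hφ.corr₂ hV s k) ∈ ofOrder (smoothBloch u₁ 0) 2 :=
  map_mem_ofOrder _ (Submodule.add_mem _ (gradOp_mem_ofOrder (hφ.corr₁_mem_ofOrder hV s))
    (smul_mem_ofOrder_add (hφ.isBigO_modeEig hV s) (hφ.corr₁_mem_ofOrder hV s)))

lemma corr_mem_ofOrder (s : Bool × Bool) :
    (fun k => hφ.corr hV s k) ∈ ofOrder (smoothBloch u₁ 0) 1 :=
  Submodule.add_mem _ (hφ.corr₁_mem_ofOrder hV s)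
    (ofOrder_antitone one_le_two (hφ.corr₂_mem_ofOrder hV s))

lemma residual_mem_ofOrder (s : Bool × Bool) :
    (fun k => hφ.residual hV s k) ∈ ofOrder (smoothBloch u₁ 0) 3 :=
  Submodule.sub_mem _ (Submodule.sub_mem _
    (smul_mem_ofOrder_add isBigO_norm_sq (hφ.corr_mem_ofOrder hV s))
    (gradOp_mem_ofOrder (hφ.corr₂_mem_ofOrder hV s)))
    (smul_mem_ofOrder_add (hφ.isBigO_modeEig hV s) (hφ.corr₂_mem_ofOrder hV s))

/-- A common bound for the corrections, the residuals and the effective eigenvalues. -/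
lemma exists_bound : ∃ M ≥ 0, ∀ᶠ k in 𝓝 (0 : Plane), ∀ s,
    ‖blochToL2 0 (hφ.corr hV s k)‖ ≤ M * ‖k‖ ∧ ‖blochToL2 0 (hφ.residual hV s k)‖ ≤ M * ‖k‖ ^ 3 ∧
      |modeEig u₁ V ED φ s k| ≤ M * ‖k‖ := by
  have h (s : Bool × Bool) : ∃ M ≥ 0, ∀ᶠ k in 𝓝 (0 : Plane),
      ‖blochToL2 0 (hφ.corr hV s k)‖ ≤ M * ‖k‖ ∧
      ‖blochToL2 0 (hφ.residual hV s k)‖ ≤ M * ‖k‖ ^ 3 ∧ |modeEig u₁ V ED φ s k| ≤ M * ‖k‖ := by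
    obtain ⟨c₁, h1, h1'⟩ := (isBigO_of_mem_ofOrder
      (map_mem_ofOrder (blochToL2 0) (hφ.corr_mem_ofOrder hV s))).exists_nonneg
    obtain ⟨c₂, h2, h2'⟩ := (isBigO_of_mem_ofOrder
      (map_mem_ofOrder (blochToL2 0) (hφ.residual_mem_ofOrder hV s))).exists_nonneg
    obtain ⟨c₃, h3, h3'⟩ := (hφ.isBigO_modeEig hV s).exists_nonneg
    refine ⟨c₁ + c₂ + c₃, by positivity, ?_⟩
    filter_upwards [h1'.bound, h2'.bound, h3'.bound] with k e1 e2 e3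
    rw [norm_pow, norm_norm] at e1 e2 e3
    rw [pow_one] at e1 e3
    rw [Complex.norm_real, Real.norm_eq_abs] at e3
    exact ⟨e1.trans (mul_le_mul_of_nonneg_right (by linarith) (norm_nonneg _)),
      e2.trans (mul_le_mul_of_nonneg_right (by linarith) (by positivity)),
      e3.trans (mul_le_mul_of_nonneg_right (by linarith) (norm_nonneg _))⟩
  choose M hM0 hM using h
  refine ⟨∑ s, M s, Finset.sum_nonneg fun s _ => hM0 s, ?_⟩
  filter_upwards [Filter.eventually_all.2 hM] with k hk s
  have hs : M s ≤ ∑ s, M s := Finset.single_le_sum (fun s _ => hM0 s) (Finset.mem_univ s)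
  obtain ⟨e1, e2, e3⟩ := hk s
  exact ⟨e1.trans (mul_le_mul_of_nonneg_right hs (norm_nonneg _)),
    e2.trans (mul_le_mul_of_nonneg_right hs (by positivity)),
    e3.trans (mul_le_mul_of_nonneg_right hs (norm_nonneg _))⟩

end IsDiracState

end

/-! ### From quasimodes to the band functions. -/

section

variable {u₁ : Plane} {k : Plane} {V : Plane → ℝ} {ED : ℝ} {φ : Plane → ℂ}

/-! ### Perturbations of orthonormal systems -/

section Perturbation

variable {H κ : Type*} [NormedAddCommGroup H] [InnerProductSpace ℂ H] [Fintype κ]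
  {v ψ ρ : κ → H}

lemma norm_sq_sum_smul_add (hv : Orthonormal ℂ v) (hvψ : ∀ s t, ⟪v s, ψ t⟫_ℂ = 0) (a : κ → ℂ) :
    ‖∑ s, a s • (v s + ψ s)‖ ^ 2 = ∑ s, ‖a s‖ ^ 2 + ‖∑ s, a s • ψ s‖ ^ 2 := by
  have h0 : ⟪∑ s, a s • v s, ∑ s, a s • ψ s⟫_ℂ = 0 := by
    simp [hvψ]
  have h1 : ‖∑ s, a s • v s‖ ^ 2 = ∑ s, ‖a s‖ ^ 2 := by
    have h := hv.inner_sum a a Finset.univ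
    have h2 : ((‖∑ s, a s • v s‖ ^ 2 : ℝ) : ℂ) = ((∑ s, ‖a s‖ ^ 2 : ℝ) : ℂ) := by
      push_cast
      refine (inner_self_eq_norm_sq_to_K (𝕜 := ℂ) _).symm.trans (h.trans ?_)
      refine Finset.sum_congr rfl fun j _ => ?_
      rw [← Complex.normSq_eq_conj_mul_self, Complex.normSq_eq_norm_sq, Complex.ofReal_pow]
    exact_mod_cast h2
  simp only [smul_add, Finset.sum_add_distrib]
  rw [norm_add_pow_two (𝕜 := ℂ), h0, h1]
  simp

/-- By orthogonality the corrections can only increase the norm, so linear independence requires no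
smallness. -/
lemma sum_norm_sq_le (hv : Orthonormal ℂ v) (hvψ : ∀ s t, ⟪v s, ψ t⟫_ℂ = 0) (a : κ → ℂ) :
    ∑ s, ‖a s‖ ^ 2 ≤ ‖∑ s, a s • (v s + ψ s)‖ ^ 2 := by
  rw [norm_sq_sum_smul_add hv hvψ]
  exact le_add_of_nonneg_right (sq_nonneg _)

lemma linearIndependent_add (hv : Orthonormal ℂ v) (hvψ : ∀ s t, ⟪v s, ψ t⟫_ℂ = 0) :
    LinearIndependent ℂ fun s => v s + ψ s := by
  rw [Fintype.linearIndependent_iff]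
  intro a ha s
  have h := sum_norm_sq_le hv hvψ a
  rw [ha, norm_zero, zero_pow two_ne_zero] at h
  have h2 := Finset.single_le_sum (f := fun s => ‖a s‖ ^ 2) (fun s _ => sq_nonneg _)
    (Finset.mem_univ s)
  have h3 : ‖a s‖ ^ 2 = 0 := le_antisymm (h2.trans h) (sq_nonneg _)
  simpa using h3

lemma norm_sum_smul_le {δ : ℝ} (hψ : ∀ s, ‖ψ s‖ ≤ δ) (a : κ → ℂ) :
    ‖∑ s, a s • ψ s‖ ^ 2 ≤ Fintype.card κ * δ ^ 2 * ∑ s, ‖a s‖ ^ 2 := by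
  have h1 : ‖∑ s, a s • ψ s‖ ≤ ∑ s, ‖a s‖ * ‖ψ s‖ :=
    (norm_sum_le _ _).trans_eq (Finset.sum_congr rfl fun s _ => norm_smul _ _)
  have h2 : ∑ s, (‖a s‖ * ‖ψ s‖) ^ 2 ≤ δ ^ 2 * ∑ s, ‖a s‖ ^ 2 := by
    rw [Finset.mul_sum]
    refine Finset.sum_le_sum fun s _ => ?_
    rw [mul_pow, mul_comm]
    exact mul_le_mul_of_nonneg_right (pow_le_pow_left₀ (norm_nonneg _) (hψ s) 2) (sq_nonneg _)
  refine (pow_le_pow_left₀ (norm_nonneg _) h1 2).trans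
    ((sq_sum_le_card_mul_sum_sq (s := Finset.univ) (f := fun s => ‖a s‖ * ‖ψ s‖)).trans ?_)
  rw [mul_assoc, Finset.card_univ]
  exact mul_le_mul_of_nonneg_left h2 (Nat.cast_nonneg _)

/-- Since `ψ` is orthogonal to `v`, replacing `v` by `v + ψ` costs a relative error of order `δ²`
and not `δ`. With `r` and `δ` of order `|k|` the excess over `r` is thus of third order, like the
residual `η`; an error of order `δ` would only give `|k|²`. -/
lemma norm_sum_smul_add_le (hv : Orthonormal ℂ v) (hvψ : ∀ s t, ⟪v s, ψ t⟫_ℂ = 0) {δ η r N : ℝ}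
    (hη : 0 ≤ η) (hr : 0 ≤ r) (hN : (Fintype.card κ : ℝ) ≤ N ^ 2) (hN0 : 0 ≤ N)
    (hψ : ∀ s, ‖ψ s‖ ≤ δ) (hρ : ∀ s, ‖ρ s‖ ≤ η) {d : κ → ℝ} (hd : ∀ s, |d s| ≤ r) (a : κ → ℂ) :
    ‖∑ s, a s • ((d s : ℂ) • (v s + ψ s) + ρ s)‖ ≤
      (r * (1 + N ^ 2 * δ ^ 2) + N * η) * ‖∑ s, a s • (v s + ψ s)‖ := by
  set W := ‖∑ s, a s • (v s + ψ s)‖ with hW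
  have hA : ∑ s, ‖a s‖ ^ 2 ≤ W ^ 2 := sum_norm_sq_le hv hvψ a
  have hA0 : 0 ≤ ∑ s, ‖a s‖ ^ 2 := Finset.sum_nonneg fun s _ => sq_nonneg _
  have hW0 : 0 ≤ W := norm_nonneg _
  have hB : ∑ s, ‖a s * d s‖ ^ 2 ≤ r ^ 2 * W ^ 2 := by
    refine le_trans ?_ (mul_le_mul_of_nonneg_left hA (sq_nonneg r))
    rw [Finset.mul_sum]
    refine Finset.sum_le_sum fun s _ => ?_
    rw [norm_mul, mul_pow, mul_comm, Complex.norm_real, Real.norm_eq_abs]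
    exact mul_le_mul_of_nonneg_right (pow_le_pow_left₀ (abs_nonneg _) (hd s) 2) (sq_nonneg _)
  have h1 : ‖∑ s, (a s * d s) • (v s + ψ s)‖ ≤ r * (1 + N ^ 2 * δ ^ 2) * W := by
    refine abs_le_of_sq_le_sq' ?_ (by positivity) |>.2
    rw [norm_sq_sum_smul_add hv hvψ]
    have h2 := norm_sum_smul_le hψ fun s => a s * d s
    have h3 : (Fintype.card κ : ℝ) * δ ^ 2 * ∑ s, ‖a s * d s‖ ^ 2 ≤
        N ^ 2 * δ ^ 2 * (r ^ 2 * W ^ 2) := by gcongr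
    have h4 : 0 ≤ N ^ 2 * δ ^ 2 := by positivity
    have h5 : 0 ≤ r ^ 2 * W ^ 2 := by positivity
    nlinarith [mul_nonneg h4 h5, mul_nonneg (mul_nonneg h4 h4) h5]
  have h2 : ‖∑ s, a s • ρ s‖ ≤ N * η * W := by
    refine abs_le_of_sq_le_sq' ?_ (by positivity) |>.2
    refine (norm_sum_smul_le hρ a).trans ?_
    rw [mul_pow, mul_pow]
    gcongr
  have h3 : ∑ s, a s • ((d s : ℂ) • (v s + ψ s) + ρ s) =
      ∑ s, (a s * d s) • (v s + ψ s) + ∑ s, a s • ρ s := by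
    rw [← Finset.sum_add_distrib]
    exact Finset.sum_congr rfl fun s _ => by rw [smul_add, smul_smul]
  rw [h3, add_mul]
  exact (norm_add_le _ _).trans (add_le_add h1 h2)

end Perturbation

lemma norm_coupling_true (k : Plane) : ‖coupling u₁ V ED φ true k‖ =
    ‖twoIkDot k (vSharp u₁ φ) + bTerm u₁ V ED φ k‖ := by
  simp [coupling, sgn]

lemma norm_coupling_false (k : Plane) : ‖coupling u₁ V ED φ false k‖ =
    ‖twoIkDot k (vSharp u₁ φ) - bTerm u₁ V ED φ k‖ := by
  rw [← norm_neg]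
  simp [coupling, sgn, sub_eq_add_neg, add_comm]

namespace IsDiracState

variable [hu : Fact (u₁ ≠ 0)]

/-- Windows spanned by effective eigenvalues contain at least as many eigenvalues as effective
eigenvalues, up to an error of third order. -/
lemma exists_window (hφ : IsDiracState u₁ V ED φ) (hV : IsSuperHoneycomb u₁ V) {n : ℕ} (hdeg : FourfoldDegeneracy u₁ V n ED) :
    ∃ C ≥ 0, ∀ᶠ k in 𝓝 (0 : Plane), ∀ (B : EigenBasis hV k) (t t' : Bool × Bool)
      (S : Finset (Bool × Bool)) (T : Finset B.ι),
      modeEig u₁ V ED φ t k ≤ modeEig u₁ V ED φ t' k →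
      (∀ s ∈ S, modeEig u₁ V ED φ t k ≤ modeEig u₁ V ED φ s k ∧
        modeEig u₁ V ED φ s k ≤ modeEig u₁ V ED φ t' k) →
      (∀ i, ED + modeEig u₁ V ED φ t k - C * ‖k‖ ^ 3 ≤ B.eig i →
        B.eig i ≤ ED + modeEig u₁ V ED φ t' k + C * ‖k‖ ^ 3 → i ∈ T) →
      S.card ≤ T.card := by
  obtain ⟨M, hM0, hM⟩ := hφ.exists_bound hV
  -- From `norm_sum_smul_add_le` with `N = 2`, `δ = M‖k‖`, `η = M‖k‖³` and `r ≤ M‖k‖`: the term `r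
  -- N² δ²` gives `4 M³ ‖k‖³`, and `N η` gives `2 M ‖k‖³`.
  refine ⟨4 * M ^ 3 + 2 * M, by positivity, ?_⟩
  filter_upwards [hM] with k hk B t t' S T htt' hS hT
  set μ := fun s => modeEig u₁ V ED φ s k
  -- Half-width and centre of the effective window; centring brings it into the form required by
  -- `card_le_of_norm_sub_le`.
  set r₀ := (μ t' - μ t) / 2 with hr₀
  set m := (μ t' + μ t) / 2 with hm
  have hr₀0 : 0 ≤ r₀ := by rw [hr₀]; linarith
  have hr₀' : r₀ ≤ M * ‖k‖ := by
    have h1 := (abs_le.1 (hk t').2.2).2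
    have h2 := (abs_le.1 (hk t).2.2).1
    rw [hr₀]; linarith
  set p : S → smoothBloch u₁ 0 := fun s => hφ.mode s k + hφ.corr hV s k
  set v : S → CellL2 u₁ := fun s => blochToL2 0 (hφ.mode s k)
  set ψ : S → CellL2 u₁ := fun s => blochToL2 0 (hφ.corr hV s k)
  set ρ : S → CellL2 u₁ := fun s => blochToL2 0 (hφ.residual hV s k)
  have hv : Orthonormal ℂ v := (hφ.orthonormal_mode k).comp _ Subtype.val_injective
  have hvψ (s t : S) : ⟪v s, ψ t⟫_ℂ = 0 := hφ.inner_mode_corr hV s t k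
  have hp (s : S) : blochToL2 0 (p s) = v s + ψ s := map_add _ _ _
  have hsum (a : S → ℂ) : ∑ s, a s • blochToL2 k (phaseMap 0 k (p s)) =
      blochToL2 k (phaseMap 0 k (∑ s, a s • p s)) := by simp
  have hsum' (a : S → ℂ) : ‖∑ s, a s • blochToL2 k (phaseMap 0 k (p s))‖ =
      ‖∑ s, a s • (v s + ψ s)‖ := by
    rw [hsum, norm_phaseMap]
    simp [hp]
  have hz (s : S) : hamiltonian hV k (phaseMap 0 k (p s)) =
      phaseMap 0 k (((ED + μ s : ℝ) : ℂ) • p s + hφ.residual hV s k) := by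
    rw [hamiltonian_phaseMap, sub_zero, ← gradOp_apply, hφ.hamiltonian_mode_add_corr hV hdeg]
  have hlin : LinearIndependent ℂ fun s => blochToL2 k (phaseMap 0 k (p s)) := by
    rw [Fintype.linearIndependent_iff]
    intro a ha
    have h1 := hsum' a
    rw [ha, norm_zero] at h1
    exact Fintype.linearIndependent_iff.1 (linearIndependent_add hv hvψ) a
      (norm_eq_zero.1 h1.symm)
  have hcard : (Fintype.card S : ℝ) ≤ 2 ^ 2 := by
    rw [Fintype.card_coe]
    have h1 : S.card ≤ 4 := S.card_le_univ
    exact_mod_cast h1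
  have h := card_le_of_norm_sub_le B.basis (fun s => blochToL2 k (phaseMap 0 k (p s)))
    (fun s => blochToL2 k (hamiltonian hV k (phaseMap 0 k (p s)))) hlin B.eig
    (fun i s => B.inner_hamiltonian i _) (ED + m) (r₀ + (4 * M ^ 3 + 2 * M) * ‖k‖ ^ 3)
    (by positivity) T ?_ ?_
  · rwa [Fintype.card_coe] at h
  · intro i hi
    rw [abs_le] at hi
    refine hT i ?_ ?_
    · change ED + μ t - _ ≤ _
      linarith [hi.1]
    · change _ ≤ ED + μ t' + _
      linarith [hi.2]
  · intro a
    have h1 : ∑ s, a s • blochToL2 k (hamiltonian hV k (phaseMap 0 k (p s))) -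
        ((ED + m : ℝ) : ℂ) • ∑ s, a s • blochToL2 k (phaseMap 0 k (p s)) =
        blochToL2 k (phaseMap 0 k (∑ s, a s • (((μ s - m : ℝ) : ℂ) • p s +
          hφ.residual hV s k))) := by
      simp only [hz, map_sum, map_smul, map_add, Finset.smul_sum]
      rw [← Finset.sum_sub_distrib]
      refine Finset.sum_congr rfl fun s _ => ?_
      push_cast
      module
    rw [h1, norm_phaseMap, hsum']
    have h2 := norm_sum_smul_add_le (ρ := ρ) hv hvψ (δ := M * ‖k‖) (η := M * ‖k‖ ^ 3) (r := r₀)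
      (N := 2) (by positivity) hr₀0 hcard zero_le_two (fun s => (hk s).1) (fun s => (hk s).2.1)
      (d := fun s => μ s - m) (fun s => by
        have h3 := hS s s.2
        rw [abs_le]
        constructor <;> rw [hr₀, hm]
        · linarith [show μ t ≤ μ s from h3.1]
        · linarith [show μ s ≤ μ t' from h3.2]) a
    have h3 : blochToL2 0 (∑ s, a s • (((μ s - m : ℝ) : ℂ) • p s + hφ.residual hV s k)) =
        ∑ s, a s • (((μ s - m : ℝ) : ℂ) • (v s + ψ s) + ρ s) := by
      simp only [map_sum, map_smul, map_add, hp]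
      rfl
    rw [h3]
    refine h2.trans (mul_le_mul_of_nonneg_right ?_ (norm_nonneg _))
    have h4 : r₀ * (2 ^ 2 * (M * ‖k‖) ^ 2) ≤ M * ‖k‖ * (2 ^ 2 * (M * ‖k‖) ^ 2) :=
      mul_le_mul_of_nonneg_right hr₀' (by positivity)
    linarith

/-- The bands above the Dirac point follow the effective eigenvalues up to third order. -/
lemma exists_abs_band_sub_le (hφ : IsDiracState u₁ V ED φ) (hV : IsSuperHoneycomb u₁ V) {n : ℕ} (hdeg : FourfoldDegeneracy u₁ V n ED) :
    ∃ C, ∀ᶠ k in 𝓝 (0 : Plane), ∀ (t : Bool × Bool) (j : ℕ) (S S' : Finset (Bool × Bool)),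
      (∀ s ∈ S, modeEig u₁ V ED φ s k ≤ modeEig u₁ V ED φ t k) →
      (∀ s ∈ S', modeEig u₁ V ED φ t k ≤ modeEig u₁ V ED φ s k) →
      1 ≤ j → j ≤ S.card → 5 ≤ S'.card + j →
      |band u₁ V (n + j) k - (ED + modeEig u₁ V ED φ t k)| ≤ C * ‖k‖ ^ 3 := by
  obtain ⟨C, hC0, hC⟩ := hφ.exists_window hV hdeg
  obtain ⟨M, hM0, hM⟩ := hφ.exists_bound hV
  let B₀ := eigenBasis hV 0
  obtain ⟨d, hd, hd1, hd2⟩ := hdeg.exists_gap hV B₀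
  -- Half of the gap is kept: counts are compared from `0` to `k` at the lower edge and from `k` to
  -- `0` at the upper edge, each at the cost of `d / 2`.
  obtain ⟨δ₁, hδ₁, h₁⟩ := count_le_count_of_norm_le hV (ED - d) (half_pos hd)
  obtain ⟨δ₂, hδ₂, h₂⟩ := count_le_count_of_norm_le hV (ED + d / 2) (half_pos hd)
  have hsmall : ∀ᶠ k in 𝓝 (0 : Plane), M * ‖k‖ + C * ‖k‖ ^ 3 < d / 2 := by
    have hc : Continuous fun k : Plane => M * ‖k‖ + C * ‖k‖ ^ 3 := by fun_prop
    refine (hc.tendsto 0).eventually (gt_mem_nhds ?_)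
    simpa using half_pos hd
  refine ⟨C, ?_⟩
  filter_upwards [hC, hM, hsmall, Metric.ball_mem_nhds (0 : Plane) hδ₁,
    Metric.ball_mem_nhds (0 : Plane) hδ₂] with k hC hM hsmall hk₁ hk₂ t j S S' hS hS' hj hjS hjS'
  rw [mem_ball_zero_iff] at hk₁ hk₂
  let B := eigenBasis hV k
  have hn1 : n ≤ B.count (ED - d / 2) := by
    have := h₁ 0 k (by simpa using hk₁) B₀ B
    rw [show ED - d + d / 2 = ED - d / 2 by ring] at this
    exact hd1.trans this
  have hn2 : B.count (ED + d / 2) ≤ n + 4 := by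
    have := h₂ k 0 (by simpa using hk₂) B B₀
    rw [add_assoc, add_halves] at this
    exact this.trans hd2
  set μ := fun s => modeEig u₁ V ED φ s k
  have hμ (s : Bool × Bool) : |μ s| + C * ‖k‖ ^ 3 < d / 2 :=
    lt_of_le_of_lt (add_le_add_left (hM s).2.2 _) hsmall
  have hk0 : 0 ≤ C * ‖k‖ ^ 3 := by positivity
  obtain ⟨t₀, ht₀⟩ := Finite.exists_min μ
  obtain ⟨t₁, ht₁⟩ := Finite.exists_max μ
  rw [abs_le]
  constructor
  -- Lower bound. The window from `t` to the largest effective eigenvalue holds at least `S'.card ≥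
  -- 5 - j` eigenvalues above `E'` and up to `ED + d / 2`. At most `n + 4` are available there, so
  -- fewer than `n + j` lie at or below `E'`.
  · suffices ED + μ t - C * ‖k‖ ^ 3 ≤ band u₁ V (n + j) k by
      change -_ ≤ _ - (ED + μ t)
      linarith
    refine B.le_band fun E' hE' => ?_
    classical
    set T := (B.finite_setOf_eig_le (ED + d / 2)).toFinset.filter fun i => E' < B.eig i
    have hE'2 : E' ≤ ED + d / 2 := by linarith [le_abs_self (μ t), hμ t]
    have hT := B.card_le_count_sub hE'2 T fun i hi => by
      rw [Finset.mem_filter, Set.Finite.mem_toFinset] at hi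
      exact ⟨hi.2, hi.1⟩
    have hST := hC B t t₁ S' T (ht₁ t) (fun s hs => ⟨hS' s hs, ht₁ s⟩) fun i hi hi' => by
      rw [Finset.mem_filter, Set.Finite.mem_toFinset]
      refine ⟨?_, hE'.trans_le hi⟩
      change B.eig i ≤ ED + d / 2
      change _ ≤ ED + μ t₁ + _ at hi'
      linarith [le_abs_self (μ t₁), hμ t₁]
    omega
  -- Upper bound. The window from the smallest effective eigenvalue to `t` holds at least `j`
  -- eigenvalues above `ED - d / 2`, in addition to the `n` at or below it.
  · suffices band u₁ V (n + j) k ≤ ED + μ t + C * ‖k‖ ^ 3 by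
      change _ - (ED + μ t) ≤ _
      linarith
    refine B.band_le (by omega) ?_
    classical
    set T := (B.finite_setOf_eig_le (ED + μ t + C * ‖k‖ ^ 3)).toFinset.filter
      fun i => ED - d / 2 < B.eig i
    have hE : ED - d / 2 ≤ ED + μ t + C * ‖k‖ ^ 3 := by linarith [neg_abs_le (μ t), hμ t]
    have hT := B.card_le_count_sub hE T fun i hi => by
      rw [Finset.mem_filter, Set.Finite.mem_toFinset] at hi
      exact ⟨hi.2, hi.1⟩
    have hST := hC B t₀ t S T (ht₀ t) (fun s hs => ⟨ht₀ s, hS s hs⟩) fun i hi hi' => by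
      rw [Finset.mem_filter, Set.Finite.mem_toFinset]
      refine ⟨hi', lt_of_lt_of_le ?_ hi⟩
      change _ < ED + μ t₀ - _
      linarith [neg_abs_le (μ t₀), hμ t₀]
    omega

/-- The four bands in terms of the extremal couplings. -/
lemma exists_band_bounds (hφ : IsDiracState u₁ V ED φ) (hV : IsSuperHoneycomb u₁ V) {n : ℕ} (hdeg : FourfoldDegeneracy u₁ V n ED) :
    ∃ C, ∀ᶠ k in 𝓝 (0 : Plane),
      |band u₁ V (n + 1) k - (ED + (‖k‖ ^ 2 - (mTerm u₁ V ED φ k).re - muCheck₁ u₁ V ED φ k))| ≤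
        C * ‖k‖ ^ 3 ∧
      |band u₁ V (n + 2) k - (ED + (‖k‖ ^ 2 - (mTerm u₁ V ED φ k).re - muCheck₂ u₁ V ED φ k))| ≤
        C * ‖k‖ ^ 3 ∧
      |band u₁ V (n + 3) k - (ED + (‖k‖ ^ 2 - (mTerm u₁ V ED φ k).re + muCheck₂ u₁ V ED φ k))| ≤
        C * ‖k‖ ^ 3 ∧
      |band u₁ V (n + 4) k - (ED + (‖k‖ ^ 2 - (mTerm u₁ V ED φ k).re + muCheck₁ u₁ V ED φ k))| ≤
        C * ‖k‖ ^ 3 := by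
  obtain ⟨C, hC⟩ := hφ.exists_abs_band_sub_le hV hdeg
  refine ⟨C, ?_⟩
  filter_upwards [hC] with k hk
  -- `p` is the sector with the larger coupling. The effective eigenvalues are then ordered as `(p,
  -- false)`, `(!p, false)`, `(!p, true)`, `(p, true)`, also in case of ties.
  obtain ⟨p, hp1, hp2⟩ : ∃ p, ‖coupling u₁ V ED φ p k‖ = muCheck₁ u₁ V ED φ k ∧
      ‖coupling u₁ V ED φ (!p) k‖ = muCheck₂ u₁ V ED φ k := by
    rw [muCheck₁, muCheck₂, ← norm_coupling_true, ← norm_coupling_false]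
    rcases le_total ‖coupling u₁ V ED φ true k‖ ‖coupling u₁ V ED φ false k‖ with h | h
    · exact ⟨false, (max_eq_right h).symm, (min_eq_left h).symm⟩
    · exact ⟨true, (max_eq_left h).symm, (min_eq_right h).symm⟩
  have hle : muCheck₂ u₁ V ED φ k ≤ muCheck₁ u₁ V ED φ k := min_le_max
  have h0 : 0 ≤ muCheck₂ u₁ V ED φ k := le_min (norm_nonneg _) (norm_nonneg _)
  set a := ‖k‖ ^ 2 - (mTerm u₁ V ED φ k).re
  have e1 : modeEig u₁ V ED φ (p, false) k = a - muCheck₁ u₁ V ED φ k := by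
    rw [modeEig, hp1]; simp [sgn, sub_eq_add_neg, a]
  have e2 : modeEig u₁ V ED φ (!p, false) k = a - muCheck₂ u₁ V ED φ k := by
    rw [modeEig, hp2]; simp [sgn, sub_eq_add_neg, a]
  have e3 : modeEig u₁ V ED φ (!p, true) k = a + muCheck₂ u₁ V ED φ k := by
    rw [modeEig, hp2]; simp [sgn, a]
  have e4 : modeEig u₁ V ED φ (p, true) k = a + muCheck₁ u₁ V ED φ k := by
    rw [modeEig, hp1]; simp [sgn, a]
  -- For the `j`-th band `S` consists of the first `j` modes in this order and `S'` of the last `5 -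
  -- j`; they share the `j`-th mode.
  refine ⟨?_, ?_, ?_, ?_⟩
  · rw [← e1]
    refine hk (p, false) 1 {(p, false)} {(p, false), (!p, false), (!p, true), (p, true)} ?_ ?_
      le_rfl ?_ ?_
    · simp
    · simp only [Finset.mem_insert, Finset.mem_singleton]
      rintro s (rfl | rfl | rfl | rfl) <;> simp only [e1, e2, e3, e4] <;> linarith
    · simp
    · cases p <;> decide
  · rw [← e2]
    refine hk (!p, false) 2 {(p, false), (!p, false)} {(!p, false), (!p, true), (p, true)} ?_ ?_
      (by norm_num) ?_ ?_
    · simp only [Finset.mem_insert, Finset.mem_singleton]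
      rintro s (rfl | rfl) <;> simp only [e1, e2] <;> linarith
    · simp only [Finset.mem_insert, Finset.mem_singleton]
      rintro s (rfl | rfl | rfl) <;> simp only [e2, e3, e4] <;> linarith
    · cases p <;> decide
    · cases p <;> decide
  · rw [← e3]
    refine hk (!p, true) 3 {(p, false), (!p, false), (!p, true)} {(!p, true), (p, true)} ?_ ?_
      (by norm_num) ?_ ?_
    · simp only [Finset.mem_insert, Finset.mem_singleton]
      rintro s (rfl | rfl | rfl) <;> simp only [e1, e2, e3] <;> linarith
    · simp only [Finset.mem_insert, Finset.mem_singleton]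
      rintro s (rfl | rfl) <;> simp only [e3, e4] <;> linarith
    · cases p <;> decide
    · cases p <;> decide
  · rw [← e4]
    refine hk (p, true) 4 {(p, false), (!p, false), (!p, true), (p, true)} {(p, true)} ?_ ?_
      (by norm_num) ?_ ?_
    · simp only [Finset.mem_insert, Finset.mem_singleton]
      rintro s (rfl | rfl | rfl | rfl) <;> simp only [e1, e2, e3, e4] <;> linarith
    · simp
    · cases p <;> decide
    · simp

end IsDiracState

end

end SuperHoneycomb

end

/-! ### The conical expansion of the four bands. -/

open SuperHoneycomb in
theorem theorem3p1 (u₁ : Plane) (V : Plane → ℝ) (hV : IsSuperHoneycomb u₁ V)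
    (n : ℕ) (ED : ℝ) (hdeg : FourfoldDegeneracy u₁ V n ED)
    (φ : Plane → ℂ) (hφ : IsDiracState u₁ V ED φ)
    (hv : ‖vSharp u₁ φ‖ ≠ 0) :
    (∀ k : Plane, ‖twoIkDot k (vSharp u₁ φ)‖ = Real.sqrt 2 * ‖vSharp u₁ φ‖ * ‖k‖) ∧
    ((fun k : Plane => (band u₁ V (n + 1) k : ℂ) -
        ((ED : ℂ) - (muCheck₁ u₁ V ED φ k : ℂ) + (‖k‖ : ℂ) ^ 2 - mTerm u₁ V ED φ k))
      =O[𝓝 0] fun k : Plane => ‖k‖ ^ 3) ∧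
    ((fun k : Plane => (band u₁ V (n + 2) k : ℂ) -
        ((ED : ℂ) - (muCheck₂ u₁ V ED φ k : ℂ) + (‖k‖ : ℂ) ^ 2 - mTerm u₁ V ED φ k))
      =O[𝓝 0] fun k : Plane => ‖k‖ ^ 3) ∧
    ((fun k : Plane => (band u₁ V (n + 3) k : ℂ) -
        ((ED : ℂ) + (muCheck₂ u₁ V ED φ k : ℂ) + (‖k‖ : ℂ) ^ 2 - mTerm u₁ V ED φ k))
      =O[𝓝 0] fun k : Plane => ‖k‖ ^ 3) ∧
    ((fun k : Plane => (band u₁ V (n + 4) k : ℂ) -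
        ((ED : ℂ) + (muCheck₁ u₁ V ED φ k : ℂ) + (‖k‖ : ℂ) ^ 2 - mTerm u₁ V ED φ k))
      =O[𝓝 0] fun k : Plane => ‖k‖ ^ 3) := by
  have : Fact (u₁ ≠ 0) := ⟨hV.u_ne_zero⟩
  obtain ⟨C, hC⟩ := hφ.exists_band_bounds hV hdeg
  -- The second-order operator is symmetric, so `m(k)` is real and the complex remainders are casts
  -- of the real ones already bounded.
  have hm (k : Plane) : mTerm u₁ V ED φ k = ((mTerm u₁ V ED φ k).re : ℂ) :=
    (Complex.conj_eq_iff_re.1 (hφ.conj_mTerm hV)).symm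
  have key {f : Plane → ℂ} {x y : Plane → ℝ} (h : ∀ᶠ k in 𝓝 0, |x k - y k| ≤ C * ‖k‖ ^ 3)
      (hf : ∀ k, f k = ((x k - y k : ℝ) : ℂ)) : f =O[𝓝 0] fun k : Plane => ‖k‖ ^ 3 := by
    refine Asymptotics.IsBigO.of_bound C ?_
    filter_upwards [h] with k hk
    rwa [hf, Complex.norm_real, norm_pow, norm_norm]
  refine ⟨hφ.norm_twoIkDot, key (hC.mono fun k h => h.1) fun k => ?_,
    key (hC.mono fun k h => h.2.1) fun k => ?_, key (hC.mono fun k h => h.2.2.1) fun k => ?_,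
    key (hC.mono fun k h => h.2.2.2) fun k => ?_⟩ <;>
  · push_cast
    linear_combination hm k
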